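/- **Setting.** Let $\{G_n\}_{n\in\omega}$ be a sequence of groups, regarded as sharing one identity element $1$ and having no other element in common. A *word* is a function $W:\overline W\to\bigcup_n G_n$ on a totally ordered set $\overline W$ such that $\{i: W(i)\in G_n\}$ is finite for every $n$. Write $V\equiv W$ if $V$ and $W$ agree up to an order isomorphism of their domains. The word $W^{-1}$ has the reversed domain and inverted letters, $E$ is the empty word, and the concatenation $\prod_{\lambda}W_\lambda$ of words indexed by a totally ordered set has as its domain the ordered disjoint union of the domains $\overline{W_\lambda}$. If $W\equiv W_0W_1W_2$ for words $W_0,W_1,W_2$, then $W_1$ is called a *subword* of $W$. For $N\in\omega$ let $p_N(W)$ be the finite word consisting of the letters of $W$ that lie in $G_0\cup\dots\cup G_N$, and write $V\sim W$ if for every $N$ the words $p_N(V)$ and $p_N(W)$ are equal in the free product $G_0*\cdots*G_N$. The words modulo $\sim$ form a group under concatenation (the topologist's product). A word $W$ is *reduced* if every subword of $W$ that is $\sim E$ is empty and neighbouring letters of $W$ never lie in a common $G_n$. Every $\sim$-class contains exactly one reduced word up to $\equiv$; thus the set $\mathrm{Red}(\{G_n\})$ of reduced words is identified with the topologist's product.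 Let $[[W]]$ be the class of $W$ in the quotient of this group by the normal closure of the set of classes of finite words. For a family $\{W_x\}_{x\in X}$ of reduced words, $\mathrm{Fine}(\{W_x\})$ is the subgroup of $\mathrm{Red}(\{G_n\})$ generated by all subwords of the $W_x$. An *interval* of a totally ordered set is an order-convex subset. A subset of a totally ordered set $\Lambda$ is *close* in $\Lambda$ if it meets every infinite interval of $\Lambda$. A *coi* (close order isomorphism) $\iota$ from $\Lambda$ to $\Theta$ is an order isomorphism from a close subset $\Lambda_0$ of $\Lambda$ onto a close subset of $\Theta$. For an interval $I\subseteq\Lambda$ let $\varpropto(I,\iota)$ be the smallest interval of $\Theta$ that includes $\iota(I\cap\Lambda_0)$. Let $\{K_n\}_{n\in\omega}$ be a second sequence of groups. A *coi triple* $\mathrm{coi}(W,\iota,U)$ consists of $W\in\mathrm{Red}(\{G_n\})$, $U\in\mathrm{Red}(\{K_n\})$ and a coi $\iota$ from $\overline W$ to $\overline U$ (called a coi from $W$ to $U$). A collection of coi triples $\{\mathrm{coi}(W_x,\iota_x,U_x)\}_{x\in X}$ is *coherent* if for all $x,y\in X$ and $\delta\in\{1,-1\}$: * for all intervals $I\subseteq\overline{W_x}$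 and $J\subseteq\overline{W_y}$ with $W_x\upharpoonright I\equiv(W_y\upharpoonright J)^\delta$ we have $[[U_x\upharpoonright\varpropto(I,\iota_x)]]=[[(U_y\upharpoonright\varpropto(J,\iota_y))^\delta]]$; and * for all intervals $I\subseteq\overline{U_x}$ and $J\subseteq\overline{U_y}$ with $U_x\upharpoonright I\equiv(U_y\upharpoonright J)^\delta$ we have $[[W_x\upharpoonright\varpropto(I,\iota_x^{-1})]]=[[(W_y\upharpoonright\varpropto(J,\iota_y^{-1}))^\delta]]$. **Proposition.** Let $\{G_n\}_{n\in\omega}$ and $\{K_n\}_{n\in\omega}$ be sequences of groups, each of which has an element of infinite order. Let $\{\mathrm{coi}(W_x,\iota_x,U_x)\}_{x\in X}$ be a coherent collection of coi triples from $\mathrm{Red}(\{G_n\})$ to $\mathrm{Red}(\{K_n\})$ with $|X|<2^{\aleph_0}$. 1. If $W\in\mathrm{Red}(\{G_n\})$ satisfies $W\equiv\prod_{m\in\omega}W'_m$ with $W'_m\not\equiv E$ and $W'_m\in\mathrm{Fine}(\{W_x\}_{x\in X})$ for every $m\in\omega$, and $W\notin\mathrm{Fine}(\{W_x\}_{x\in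 X})$, then there are $U\in\mathrm{Red}(\{K_n\})$ and a coi $\iota$ from $W$ to $U$ such that $\{\mathrm{coi}(W_x,\iota_x,U_x)\}_{x\in X}\cup\{\mathrm{coi}(W,\iota,U)\}$ is coherent. 2. If $U\in\mathrm{Red}(\{K_n\})$ satisfies $U\equiv\prod_{m\in\omega}U'_m$ with $U'_m\not\equiv E$ and $U'_m\in\mathrm{Fine}(\{U_x\}_{x\in X})$ for every $m\in\omega$, and $U\notin\mathrm{Fine}(\{U_x\}_{x\in X})$, then there are $W\in\mathrm{Red}(\{G_n\})$ and a coi $\iota$ from $W$ to $U$ such that $\{\mathrm{coi}(W_x,\iota_x,U_x)\}_{x\in X}\cup\{\mathrm{coi}(W,\iota,U)\}$ is coherent. -/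

import Mathlib

universe u v w

namespace TopologistsProduct

/-! ### Letters -/

/-- The set of letters `⋃ n, G n`, where the groups `G n` share one identity element (`none`)
and have no other element in common. -/
abbrev Letter (G : ℕ → Type u) [∀ n, Group (G n)] : Type u :=
  Option (Σ n, {g : G n // g ≠ 1})

namespace Letter

variable {G : ℕ → Type u} [∀ n, Group (G n)]

/-- `a.InGroup n` says that the letter `a` lies in `G n`; the identity lies in every `G n`. -/
def InGroup (n : ℕ) : Letter G → Prop
  | none => True
  | some a => a.1 = n

/-- The inverse of a letter, formed in the group in which it lies. -/
def inv : Letter G → Letter G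
  | none => none
  | some a => some ⟨a.1, (a.2 : G a.1)⁻¹, inv_ne_one.mpr a.2.2⟩

theorem inGroup_inv (n : ℕ) (a : Letter G) : (inv a).InGroup n ↔ InGroup n a := by
  cases a <;> rfl

/-- A letter of `⋃ n ≤ N, G n` as an element of the free product of `G 0, …, G N`
(the value on the other letters is irrelevant). -/
noncomputable def toFree (N : ℕ) :
    Letter G → Monoid.CoprodI (fun n : Fin (N + 1) => G n)
  | none => 1
  | some a =>
    if h : a.1 < N + 1 then
      Monoid.CoprodI.of (M := fun n : Fin (N + 1) => G n) (i := ⟨a.1, h⟩) (a.2 : G a.1)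
    else 1

theorem toFree_inv (N : ℕ) (a : Letter G) : toFree N (inv a) = (toFree N a)⁻¹ := by
  cases a with
  | none => simp [toFree, inv]
  | some a =>
    by_cases h : a.1 < N + 1
    · simp only [toFree, inv, h, dite_true]
      exact map_inv
        (Monoid.CoprodI.of (M := fun n : Fin (N + 1) => G n) (i := ⟨a.1, h⟩)) (a.2 : G a.1)
    · simp [toFree, inv, h]

end Letter

/-! ### Words -/

/-- A word: a function from a totally ordered set to the set of letters that takes values in each
`G n` only finitely often. The domain is then countable, so every word is, up to isomorphism of
the domain, one whose domain is in `Type`. -/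
structure Word (G : ℕ → Type u) [∀ n, Group (G n)] where
  dom : Type
  [order : LinearOrder dom]
  letter : dom → Letter G
  finite_letters : ∀ n, {i | (letter i).InGroup n}.Finite

attribute [instance] Word.order

namespace Word

variable {G : ℕ → Type u} [∀ n, Group (G n)]

/-- `V ≡ W`: the words agree up to an order isomorphism of their domains. -/
def Same (V W : Word G) : Prop :=
  ∃ e : V.dom ≃o W.dom, ∀ i, V.letter i = W.letter (e i)

/-- The empty word `E`. -/
def empty : Word G where
  dom := Empty
  letter := Empty.elim
  finite_letters _ := Set.toFinite _

/-- The concatenation `V W`. -/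
def concat (V W : Word G) : Word G where
  dom := V.dom ⊕ₗ W.dom
  letter i := Sum.elim V.letter W.letter (ofLex i)
  finite_letters n := by
    refine (((V.finite_letters n).image (fun i => toLex (Sum.inl i))).union
      ((W.finite_letters n).image (fun i => toLex (Sum.inr i)))).subset ?_
    intro i hi
    obtain ⟨j, rfl⟩ := toLex.surjective i
    rcases j with j | j
    · exact Or.inl ⟨j, hi, rfl⟩
    · exact Or.inr ⟨j, hi, rfl⟩

/-- The inverse word `W⁻¹`: reversed domain, inverted letters. -/
def inv (W : Word G) : Word G where
  dom := W.domᵒᵈ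
  letter i := (W.letter (OrderDual.ofDual i)).inv
  finite_letters n := by
    refine ((W.finite_letters n).image OrderDual.toDual).subset ?_
    intro i hi
    exact ⟨OrderDual.ofDual i, (Letter.inGroup_inv n _).mp hi, rfl⟩

/-- `W ^ δ` for a sign `δ`. -/
def signed (W : Word G) (δ : ℤˣ) : Word G := if δ = 1 then W else W.inv

/-- The restriction `W ↾ S`. -/
def restrict (W : Word G) (S : Set W.dom) : Word G where
  dom := S
  letter i := W.letter i
  finite_letters n := (W.finite_letters n).preimage Subtype.val_injective.injOn

/-- `W ≡ ∏ m, V m`, where the (possibly non-word) right-hand side has as domain the disjoint union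
of the domains of the `V m`, ordered lexicographically. -/
def IsOmegaConcat (W : Word G) (V : ℕ → Word G) : Prop :=
  ∃ e : W.dom ≃o (Σₗ m, (V m).dom), ∀ i,
    W.letter i = (V (ofLex (e i)).1).letter (ofLex (e i)).2

theorem finite_le (W : Word G) (N : ℕ) :
    {i | ∃ n ≤ N, (W.letter i).InGroup n}.Finite := by
  refine ((Set.finite_Iic N).biUnion (fun n _ => W.finite_letters n)).subset ?_
  rintro i ⟨n, hn, hi⟩
  exact Set.mem_biUnion (Set.mem_Iic.mpr hn) hi

/-- The finite domain of the word `p_N(W)`, which keeps the letters from `G 0, …, G N` only. -/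
noncomputable def support (W : Word G) (N : ℕ) : Finset W.dom := (W.finite_le N).toFinset

/-- The element of the free product of `G 0, …, G N` given by the finite word `p_N(W)`. -/
noncomputable def proj (N : ℕ) (W : Word G) : Monoid.CoprodI (fun n : Fin (N + 1) => G n) :=
  (((W.support N).sort (· ≤ ·)).map (fun i => (W.letter i).toFree N)).prod

/-- `V ∼ W`: for every `N`, `p_N(V)` and `p_N(W)` are equal in the free product of
`G 0, …, G N`. -/
def Equivalent (V W : Word G) : Prop := ∀ N, proj N V = proj N W

/-- `V` is a subword of `W`. -/
def IsSubword (V W : Word G) : Prop :=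
  ∃ W₀ W₂ : Word G, W.Same (concat W₀ (concat V W₂))

/-- `W` is reduced: a subword that is `∼ E` is empty, and neighbouring letters never lie in a
common `G n`. -/
def IsReduced (W : Word G) : Prop :=
  (∀ V : Word G, V.IsSubword W → V.Equivalent empty → V.Same empty) ∧
  ∀ i j : W.dom, i ⋖ j → ¬ ∃ n, (W.letter i).InGroup n ∧ (W.letter j).InGroup n

theorem proj_eq (N : ℕ) (W : Word G) (l : List W.dom) (h : l.Pairwise (· < ·))
    (hl : ∀ i, i ∈ l ↔ ∃ n ≤ N, (W.letter i).InGroup n) :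
    proj N W = (l.map (fun i => (W.letter i).toFree N)).prod := by
  classical
  have hnd : l.Nodup := h.imp (fun hab => ne_of_lt hab)
  have hs : W.support N = l.toFinset := by
    ext a
    rw [List.mem_toFinset, hl, support, Set.Finite.mem_toFinset]
    rfl
  rw [proj, hs, (List.toFinset_sort (· ≤ ·) hnd).mpr (h.imp le_of_lt)]

theorem mem_support (N : ℕ) (W : Word G) (i : W.dom) :
    i ∈ (W.support N).sort (· ≤ ·) ↔ ∃ n ≤ N, (W.letter i).InGroup n := by
  rw [Finset.mem_sort, support, Set.Finite.mem_toFinset]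
  rfl

theorem proj_empty (N : ℕ) : proj N (empty : Word G) = 1 :=
  proj_eq N empty [] List.Pairwise.nil (fun i => i.elim)

theorem proj_concat (N : ℕ) (V W : Word G) :
    proj N (concat V W) = proj N V * proj N W := by
  let f : V.dom → (concat V W).dom := fun i => toLex (Sum.inl i)
  let g : W.dom → (concat V W).dom := fun i => toLex (Sum.inr i)
  have hf : ∀ a b, a < b → f a < f b := fun a b hab => Sum.Lex.inl_lt_inl_iff.mpr hab
  have hg : ∀ a b, a < b → g a < g b := fun a b hab => Sum.Lex.inr_lt_inr_iff.mpr hab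
  have hfg : ∀ a b, f a < g b := fun a b => Sum.Lex.inl_lt_inr a b
  have hcase : ∀ i : (concat V W).dom, (∃ a, f a = i) ∨ ∃ b, g b = i := by
    intro i
    obtain ⟨j, rfl⟩ := toLex.surjective i
    rcases j with j | j
    · exact Or.inl ⟨j, rfl⟩
    · exact Or.inr ⟨j, rfl⟩
  have hfi : ∀ a, (concat V W).letter (f a) = V.letter a := fun _ => rfl
  have hgi : ∀ b, (concat V W).letter (g b) = W.letter b := fun _ => rfl
  rw [proj_eq N (concat V W) (((V.support N).sort (· ≤ ·)).map f ++
    ((W.support N).sort (· ≤ ·)).map g)]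
  · rw [List.map_append, List.prod_append, List.map_map, List.map_map]
    rfl
  · refine List.pairwise_append.mpr ⟨?_, ?_, ?_⟩
    · exact List.Pairwise.map f hf (Finset.sortedLT_sort _).pairwise
    · exact List.Pairwise.map g hg (Finset.sortedLT_sort _).pairwise
    · intro a ha b hb
      obtain ⟨a, -, rfl⟩ := List.mem_map.mp ha
      obtain ⟨b, -, rfl⟩ := List.mem_map.mp hb
      exact hfg a b
  · intro i
    rw [List.mem_append, List.mem_map, List.mem_map]
    constructor
    · rintro (⟨a, ha, rfl⟩ | ⟨b, hb, rfl⟩)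
      · rw [hfi]; exact (mem_support N V a).mp ha
      · rw [hgi]; exact (mem_support N W b).mp hb
    · intro h
      rcases hcase i with ⟨a, rfl⟩ | ⟨b, rfl⟩
      · exact Or.inl ⟨a, (mem_support N V a).mpr (by rwa [hfi] at h), rfl⟩
      · exact Or.inr ⟨b, (mem_support N W b).mpr (by rwa [hgi] at h), rfl⟩

theorem proj_inv (N : ℕ) (W : Word G) : proj N (inv W) = (proj N W)⁻¹ := by
  let f : W.dom → (inv W).dom := OrderDual.toDual
  have hf : ∀ a b, a < b → f b < f a := fun a b hab => OrderDual.toDual_lt_toDual.mpr hab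
  have hfi : ∀ a, (inv W).letter (f a) = (W.letter a).inv := fun _ => rfl
  rw [proj_eq N (inv W) (((W.support N).sort (· ≤ ·)).map f).reverse]
  · rw [proj, List.prod_inv_reverse, List.map_reverse, List.map_map, List.map_map]
    congr 2
    exact List.map_congr_left (fun i _ => Letter.toFree_inv N _)
  · rw [List.pairwise_reverse]
    exact List.Pairwise.map f hf (Finset.sortedLT_sort _).pairwise
  · intro i
    obtain ⟨a, rfl⟩ : ∃ a, f a = i := OrderDual.toDual.surjective i
    rw [List.mem_reverse, List.mem_map]
    simp only [hfi, Letter.inGroup_inv]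
    constructor
    · rintro ⟨b, hb, hba⟩
      obtain rfl : b = a := hba
      exact (mem_support N W b).mp hb
    · intro h
      exact ⟨a, (mem_support N W a).mpr h, rfl⟩

/-- The equivalence relation `∼` on words. -/
instance setoid (G : ℕ → Type u) [∀ n, Group (G n)] : Setoid (Word G) where
  r := Equivalent
  iseqv := ⟨fun _ _ => rfl, fun h N => (h N).symm, fun h h' N => (h N).trans (h' N)⟩

end Word

/-! ### The topologist's product and its quotient by finite words -/

/-- The topologist's product of the groups `G n`: words modulo `∼`. -/
def TopProd (G : ℕ → Type u) [∀ n, Group (G n)] : Type (max 1 u) := Quotient (Word.setoid G)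

namespace TopProd

variable {G : ℕ → Type u} [∀ n, Group (G n)]

/-- The `∼`-class of a word. -/
def mk (W : Word G) : TopProd G := Quotient.mk (Word.setoid G) W

instance : Group (TopProd G) where
  mul := Quotient.map₂ Word.concat (fun V V' h W W' h' N => by
    rw [Word.proj_concat, Word.proj_concat, h N, h' N])
  one := mk Word.empty
  inv := Quotient.map Word.inv (fun V V' h N => by
    rw [Word.proj_inv, Word.proj_inv, h N])
  mul_assoc a b c := by
    induction a using Quotient.inductionOn
    induction b using Quotient.inductionOn
    induction c using Quotient.inductionOn
    exact Quotient.sound (fun N => by simp only [Word.proj_concat, mul_assoc])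
  one_mul a := by
    induction a using Quotient.inductionOn
    exact Quotient.sound (fun N => by simp only [Word.proj_concat, Word.proj_empty, one_mul])
  mul_one a := by
    induction a using Quotient.inductionOn
    exact Quotient.sound (fun N => by simp only [Word.proj_concat, Word.proj_empty, mul_one])
  inv_mul_cancel a := by
    induction a using Quotient.inductionOn
    exact Quotient.sound (fun N => by
      simp only [Word.proj_concat, Word.proj_inv, Word.proj_empty, inv_mul_cancel])

end TopProd

/-- The quotient of the topologist's product by the normal closure of the free product of the
`G n`, that is, of the set of classes of finite words. -/
abbrev ArchQuot (G : ℕ → Type u) [∀ n, Group (G n)] : Type (max 1 u) :=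
  TopProd G ⧸ Subgroup.normalClosure
    {a : TopProd G | ∃ W : Word G, Finite W.dom ∧ TopProd.mk W = a}

section

variable {G : ℕ → Type u} [∀ n, Group (G n)]

/-- The class `[[W]]` of a word in the quotient by finite words. -/
def Word.cls (W : Word G) : ArchQuot G := QuotientGroup.mk (TopProd.mk W)

end

/-- The reduced words. Every `∼`-class contains a reduced word, unique up to `≡`, so that
(reduced words up to `≡`) are identified with `TopProd G` by means of `TopProd.mk`. -/
abbrev Red (G : ℕ → Type u) [∀ n, Group (G n)] : Type (max 1 u) :=
  {W : Word G // W.IsReduced}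

/-- `Fine ({W x})`: the reduced words that lie in the subgroup generated by all the subwords of
the `W x`. -/
def Fine {G : ℕ → Type u} [∀ n, Group (G n)] {X : Type w} (W : X → Red G) : Set (Red G) :=
  {V | TopProd.mk V.1 ∈ Subgroup.closure
    {a : TopProd G | ∃ (x : X) (S : Word G), S.IsSubword (W x).1 ∧ TopProd.mk S = a}}

/-! ### Close order isomorphisms and coherent collections -/

/-- `Λ₀` is close in `Λ`: it meets every infinite interval (order-convex subset) of `Λ`. -/
def IsClose {Λ : Type*} [LinearOrder Λ] (Λ₀ : Set Λ) : Prop :=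
  ∀ I : Set Λ, I.OrdConnected → I.Infinite → (I ∩ Λ₀).Nonempty

/-- A close order isomorphism (coi) from `Λ` to `Θ`: an order isomorphism from a close subset of
`Λ` onto a close subset of `Θ`. -/
structure Coi (Λ Θ : Type*) [LinearOrder Λ] [LinearOrder Θ] where
  source : Set Λ
  target : Set Θ
  close_source : IsClose source
  close_target : IsClose target
  iso : source ≃o target

namespace Coi

variable {Λ Θ : Type*} [LinearOrder Λ] [LinearOrder Θ]

/-- The inverse of a coi. -/
def symm (ι : Coi Λ Θ) : Coi Θ Λ := ⟨ι.target, ι.source, ι.close_target, ι.close_source, ι.iso.symm⟩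

/-- `∝(I, ι)`: the smallest interval of `Θ` that includes the image under `ι` of `I`. -/
def hull (ι : Coi Λ Θ) (I : Set Λ) : Set Θ :=
  {θ | ∃ a b : ι.source, (a : Λ) ∈ I ∧ (b : Λ) ∈ I ∧ (ι.iso a : Θ) ≤ θ ∧ θ ≤ (ι.iso b : Θ)}

end Coi

/-- A coi triple `coi(W, ι, U)`: reduced words `W`, `U` and a coi `ι` from the domain of `W` to
the domain of `U`. -/
structure CoiTriple (G : ℕ → Type u) (K : ℕ → Type v) [∀ n, Group (G n)] [∀ n, Group (K n)] where
  left : Red G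
  right : Red K
  coi : Coi left.1.dom right.1.dom

/-- The triple `coi(U, ι⁻¹, W)`. -/
def CoiTriple.symm {G : ℕ → Type u} {K : ℕ → Type v} [∀ n, Group (G n)] [∀ n, Group (K n)]
    (t : CoiTriple G K) : CoiTriple K G := ⟨t.right, t.left, t.coi.symm⟩

/-- The condition of coherence for a pair of triples, from the left words to the right words. -/
def CoiTriple.Agree {G : ℕ → Type u} {K : ℕ → Type v} [∀ n, Group (G n)] [∀ n, Group (K n)]
    (t₀ t₁ : CoiTriple G K) : Prop :=
  ∀ (I₀ : Set t₀.left.1.dom) (I₁ : Set t₁.left.1.dom), I₀.OrdConnected → I₁.OrdConnected →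
    ∀ δ : ℤˣ, (t₀.left.1.restrict I₀).Same ((t₁.left.1.restrict I₁).signed δ) →
      (t₀.right.1.restrict (t₀.coi.hull I₀)).cls =
        ((t₁.right.1.restrict (t₁.coi.hull I₁)).signed δ).cls

/-- A collection of coi triples is coherent. -/
def Coherent {G : ℕ → Type u} {K : ℕ → Type v} [∀ n, Group (G n)] [∀ n, Group (K n)]
    (T : Set (CoiTriple G K)) : Prop :=
  ∀ t₀ ∈ T, ∀ t₁ ∈ T, t₀.Agree t₁ ∧ t₀.symm.Agree t₁.symm

end TopologistsProduct

open TopologistsProduct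

namespace TopologistsProduct

/-! ### Signed comparison and matching of words -/

/-! Coherence is preserved when every coi of a collection is inverted, so only the first half needs
an argument.

Decomposition. Each factor `W'_m` of `W` lies in the group generated by the subwords of the `W_x`,
so some finite concatenation of intervals of words `W_x^{±1}`, followed by the inverse of the
factor, is a word equal to `1`. Such a word carries a noncrossing equivalence relation on its
letters along which everything cancels: `exists_cancellation` obtains it from normal forms in the
finite free products and an ultrafilter limit. The intervals and the factor are reduced, so a class
meets each of them at most once. Hence, up to finitely many letters, the factor splits into finitely
many intervals, each matched letter by letter with an interval of some `W_x^{±1}`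
(`Cancellation.exists_cover`, `Word.exists_piece_cover`). Further cuts make the corresponding
intervals of the `U_x` avoid any prescribed finite set of groups (`exists_piece_decomposition`).

Construction. `U` is the concatenation over `k` of `z_k Q_k`, where `Q_k` copies the part of some
`U_x` corresponding to the `k`-th piece (it is empty for a finite piece) and `z_k` is a new letter,
a positive power of an element of infinite order. Positivity and a suitable choice of the groups
make `U` reduced (`Interleaved.isReduced`). The exponents encode a binary sequence. If a final
segment of `U` were matched with an interval of some `U_x`, then `x` and countably many data would
determine the sequence; as `|X| < 2^ℵ₀`, some sequence has no such match
(`Word.exists_reduced_interleaved`).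

Coherence. Modulo finite words, the value of an interval is multiplicative (`CoiTriple.val_union`),
so intervals that meet finitely many pieces inherit agreement from the family. A cofinal interval of
`W` matches no interval of a `W_x` because `W` is not in `Fine`, and the analogue for `U` holds by
its choice. Two cofinal intervals of the same word can only be matched with sign `1`, and then by
the identity, because every letter occurs finitely often; the remaining matches reduce to bounded
intervals (`Assembled.coherent`). -/

/-- `a < b` or `b < a`, according to the sign `δ`. -/
def SignedLT {D : Type*} [LT D] (δ : ℤˣ) (a b : D) : Prop := if δ = 1 then a < b else b < a

@[simp] theorem signedLT_one {D : Type*} [LT D] (a b : D) : SignedLT 1 a b ↔ a < b := by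
  simp [SignedLT]

@[simp] theorem signedLT_neg_one {D : Type*} [LT D] (a b : D) : SignedLT (-1) a b ↔ b < a := by
  simp [SignedLT]

theorem SignedLT.ne {D : Type*} [LinearOrder D] {δ : ℤˣ} {a b : D} (h : SignedLT δ a b) :
    a ≠ b := by
  rcases Int.units_eq_one_or δ with rfl | rfl
  · exact ((signedLT_one _ _).mp h).ne
  · exact ((signedLT_neg_one _ _).mp h).ne'

namespace Letter

variable {G : ℕ → Type u} [∀ n, Group (G n)]

theorem inv_inv (a : Letter G) : inv (inv a) = a := by
  rcases a with _ | ⟨n, g, hg⟩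
  · rfl
  · simp [inv]

/-- The letter `a ^ δ` for a sign `δ`. -/
def signed (δ : ℤˣ) (a : Letter G) : Letter G := if δ = 1 then a else a.inv

@[simp] theorem signed_one (a : Letter G) : signed 1 a = a := by simp [signed]

@[simp] theorem signed_neg_one (a : Letter G) : signed (-1) a = a.inv := by simp [signed]

theorem signed_signed (δ ε : ℤˣ) (a : Letter G) : signed ε (signed δ a) = signed (δ * ε) a := by
  rcases Int.units_eq_one_or δ with rfl | rfl <;> rcases Int.units_eq_one_or ε with rfl | rfl <;>
    simp [inv_inv]

theorem signed_signed_self (δ : ℤˣ) (a : Letter G) : signed δ (signed δ a) = a := by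
  rw [signed_signed, Int.units_mul_self, signed_one]

@[simp] theorem inGroup_signed (n : ℕ) (δ : ℤˣ) (a : Letter G) :
    (signed δ a).InGroup n ↔ a.InGroup n := by
  rcases Int.units_eq_one_or δ with rfl | rfl <;> simp [inGroup_inv]

theorem InGroup.unique {n m : ℕ} {a : Letter G} (ha : a ≠ none) (hn : a.InGroup n)
    (hm : a.InGroup m) : n = m := by
  rcases a with _ | a
  · exact absurd rfl ha
  · exact (show a.1 = n from hn).symm.trans hm

theorem exists_inGroup (a : Letter G) : ∃ n, a.InGroup n := by
  rcases a with _ | a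
  · exact ⟨0, trivial⟩
  · exact ⟨a.1, rfl⟩

end Letter

namespace Word

variable {G : ℕ → Type u} [∀ n, Group (G n)]

/-- On the set `A`, the map `f` preserves (`δ = 1`) or reverses (`δ = -1`) the order, and carries
letters of `V` to letters of `W` or to their inverses, accordingly. -/
structure IsMatch (V W : Word G) (δ : ℤˣ) (f : V.dom → W.dom) (A : Set V.dom) : Prop where
  lt : ∀ ⦃a⦄, a ∈ A → ∀ ⦃b⦄, b ∈ A → a < b → SignedLT δ (f a) (f b)
  letter : ∀ ⦃a⦄, a ∈ A → W.letter (f a) = (V.letter a).signed δ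

namespace IsMatch

variable {V W Z : Word G} {δ ε : ℤˣ} {f : V.dom → W.dom} {A B : Set V.dom}

theorem mono (h : IsMatch V W δ f A) (hB : B ⊆ A) : IsMatch V W δ f B :=
  ⟨fun _ ha _ hb => h.lt (hB ha) (hB hb), fun _ ha => h.letter (hB ha)⟩

theorem injOn (h : IsMatch V W δ f A) : Set.InjOn f A := by
  intro a ha b hb hab
  rcases lt_trichotomy a b with hlt | heq | hlt
  · exact absurd hab (h.lt ha hb hlt).ne
  · exact heq
  · exact absurd hab.symm (h.lt hb ha hlt).ne

theorem lt_iff (h : IsMatch V W δ f A) {a b : V.dom} (ha : a ∈ A) (hb : b ∈ A) :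
    a < b ↔ SignedLT δ (f a) (f b) := by
  refine ⟨h.lt ha hb, fun hab => ?_⟩
  rcases lt_trichotomy a b with hlt | rfl | hlt
  · exact hlt
  · exact absurd rfl hab.ne
  · have := h.lt hb ha hlt
    rcases Int.units_eq_one_or δ with rfl | rfl
    · simp only [signedLT_one] at this hab; exact absurd this hab.asymm
    · simp only [signedLT_neg_one] at this hab; exact absurd this hab.asymm

theorem exists_leftInv [Nonempty V.dom] (h : IsMatch V W δ f A) :
    ∃ g : W.dom → V.dom, ∀ a ∈ A, g (f a) = a :=
  ⟨Function.invFunOn f A, fun _ ha => h.injOn.leftInvOn_invFunOn ha⟩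

theorem symm (h : IsMatch V W δ f A) {g : W.dom → V.dom} (hg : ∀ a ∈ A, g (f a) = a) :
    IsMatch W V δ g (f '' A) := by
  constructor
  · rintro _ ⟨a, ha, rfl⟩ _ ⟨b, hb, rfl⟩ hab
    rw [hg a ha, hg b hb]
    rcases Int.units_eq_one_or δ with rfl | rfl
    · rw [signedLT_one, h.lt_iff ha hb]; simpa using hab
    · rw [signedLT_neg_one, h.lt_iff hb ha]; simpa using hab
  · rintro _ ⟨a, ha, rfl⟩
    rw [hg a ha, h.letter ha, Letter.signed_signed_self]

theorem image_image {g : W.dom → V.dom} (hg : ∀ a ∈ A, g (f a) = a) : g '' (f '' A) = A := by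
  ext a
  constructor
  · rintro ⟨_, ⟨b, hb, rfl⟩, rfl⟩; rwa [hg b hb]
  · intro ha; exact ⟨f a, ⟨a, ha, rfl⟩, hg a ha⟩

theorem comp (h : IsMatch V W δ f A) {g : W.dom → Z.dom} (h' : IsMatch W Z ε g (f '' A)) :
    IsMatch V Z (δ * ε) (g ∘ f) A := by
  constructor
  · intro a ha b hb hab
    have h1 := h.lt ha hb hab
    rcases Int.units_eq_one_or δ with rfl | rfl
    · have := h'.lt ⟨a, ha, rfl⟩ ⟨b, hb, rfl⟩ (by simpa using h1)
      simpa using this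
    · have := h'.lt ⟨b, hb, rfl⟩ ⟨a, ha, rfl⟩ (by simpa using h1)
      rcases Int.units_eq_one_or ε with rfl | rfl
      · simpa using this
      · simpa using this
  · intro a ha
    simp only [Function.comp]
    rw [h'.letter ⟨a, ha, rfl⟩, h.letter ha, Letter.signed_signed]

/-- Betweenness, unlike the order, is insensitive to the sign. Through this lemma and `between`,
intervals are transported without a case distinction on `δ`. -/
theorem lt_or_lt (h : IsMatch V W δ f A) {a b c : V.dom} (ha : a ∈ A) (hb : b ∈ A) (hc : c ∈ A)
    (hab : f a < f b) (hbc : f b < f c) : (a < b ∧ b < c) ∨ (c < b ∧ b < a) := by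
  rcases Int.units_eq_one_or δ with rfl | rfl
  · left; rw [h.lt_iff ha hb, h.lt_iff hb hc]; simpa using ⟨hab, hbc⟩
  · right; rw [h.lt_iff hc hb, h.lt_iff hb ha]; simpa using ⟨hbc, hab⟩

theorem between (h : IsMatch V W δ f A) {a b c : V.dom} (ha : a ∈ A) (hb : b ∈ A) (hc : c ∈ A)
    (hab : a < b) (hbc : b < c) : (f a < f b ∧ f b < f c) ∨ (f c < f b ∧ f b < f a) := by
  have h1 := h.lt ha hb hab
  have h2 := h.lt hb hc hbc
  rcases Int.units_eq_one_or δ with rfl | rfl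
  · left; simpa using ⟨h1, h2⟩
  · right; simpa using ⟨h2, h1⟩

theorem ordConnected_image (h : IsMatch V W δ f A) (hA : (f '' A).OrdConnected) (hBA : B ⊆ A)
    (hB : B.OrdConnected) : (f '' B).OrdConnected := by
  rw [Set.ordConnected_iff]
  rintro _ ⟨a, ha, rfl⟩ _ ⟨c, hc, rfl⟩ - w ⟨h1, h2⟩
  obtain ⟨b, hb, rfl⟩ := hA.out ⟨a, hBA ha, rfl⟩ ⟨c, hBA hc, rfl⟩ ⟨h1, h2⟩
  rcases eq_or_lt_of_le h1 with h1 | h1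
  · rw [← h1]; exact ⟨a, ha, rfl⟩
  rcases eq_or_lt_of_le h2 with h2 | h2
  · rw [h2]; exact ⟨c, hc, rfl⟩
  refine ⟨b, ?_, rfl⟩
  rcases h.lt_or_lt (hBA ha) hb (hBA hc) h1 h2 with h3 | h3
  · exact hB.out ha hc ⟨h3.1.le, h3.2.le⟩
  · exact hB.out hc ha ⟨h3.1.le, h3.2.le⟩

theorem ordConnected_preimage (h : IsMatch V W δ f A) (hA : A.OrdConnected) {S : Set W.dom}
    (hS : S.OrdConnected) : (A ∩ f ⁻¹' S).OrdConnected := by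
  rw [Set.ordConnected_iff]
  rintro a ⟨ha, has⟩ c ⟨hc, hcs⟩ - b ⟨h1, h2⟩
  have hb : b ∈ A := hA.out ha hc ⟨h1, h2⟩
  refine ⟨hb, ?_⟩
  rcases eq_or_lt_of_le h1 with rfl | h1
  · exact has
  rcases eq_or_lt_of_le h2 with rfl | h2
  · exact hcs
  rcases h.between ha hb hc h1 h2 with h3 | h3
  · exact hS.out has hcs ⟨h3.1.le, h3.2.le⟩
  · exact hS.out hcs has ⟨h3.1.le, h3.2.le⟩

end IsMatch

theorem signed_neg_one (W : Word G) : W.signed (-1) = W.inv := by simp [signed]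

theorem signed_one (W : Word G) : W.signed 1 = W := by simp [signed]

theorem Same.symm {V W : Word G} (h : V.Same W) : W.Same V := by
  obtain ⟨e, he⟩ := h
  exact ⟨e.symm, fun i => by rw [he, e.apply_symm_apply]⟩

theorem same_of_strictMono {V W : Word G} (f : V.dom → W.dom) (hf : StrictMono f)
    (hs : Function.Surjective f) (hl : ∀ i, V.letter i = W.letter (f i)) : V.Same W :=
  ⟨hf.orderIsoOfSurjective f hs, hl⟩

theorem IsMatch.same {V W : Word G} {δ : ℤˣ} {f : V.dom → W.dom} {A : Set V.dom}
    (h : IsMatch V W δ f A) : (V.restrict A).Same ((W.restrict (f '' A)).signed δ) := by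
  rcases Int.units_eq_one_or δ with rfl | rfl
  · rw [signed_one]
    refine same_of_strictMono (fun a => (⟨f a.1, a.1, a.2, rfl⟩ : f '' A)) ?_ ?_ ?_
    · intro a b hab
      exact (signedLT_one _ _).mp (h.lt a.2 b.2 hab)
    · rintro ⟨_, a, ha, rfl⟩; exact ⟨⟨a, ha⟩, rfl⟩
    · intro a
      have := h.letter a.2
      rw [Letter.signed_one] at this
      exact this.symm
  · rw [signed_neg_one]
    refine same_of_strictMono
      (fun a => OrderDual.toDual (⟨f a.1, a.1, a.2, rfl⟩ : f '' A)) ?_ ?_ ?_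
    · intro a b hab
      exact (signedLT_neg_one _ _).mp (h.lt a.2 b.2 hab)
    · rintro ⟨_, a, ha, rfl⟩; exact ⟨⟨a, ha⟩, rfl⟩
    · intro a
      have := h.letter a.2
      change V.letter a.1 = (W.letter (f a.1)).inv
      rw [this, Letter.signed_neg_one, Letter.inv_inv]

/-- The map `f` is total, with an arbitrary value of the isomorphism as default off `A`. This is why
`A` must be nonempty: otherwise `W` could have no letters at all. -/
theorem exists_isMatch_of_same {V W : Word G} {δ : ℤˣ} {A : Set V.dom} {B : Set W.dom}
    (hA : A.Nonempty) (h : (V.restrict A).Same ((W.restrict B).signed δ)) :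
    ∃ f : V.dom → W.dom, IsMatch V W δ f A ∧ f '' A = B := by
  classical
  rcases Int.units_eq_one_or δ with rfl | rfl
  · rw [signed_one] at h
    obtain ⟨e, he⟩ := h
    obtain ⟨a₀, ha₀⟩ := hA
    let e' : A ≃o B := e
    obtain ⟨f, key⟩ : ∃ f : V.dom → W.dom, ∀ a (ha : a ∈ A), f a = e' ⟨a, ha⟩ :=
      ⟨fun a => if h : a ∈ A then (e' ⟨a, h⟩ : W.dom) else (e' ⟨a₀, ha₀⟩ : W.dom),
        fun a ha => dif_pos ha⟩
    refine ⟨f, ⟨?_, ?_⟩, ?_⟩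
    · intro a ha b hb hab
      rw [signedLT_one, key a ha, key b hb]
      exact e'.strictMono (show (⟨a, ha⟩ : A) < ⟨b, hb⟩ from hab)
    · intro a ha
      rw [key a ha, Letter.signed_one]
      exact (he ⟨a, ha⟩).symm
    · ext b
      constructor
      · rintro ⟨a, ha, rfl⟩
        rw [key a ha]; exact (e' ⟨a, ha⟩).2
      · intro hb
        refine ⟨(e'.symm ⟨b, hb⟩).1, (e'.symm ⟨b, hb⟩).2, ?_⟩
        rw [key _ (e'.symm ⟨b, hb⟩).2]
        exact congrArg Subtype.val (e'.apply_symm_apply ⟨b, hb⟩)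
  · rw [signed_neg_one] at h
    obtain ⟨e, he⟩ := h
    obtain ⟨a₀, ha₀⟩ := hA
    let e' : A ≃o Bᵒᵈ := e
    obtain ⟨f, key⟩ : ∃ f : V.dom → W.dom, ∀ a (ha : a ∈ A),
        f a = (OrderDual.ofDual (e' ⟨a, ha⟩) : B) :=
      ⟨fun a => if h : a ∈ A then ((OrderDual.ofDual (e' ⟨a, h⟩) : B) : W.dom)
        else ((OrderDual.ofDual (e' ⟨a₀, ha₀⟩) : B) : W.dom), fun a ha => dif_pos ha⟩
    refine ⟨f, ⟨?_, ?_⟩, ?_⟩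
    · intro a ha b hb hab
      rw [signedLT_neg_one, key a ha, key b hb]
      exact e'.strictMono (show (⟨a, ha⟩ : A) < ⟨b, hb⟩ from hab)
    · intro a ha
      rw [key a ha, Letter.signed_neg_one]
      have := he ⟨a, ha⟩
      change V.letter a = (W.letter ((OrderDual.ofDual (e' ⟨a, ha⟩) : B) : W.dom)).inv at this
      rw [this, Letter.inv_inv]
    · ext b
      constructor
      · rintro ⟨a, ha, rfl⟩
        rw [key a ha]; exact (OrderDual.ofDual (e' ⟨a, ha⟩)).2
      · intro hb
        refine ⟨(e'.symm (OrderDual.toDual ⟨b, hb⟩)).1, (e'.symm (OrderDual.toDual ⟨b, hb⟩)).2, ?_⟩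
        rw [key _ (e'.symm (OrderDual.toDual ⟨b, hb⟩)).2]
        exact congrArg (fun z : Bᵒᵈ => ((OrderDual.ofDual z : B) : W.dom))
          (e'.apply_symm_apply (OrderDual.toDual ⟨b, hb⟩))

/-! ### Classes of words and of their restrictions -/

theorem Same.mk_eq {V W : Word G} (h : V.Same W) : TopProd.mk V = TopProd.mk W := by
  obtain ⟨e, he⟩ := h
  refine Quotient.sound (fun N => ?_)
  rw [proj_eq N W (((V.support N).sort (· ≤ ·)).map e)]
  · rw [proj, List.map_map]
    congr 1
    exact List.map_congr_left (fun i _ => by simp [he])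
  · exact List.Pairwise.map e (fun a b h => e.strictMono h) (Finset.sortedLT_sort _).pairwise
  · intro i
    rw [List.mem_map]
    constructor
    · rintro ⟨a, ha, rfl⟩
      rw [← he]; exact (mem_support N V a).mp ha
    · intro h
      refine ⟨e.symm i, (mem_support N V _).mpr ?_, e.apply_symm_apply i⟩
      rw [he, e.apply_symm_apply]; exact h

theorem mk_concat (V W : Word G) :
    TopProd.mk (concat V W) = TopProd.mk V * TopProd.mk W := rfl

theorem mk_inv (W : Word G) : TopProd.mk W.inv = (TopProd.mk W)⁻¹ := rfl

theorem mk_empty : TopProd.mk (empty : Word G) = 1 := rfl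

theorem mk_signed (W : Word G) (δ : ℤˣ) :
    TopProd.mk (W.signed δ) = TopProd.mk W ^ (δ : ℤ) := by
  rcases Int.units_eq_one_or δ with rfl | rfl
  · simp [signed_one]
  · simp [signed_neg_one, mk_inv]

theorem mk_eq_one_iff (W : Word G) : TopProd.mk W = 1 ↔ W.Equivalent empty :=
  ⟨fun h => Quotient.exact h, fun h => Quotient.sound h⟩

/-- The class in the topologist's product of the restriction `W ↾ S`. -/
def seg (W : Word G) (S : Set W.dom) : TopProd G := TopProd.mk (W.restrict S)

theorem seg_empty (W : Word G) : W.seg ∅ = 1 := by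
  rw [← mk_empty]
  exact Same.mk_eq (same_of_strictMono (fun a => a.2.elim) (fun a => a.2.elim)
    (fun a => a.elim) (fun a => a.2.elim))

theorem seg_univ (W : Word G) : W.seg Set.univ = TopProd.mk W :=
  Same.mk_eq (same_of_strictMono (fun a => a.1) (fun _ _ h => h) (fun a => ⟨⟨a, trivial⟩, rfl⟩)
    (fun _ => rfl))

theorem seg_union (W : Word G) {S T : Set W.dom} (h : ∀ a ∈ S, ∀ b ∈ T, a < b) :
    W.seg (S ∪ T) = W.seg S * W.seg T := by
  rw [seg, seg, seg, ← mk_concat]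
  symm
  refine Same.mk_eq (same_of_strictMono (V := concat (W.restrict S) (W.restrict T))
    (W := W.restrict (S ∪ T))
    (fun i => Sum.elim (fun a : S => (⟨a.1, Or.inl a.2⟩ : (S ∪ T : Set W.dom)))
      (fun b : T => ⟨b.1, Or.inr b.2⟩) (ofLex i)) ?_ ?_ ?_)
  · intro i j hij
    obtain ⟨i, rfl⟩ := toLex.surjective i
    obtain ⟨j, rfl⟩ := toLex.surjective j
    rcases i with i | i <;> rcases j with j | j
    · exact (Sum.Lex.inl_lt_inl_iff (α := S) (β := T)).mp hij
    · exact h i.1 i.2 j.1 j.2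
    · exact absurd hij Sum.Lex.not_inr_lt_inl
    · exact (Sum.Lex.inr_lt_inr_iff (α := S) (β := T)).mp hij
  · rintro ⟨a, ha | ha⟩
    · exact ⟨toLex (Sum.inl ⟨a, ha⟩), rfl⟩
    · exact ⟨toLex (Sum.inr ⟨a, ha⟩), rfl⟩
  · intro i
    obtain ⟨i, rfl⟩ := toLex.surjective i
    rcases i with i | i <;> rfl

theorem IsMatch.seg_eq {V W : Word G} {δ : ℤˣ} {f : V.dom → W.dom} {A : Set V.dom}
    (h : IsMatch V W δ f A) : V.seg A = W.seg (f '' A) ^ (δ : ℤ) := by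
  rw [seg, h.same.mk_eq, mk_signed]; rfl

end Word

/-! ### Projections of the topologist's product to finite free products -/

namespace TopProd

variable {G : ℕ → Type u} [∀ n, Group (G n)]

/-- The projection of the topologist's product to the free product of `G 0, …, G N`. -/
noncomputable def proj (N : ℕ) : TopProd G →* Monoid.CoprodI (fun n : Fin (N + 1) => G n) where
  toFun := Quotient.lift (Word.proj N) (fun _ _ h => h N)
  map_one' := Word.proj_empty N
  map_mul' a b := by
    induction a using Quotient.inductionOn
    induction b using Quotient.inductionOn
    exact Word.proj_concat N _ _

theorem proj_mk (N : ℕ) (W : Word G) : proj N (mk W) = W.proj N := rfl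

theorem ext {a b : TopProd G} (h : ∀ N, proj N a = proj N b) : a = b := by
  induction a using Quotient.inductionOn
  induction b using Quotient.inductionOn
  exact Quotient.sound h

/-- The homomorphism to `H` that is `φ` on the factor `n` and trivial on the others. -/
noncomputable def factorHom {H : Type*} [Group H] (N : ℕ)
    (φ : ∀ n, G n →* H) :
    Monoid.CoprodI (fun n : Fin (N + 1) => G n) →* H :=
  Monoid.CoprodI.lift (fun n => φ n)

theorem factorHom_toFree {H : Type*} [Group H] (N : ℕ) (φ : ∀ n, G n →* H) (a : Letter G)
    (n : ℕ) (hn : n ≤ N) (ha : a.InGroup n) :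
    ∃ g : G n, factorHom N φ (a.toFree N) = φ n g ∧ Letter.toFree N a =
      Monoid.CoprodI.of (M := fun n : Fin (N + 1) => G n) (i := ⟨n, by omega⟩) g ∧
      (a ≠ none → g ≠ 1) := by
  rcases a with _ | ⟨k, g, hg⟩
  · exact ⟨1, by simp [Letter.toFree], by simp [Letter.toFree], by simp⟩
  · obtain rfl : k = n := ha
    refine ⟨g, ?_, ?_, fun _ => hg⟩
    · have : k < N + 1 := by omega
      simp [Letter.toFree, this, factorHom]
    · have : k < N + 1 := by omega
      simp [Letter.toFree, this]

/-- Killing the factors beyond `M` sends `p_N` to `p_M`. So the finite stages form an inverse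
system, and agreement at a late stage implies agreement at all earlier ones. -/
theorem exists_proj_hom (M N : ℕ) (h : M ≤ N) :
    ∃ r : Monoid.CoprodI (fun n : Fin (N + 1) => G n) →*
      Monoid.CoprodI (fun n : Fin (M + 1) => G n), ∀ a : TopProd G, r (proj N a) = proj M a := by
  classical
  let φ : ∀ n, G n →* Monoid.CoprodI (fun n : Fin (M + 1) => G n) := fun n =>
    if h : n < M + 1 then Monoid.CoprodI.of (M := fun n : Fin (M + 1) => G n) (i := ⟨n, h⟩) else 1
  have hφ : ∀ a : Letter G, (∃ n ≤ N, a.InGroup n) →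
      factorHom N φ (a.toFree N) = a.toFree M := by
    rintro (_ | ⟨k, g, hg⟩) ⟨n, hn, hk⟩
    · simp [Letter.toFree]
    · obtain rfl : k = n := hk
      have hk' : k < N + 1 := by omega
      by_cases hkM : k < M + 1
      · simp only [Letter.toFree, hk', hkM, factorHom, φ, dite_true, Monoid.CoprodI.lift_of]
      · simp [Letter.toFree, hk', hkM, factorHom, φ, -Order.lt_add_one_iff]
  have hφ' : ∀ a : Letter G, ¬ (∃ n ≤ M, a.InGroup n) → a.toFree M = 1 := by
    rintro (_ | ⟨k, g, hg⟩) hn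
    · exact absurd ⟨0, by simp, trivial⟩ hn
    · have : ¬ k < M + 1 := fun h => hn ⟨k, by omega, rfl⟩
      simp [Letter.toFree, this]
  refine ⟨factorHom N φ, fun a => ?_⟩
  induction a using Quotient.inductionOn with
  | h W =>
  change factorHom N φ (W.proj N) = W.proj M
  rw [Word.proj_eq M W (((W.support N).sort (· ≤ ·)).filter
    (fun i => ∃ n ≤ M, (W.letter i).InGroup n))]
  · rw [Word.proj, map_list_prod, List.map_map]
    have : ∀ l : List W.dom, (∀ i ∈ l, ∃ n ≤ N, (W.letter i).InGroup n) →
        (l.map (factorHom N φ ∘ fun i => (W.letter i).toFree N)).prod =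
        ((l.filter (fun i => ∃ n ≤ M, (W.letter i).InGroup n)).map
          (fun i => (W.letter i).toFree M)).prod := by
      intro l
      induction l with
      | nil => intro _; simp
      | cons i l ih =>
        intro hl
        have ih := ih (fun j hj => hl j (List.mem_cons_of_mem _ hj))
        rw [List.map_cons, List.prod_cons, ih, List.filter_cons, Function.comp_apply,
          hφ _ (hl i (by simp))]
        split_ifs with hi
        · simp
        · rw [hφ' _ (by simpa using hi), one_mul]
    exact this _ (fun i hi => (Word.mem_support N W i).mp hi)
  · exact List.Pairwise.filter _ (Finset.sortedLT_sort _).pairwise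
  · intro i
    rw [List.mem_filter, Word.mem_support]
    simp only [decide_eq_true_eq, and_iff_right_iff_imp]
    rintro ⟨n, hn, hi⟩
    exact ⟨n, hn.trans h, hi⟩

theorem proj_eq_of_le {a b : TopProd G} {M N : ℕ} (h : M ≤ N) (hab : proj N a = proj N b) :
    proj M a = proj M b := by
  obtain ⟨r, hr⟩ := exists_proj_hom (G := G) M N h
  rw [← hr, ← hr, hab]

end TopProd

namespace Word

variable {G : ℕ → Type u} [∀ n, Group (G n)]

theorem proj_seg_eq_prod (N : ℕ) (W : Word G) (S : Set W.dom) (l : List W.dom)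
    (h : l.Pairwise (· < ·)) (hl : ∀ i, i ∈ l ↔ i ∈ S ∧ ∃ n ≤ N, (W.letter i).InGroup n) :
    TopProd.proj N (W.seg S) = (l.map (fun i => (W.letter i).toFree N)).prod := by
  have hS : ∀ i ∈ l, i ∈ S := fun i hi => ((hl i).mp hi).1
  obtain ⟨l', rfl⟩ : ∃ l' : List S, l'.map Subtype.val = l :=
    ⟨l.attachWith (· ∈ S) hS, by simp⟩
  rw [List.pairwise_map] at h
  rw [seg, TopProd.proj_mk, proj_eq N (W.restrict S) l' h, List.map_map]
  · rfl
  · intro i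
    refine Iff.trans ?_ ((hl i.1).trans (and_iff_right i.2))
    rw [List.mem_map]
    exact ⟨fun h => ⟨i, h, rfl⟩, fun ⟨j, hj, hij⟩ => Subtype.ext hij ▸ hj⟩

theorem proj_seg_of_forall_not (N : ℕ) (W : Word G) (S : Set W.dom)
    (h : ∀ i ∈ S, ∀ n ≤ N, ¬ (W.letter i).InGroup n) : TopProd.proj N (W.seg S) = 1 := by
  rw [proj_seg_eq_prod N W S [] List.Pairwise.nil]
  · rfl
  · intro i
    simp only [List.not_mem_nil, false_iff, not_and, not_exists]
    exact fun hi n hn => h i hi n hn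

theorem proj_seg_singleton (N : ℕ) (W : Word G) (i : W.dom)
    (h : ∃ n ≤ N, (W.letter i).InGroup n) :
    TopProd.proj N (W.seg {i}) = (W.letter i).toFree N := by
  rw [proj_seg_eq_prod N W {i} [i] (List.pairwise_singleton _ _)]
  · simp
  · intro j
    simp only [List.mem_singleton, Set.mem_singleton_iff]
    constructor
    · rintro rfl; exact ⟨rfl, h⟩
    · exact fun h => h.1

end Word

/-! ### Noncrossing cancellation in free products -/

/-- The letters `d` of the list lead from `pre d` to `post d`; the list leads from `a` to `b`. -/
def IsPath {D H : Type*} (pre post : D → H) : H → List D → H → Prop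
  | a, [], b => a = b
  | a, d :: l, b => pre d = a ∧ IsPath pre post (post d) l b

theorem isPath_append {D H : Type*} (pre post : D → H) (l₁ l₂ : List D) (a b : H) :
    IsPath pre post a (l₁ ++ l₂) b ↔ ∃ c, IsPath pre post a l₁ c ∧ IsPath pre post c l₂ b := by
  induction l₁ generalizing a with
  | nil => simp [IsPath]
  | cons d l ih => simp [IsPath, ih, and_assoc]

theorem IsPath.congr {D H : Type*} {pre post post' : D → H} {l : List D} {a b : H}
    (h : IsPath pre post a l b) (hp : ∀ d ∈ l, post' d = post d) : IsPath pre post' a l b := by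
  induction l generalizing a with
  | nil => exact h
  | cons d l ih =>
    refine ⟨h.1, ?_⟩
    rw [hp d (by simp)]
    exact ih h.2 (fun x hx => hp x (by simp [hx]))

theorem IsPath.prod_eq {D H : Type*} [Group H] {pre post : D → H} {l : List D} {a b : H}
    (h : IsPath pre post a l b) : (l.map (fun d => (pre d)⁻¹ * post d)).prod = a⁻¹ * b := by
  induction l generalizing a with
  | nil => simp [show a = b from h]
  | cons d l ih => simp [ih h.2, h.1]

/-- A noncrossing equivalence relation on the members of a list of letters leading from `pre d` to
`post d`, such that successive members of a class cancel what lies between them. -/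
structure Noncrossing {D H ι : Type*} [LinearOrder D] (idx : D → ι) (pre post : D → H)
    (l : List D) (R : D → D → Prop) : Prop where
  equiv : Equivalence R
  mem : ∀ a b, R a b → a ≠ b → a ∈ l
  idx_eq : ∀ a b, R a b → idx a = idx b
  cross : ∀ a b c d, a < b → b < c → c < d → R a c → R b d → R a b
  next : ∀ a b, a < b → R a b → (∀ c, a < c → c < b → ¬ R a c) → post a = pre b
  close : ∀ a b, a ∈ l → b ∈ l → R a b → (∀ c, R a c → a ≤ c ∧ c ≤ b) → pre a = post b

/-- Otherwise the steps `(pre d)⁻¹ * post d` would spell a nonempty reduced word of the free product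
with value `1`, against the uniqueness of normal forms. -/
theorem exists_adjacent_idx_eq {ι : Type*} {M : ι → Type*} [∀ i, Group (M i)] {D : Type*}
    (idx : D → ι) (pre post : D → Monoid.CoprodI M) {l : List D} (hl : l ≠ [])
    {a : Monoid.CoprodI M} (hp : IsPath pre post a l a)
    (hv : ∀ d ∈ l, ∃ g : M (idx d), g ≠ 1 ∧ (pre d)⁻¹ * post d = Monoid.CoprodI.of g) :
    ∃ l₁ i j l₂, l = l₁ ++ i :: j :: l₂ ∧ idx i = idx j := by
  classical
  by_contra hcon
  push Not at hcon
  choose! g hg using hv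
  let w : Monoid.CoprodI.Word M :=
    { toList := l.map (fun d => ⟨idx d, g d⟩)
      ne_one := by
        intro p hp
        obtain ⟨d, hd, rfl⟩ := List.mem_map.mp hp
        exact (hg d hd).1
      chain_ne := by
        rw [List.isChain_map, List.isChain_iff_forall_rel_of_append_cons_cons]
        intro i j l₁ l₂ h
        exact hcon l₁ i j l₂ h }
  have hw : w.prod = 1 := by
    have h1 := hp.prod_eq
    rw [inv_mul_cancel] at h1
    rw [← h1]
    simp only [Monoid.CoprodI.Word.prod, w, List.map_map]
    congr 1
    refine List.map_congr_left (fun d hd => ?_)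
    exact (hg d hd).2.symm
  have : w = Monoid.CoprodI.Word.empty :=
    Monoid.CoprodI.Word.equiv.symm.injective
      (hw.trans Monoid.CoprodI.Word.prod_empty.symm)
  have h2 : w.toList = [] := by rw [this]; rfl
  exact hl (List.map_eq_nil_iff.mp h2)

/-- The adjacent letters `i` and `j` cancel, so they form a class of their own; with no letter of
the list between them, this class crosses no other. -/
theorem noncrossing_delete {D H ι : Type*} [LinearOrder D] {idx : D → ι} {pre post : D → H}
    {l₁ l₂ : List D} {i j : D} (hs : (l₁ ++ i :: j :: l₂).Pairwise (· < ·))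
    (hij : idx i = idx j) (h1 : post i = pre j) (h2 : pre i = post j) {R : D → D → Prop}
    (hR : Noncrossing idx pre post (l₁ ++ l₂) R) :
    Noncrossing idx pre post (l₁ ++ i :: j :: l₂)
      (fun a b => R a b ∨ (a = i ∨ a = j) ∧ (b = i ∨ b = j)) := by
  have hs' := List.pairwise_append.mp hs
  have hl1 : ∀ x ∈ l₁, x < i ∧ x < j := fun x hx =>
    ⟨hs'.2.2 x hx i (by simp), hs'.2.2 x hx j (by simp)⟩
  have h3 := List.pairwise_cons.mp hs'.2.1
  have hlt : i < j := h3.1 j (by simp)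
  have hl2 : ∀ x ∈ l₂, i < x ∧ j < x := fun x hx =>
    ⟨h3.1 x (by simp [hx]), (List.pairwise_cons.mp h3.2).1 x hx⟩
  have hni : i ∉ l₁ ++ l₂ := by
    rw [List.mem_append]; rintro (h | h)
    · exact (hl1 i h).1.false
    · exact (hl2 i h).1.false
  have hnj : j ∉ l₁ ++ l₂ := by
    rw [List.mem_append]; rintro (h | h)
    · exact (hl1 j h).2.false
    · exact (hl2 j h).2.false
  have hout : ∀ x ∈ l₁ ++ l₂, x < i ∨ j < x := by
    intro x hx
    rcases List.mem_append.mp hx with h | h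
    · exact Or.inl (hl1 x h).1
    · exact Or.inr (hl2 x h).2
  have hRi : ∀ x y, (x = i ∨ x = j) → R x y → y = x := by
    rintro x y hx hxy
    by_contra hne
    have := hR.mem x y hxy (Ne.symm hne)
    rcases hx with rfl | rfl
    · exact hni this
    · exact hnj this
  have hmem : ∀ x, x ∈ l₁ ++ i :: j :: l₂ ↔ x ∈ l₁ ++ l₂ ∨ (x = i ∨ x = j) := by
    intro x; simp only [List.mem_append, List.mem_cons]; tauto
  refine ⟨⟨fun a => Or.inl (hR.equiv.refl a), ?_, ?_⟩, ?_, ?_, ?_, ?_, ?_⟩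
  · rintro a b (h | h)
    · exact Or.inl (hR.equiv.symm h)
    · exact Or.inr ⟨h.2, h.1⟩
  · rintro a b c (h | h) (h' | h')
    · exact Or.inl (hR.equiv.trans h h')
    · obtain rfl : a = b := hRi b a h'.1 (hR.equiv.symm h)
      exact Or.inr h'
    · obtain rfl : c = b := hRi b c h.2 h'
      exact Or.inr h
    · exact Or.inr ⟨h.1, h'.2⟩
  · rintro a b (h | h) hne
    · exact (hmem a).mpr (Or.inl (hR.mem a b h hne))
    · exact (hmem a).mpr (Or.inr h.1)
  · rintro a b (h | ⟨rfl | rfl, rfl | rfl⟩)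
    · exact hR.idx_eq a b h
    · rfl
    · exact hij
    · exact hij.symm
    · rfl
  · rintro a b c d hab hbc hcd (h | h) (h' | h')
    · exact Or.inl (hR.cross a b c d hab hbc hcd h h')
    · have hc : c ∈ l₁ ++ l₂ := hR.mem c a (hR.equiv.symm h) (hab.trans hbc).ne'
      rcases hout c hc with h4 | h4 <;> rcases h' with ⟨rfl | rfl, rfl | rfl⟩ <;> order
    · have hc : b ∈ l₁ ++ l₂ := hR.mem b d h' (hbc.trans hcd).ne
      rcases hout b hc with h4 | h4 <;> rcases h with ⟨rfl | rfl, rfl | rfl⟩ <;> order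
    · rcases h with ⟨rfl | rfl, rfl | rfl⟩ <;> rcases h' with ⟨rfl | rfl, rfl | rfl⟩ <;> order
  · rintro a b hab (h | h) hn
    · exact hR.next a b hab h (fun c hc hc' h' => hn c hc hc' (Or.inl h'))
    · rcases h with ⟨rfl | rfl, rfl | rfl⟩
      · exact absurd hab (lt_irrefl _)
      · exact h1
      · exact absurd hab hlt.asymm
      · exact absurd hab (lt_irrefl _)
  · intro a b ha hb hab hc
    -- The class is exactly `{i, j}`, so the bounds in `hc` force `a = i` and `b = j`.
    have key : (a = i ∨ a = j) → pre a = post b := by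
      intro ha'
      have hci := (hc i (Or.inr ⟨ha', Or.inl rfl⟩)).1
      have hcj := (hc j (Or.inr ⟨ha', Or.inr rfl⟩)).2
      have hb' : b = i ∨ b = j := by
        rcases hab with h | h
        · rw [hRi a b ha' h]; exact ha'
        · exact h.2
      rcases ha' with rfl | rfl
      · rcases hb' with rfl | rfl
        · exact absurd hcj (not_le.mpr hlt)
        · exact h2
      · exact absurd hci (not_le.mpr hlt)
    rcases (hmem a).mp ha with ha' | ha'
    · rcases hab with h | h
      · have hb' : b ∈ l₁ ++ l₂ := by
          by_cases hne : a = b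
          · rwa [← hne]
          · exact hR.mem b a (hR.equiv.symm h) (Ne.symm hne)
        exact hR.close a b ha' hb' h (fun c h' => hc c (Or.inl h'))
      · exact key h.1
    · exact key ha'

/-- The letters `i` and `j` count as a single letter in the shorter list, kept under the name `i`
and now leading to `post j`. In the longer list `j` joins the class of `i`, as its immediate
successor. -/
theorem noncrossing_merge {D H ι : Type*} [LinearOrder D] {idx : D → ι} {pre post : D → H}
    {l₁ l₂ : List D} {i j : D} (hs : (l₁ ++ i :: j :: l₂).Pairwise (· < ·))
    (hij : idx i = idx j) (h1 : post i = pre j) {R : D → D → Prop}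
    (hR : Noncrossing idx pre (Function.update post i (post j)) (l₁ ++ i :: l₂) R) :
    Noncrossing idx pre post (l₁ ++ i :: j :: l₂)
      (fun a b => R (if a = j then i else a) (if b = j then i else b)) := by
  have hs' := List.pairwise_append.mp hs
  have h3 := List.pairwise_cons.mp hs'.2.1
  have hlt : i < j := h3.1 j (by simp)
  have hout : ∀ x ∈ l₁ ++ i :: j :: l₂, x < i ∨ x = i ∨ x = j ∨ j < x := by
    intro x hx
    simp only [List.mem_append, List.mem_cons] at hx
    rcases hx with h | rfl | rfl | h
    · exact Or.inl (hs'.2.2 x h i (by simp))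
    · simp
    · simp
    · exact Or.inr (Or.inr (Or.inr ((List.pairwise_cons.mp h3.2).1 x h)))
  have hnj : j ∉ l₁ ++ i :: l₂ := by
    simp only [List.mem_append, List.mem_cons]
    rintro (h | rfl | h)
    · exact (hs'.2.2 j h j (by simp)).false
    · exact hlt.false
    · exact ((List.pairwise_cons.mp h3.2).1 j h).false
  have hmem : ∀ x, x ∈ l₁ ++ i :: j :: l₂ ↔ x ∈ l₁ ++ i :: l₂ ∨ x = j := by
    intro x; simp only [List.mem_append, List.mem_cons]; tauto
  have hi : i ∈ l₁ ++ i :: l₂ := by simp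
  -- `σ` collapses `j` onto `i`. It is weakly monotone on the list (`hσm`), which is what carries
  -- the noncrossing property back.
  obtain ⟨σ, hσ⟩ : ∃ σ : D → D, σ = fun a => if a = j then i else a := ⟨_, rfl⟩
  have hσj : σ j = i := by simp [hσ]
  have hσn : ∀ x, x ≠ j → σ x = x := fun x hx => by simp [hσ, hx]
  have hσ' : ∀ a b, R (if a = j then i else a) (if b = j then i else b) ↔ R (σ a) (σ b) := by
    intro a b; rw [hσ]
  simp only [hσ']
  have hσl : ∀ x, σ x ∈ l₁ ++ i :: l₂ → x ∈ l₁ ++ i :: j :: l₂ := by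
    intro x hx
    by_cases h : x = j
    · rw [h]; simp
    · rw [hσn x h] at hx; exact (hmem x).mpr (Or.inl hx)
  have hmem' : ∀ a b, R (σ a) (σ b) → a ≠ b → a ∈ l₁ ++ i :: j :: l₂ := by
    intro a b hab hne
    by_cases h : σ a = σ b
    · by_cases ha : a = j
      · rw [ha]; simp
      · by_cases hb : b = j
        · rw [hσn a ha, hb, hσj] at h; rw [h]; simp
        · rw [hσn a ha, hσn b hb] at h; exact absurd h hne
    · exact hσl a (hR.mem _ _ hab h)
  have hσm : ∀ x y, x ∈ l₁ ++ i :: j :: l₂ → y ∈ l₁ ++ i :: j :: l₂ → x < y → σ x ≤ σ y := by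
    intro x y hx hy hxy
    by_cases hxj : x = j
    · have : y ≠ j := by rintro rfl; exact hxy.ne hxj
      rw [hxj, hσj, hσn y this]; exact (hlt.trans (hxj ▸ hxy)).le
    · rw [hσn x hxj]
      by_cases hyj : y = j
      · rw [hyj, hσj]
        rcases hout x hx with h | h | h | h
        · exact h.le
        · exact h.le
        · exact absurd h hxj
        · exact absurd h (hyj ▸ hxy).asymm
      · rw [hσn y hyj]; exact hxy.le
  have hpost : ∀ x, x ≠ i → Function.update post i (post j) x = post x := fun x hx =>
    Function.update_of_ne hx _ _
  have hposti : Function.update post i (post j) i = post j := Function.update_self ..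
  refine ⟨⟨fun a => hR.equiv.refl _, fun h => hR.equiv.symm h, fun h h' => hR.equiv.trans h h'⟩,
    hmem', ?_, ?_, ?_, ?_⟩
  · intro a b h
    have hidx : ∀ x, idx (σ x) = idx x := by
      intro x
      by_cases hx : x = j
      · rw [hx, hσj, hij]
      · rw [hσn x hx]
    rw [← hidx a, ← hidx b]
    exact hR.idx_eq _ _ h
  · intro a b c d hab hbc hcd h h'
    have ha := hmem' a c h (hab.trans hbc).ne
    have hc := hmem' c a (hR.equiv.symm h) (hab.trans hbc).ne'
    have hb := hmem' b d h' (hbc.trans hcd).ne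
    have hd := hmem' d b (hR.equiv.symm h') (hbc.trans hcd).ne'
    rcases eq_or_lt_of_le (hσm a b ha hb hab) with e1 | l1
    · rw [e1]; exact hR.equiv.refl _
    rcases eq_or_lt_of_le (hσm b c hb hc hbc) with e2 | l2
    · rw [e2]; exact h
    rcases eq_or_lt_of_le (hσm c d hc hd hcd) with e3 | l3
    · rw [e3] at h; exact hR.equiv.trans h (hR.equiv.symm h')
    exact hR.cross _ _ _ _ l1 l2 l3 h h'
  · intro a b hab h hn
    have hbmem : b ∈ l₁ ++ i :: j :: l₂ := hmem' b a (hR.equiv.symm h) hab.ne'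
    by_cases haj : a = j
    · subst haj
      have hbj : b ≠ a := hab.ne'
      rw [hσj, hσn b hbj] at h
      rw [← hposti]
      refine hR.next i b (hlt.trans hab) h (fun c hc hc' h' => ?_)
      have hcl : c ∈ l₁ ++ i :: l₂ := hR.mem c i (hR.equiv.symm h') hc.ne'
      have hca : c ≠ a := fun hh => hnj (hh ▸ hcl)
      have hac : a < c := by
        rcases hout c ((hmem c).mpr (Or.inl hcl)) with h4 | h4 | h4 | h4
        · exact absurd h4 hc.asymm
        · exact absurd h4 hc.ne'
        · exact absurd h4 hca
        · exact h4
      refine hn c hac hc' ?_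
      rwa [hσj, hσn c hca]
    · by_cases hai : a = i
      · subst hai
        by_cases hbj : b = j
        · rw [hbj]; exact h1
        · have : j < b := by
            rcases hout b hbmem with h4 | h4 | h4 | h4
            · exact absurd h4 hab.asymm
            · exact absurd h4 hab.ne'
            · exact absurd h4 hbj
            · exact h4
          refine absurd ?_ (hn j hlt this)
          rw [hσj, hσn a haj]; exact hR.equiv.refl _
      · rw [hσn a haj] at h
        by_cases hbj : b = j
        · subst hbj
          rw [hσj] at h
          have hai' : a < i := by
            rcases hout a (hmem' a b (by rwa [hσn a haj, hσj]) haj) with h4 | h4 | h4 | h4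
            · exact h4
            · exact absurd h4 hai
            · exact absurd h4 haj
            · exact absurd h4 hab.asymm
          refine absurd ?_ (hn i hai' hlt)
          rwa [hσn a haj, hσn i hlt.ne]
        · rw [hσn b hbj] at h
          rw [← hpost a hai]
          refine hR.next a b hab h (fun c hc hc' h' => ?_)
          have hcl : c ∈ l₁ ++ i :: l₂ := hR.mem c a (hR.equiv.symm h') hc.ne'
          have hca : c ≠ j := fun hh => hnj (hh ▸ hcl)
          refine hn c hc hc' ?_
          rwa [hσn a haj, hσn c hca]
  · intro a b ha hb h hc
    by_cases haj : a = j
    · subst haj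
      have := (hc i (by rw [hσj, hσn i hlt.ne]; exact hR.equiv.refl _)).1
      exact absurd hlt (not_lt.mpr this)
    have ha' : a ∈ l₁ ++ i :: l₂ := ((hmem a).mp ha).resolve_right haj
    rw [hσn a haj] at h
    simp only [hσn a haj] at hc
    by_cases hbj : b = j
    · subst hbj
      rw [hσj] at h
      rw [← hposti]
      refine hR.close a i ha' hi h (fun c h' => ?_)
      have hcl : c ∈ l₁ ++ i :: l₂ := by
        by_cases hca : c = a
        · rwa [hca]
        · exact hR.mem c a (hR.equiv.symm h') hca
      have hcj : c ≠ b := fun hh => hnj (hh ▸ hcl)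
      have h5 := hc c (by rwa [hσn c hcj])
      refine ⟨h5.1, ?_⟩
      rcases hout c ((hmem c).mpr (Or.inl hcl)) with h4 | h4 | h4 | h4
      · exact h4.le
      · exact h4.le
      · exact absurd h4 hcj
      · exact absurd h4 (not_lt.mpr h5.2)
    · rw [hσn b hbj] at h
      have hb' : b ∈ l₁ ++ i :: l₂ := ((hmem b).mp hb).resolve_right hbj
      have hbi : b ≠ i := by
        rintro rfl
        have := (hc j (by rwa [hσj])).2
        exact absurd hlt (not_lt.mpr this)
      rw [← hpost b hbi]
      refine hR.close a b ha' hb' h (fun c h' => ?_)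
      have hcl : c ∈ l₁ ++ i :: l₂ := by
        by_cases hca : c = a
        · rwa [hca]
        · exact hR.mem c a (hR.equiv.symm h') hca
      have hcj : c ≠ j := fun hh => hnj (hh ▸ hcl)
      exact hc c (by rwa [hσn c hcj])

/-- Induction on the length: some two adjacent letters come from one factor, and they either cancel
and are deleted, or have a nontrivial product and are merged. Merging changes `post` but not `pre`,
so only `post` varies in the induction. -/
theorem exists_noncrossing {ι : Type*} {M : ι → Type*} [∀ i, Group (M i)] {D : Type*}
    [LinearOrder D] (idx : D → ι) (pre : D → Monoid.CoprodI M) (a : Monoid.CoprodI M) (n : ℕ)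
    (post : D → Monoid.CoprodI M) (l : List D) (hn : l.length ≤ n)
    (hs : l.Pairwise (· < ·)) (hp : IsPath pre post a l a)
    (hv : ∀ d ∈ l, ∃ g : M (idx d), g ≠ 1 ∧ (pre d)⁻¹ * post d = Monoid.CoprodI.of g) :
    ∃ R, Noncrossing idx pre post l R := by
  induction n generalizing l post with
  | zero =>
    obtain rfl : l = [] := List.length_eq_zero_iff.mp (Nat.le_zero.mp hn)
    refine ⟨Eq, ⟨eq_equivalence, ?_, ?_, ?_, ?_, ?_⟩⟩
    · exact fun a b h h' => absurd h h'
    · rintro a _ rfl; rfl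
    · rintro a b _ d h1 h2 - rfl -; exact absurd (h1.trans h2) (lt_irrefl _)
    · rintro a _ h rfl; exact absurd h (lt_irrefl _)
    · intro a b h; simp at h
  | succ n ih =>
    rcases eq_or_ne l [] with rfl | hl
    · exact ih post [] (by simp) hs hp hv
    obtain ⟨l₁, i, j, l₂, rfl, hij⟩ := exists_adjacent_idx_eq idx pre post hl hp hv
    obtain ⟨c, hp1, hp2⟩ := (isPath_append _ _ _ _ _ _).mp hp
    obtain ⟨hc, h1, hp3⟩ := hp2
    have hs1 : (l₁ ++ l₂).Pairwise (· < ·) := hs.sublist (by simp)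
    have hs2 : (l₁ ++ i :: l₂).Pairwise (· < ·) := hs.sublist (by simp)
    simp only [List.length_append, List.length_cons] at hn
    by_cases h2 : pre i = post j
    · obtain ⟨R, hR⟩ := ih post (l₁ ++ l₂) (by simp only [List.length_append]; omega) hs1
        ((isPath_append _ _ _ _ _ _).mpr ⟨c, hp1, by rw [← hc, h2]; exact hp3⟩)
        (fun d hd => hv d (by
          simp only [List.mem_append, List.mem_cons] at hd ⊢; tauto))
      exact ⟨_, noncrossing_delete hs hij h1.symm h2 hR⟩
    · have hsl := List.pairwise_append.mp hs2
      have hne1 : ∀ d ∈ l₁, Function.update post i (post j) d = post d := fun d hd =>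
        Function.update_of_ne (hsl.2.2 d hd i (by simp)).ne _ _
      have hne2 : ∀ d ∈ l₂, Function.update post i (post j) d = post d := fun d hd =>
        Function.update_of_ne ((List.pairwise_cons.mp hsl.2.1).1 d hd).ne' _ _
      obtain ⟨R, hR⟩ := ih (Function.update post i (post j)) (l₁ ++ i :: l₂)
        (by simp only [List.length_append, List.length_cons]; omega) hs2
        ((isPath_append _ _ _ _ _ _).mpr ⟨c, hp1.congr hne1, hc, by
          rw [Function.update_self]; exact hp3.congr hne2⟩) (by
          intro d hd
          by_cases hdi : d = i
          · subst hdi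
            obtain ⟨g, hg1, hg2⟩ := hv d (by simp)
            obtain ⟨g', hg1', hg2'⟩ := hv j (by simp)
            rw [Function.update_self]
            obtain ⟨g'', hg''⟩ : ∃ g'' : M (idx d), Monoid.CoprodI.of g'' =
                (Monoid.CoprodI.of g' : Monoid.CoprodI M) := by
              rw [hij]; exact ⟨g', rfl⟩
            refine ⟨g * g'', ?_, ?_⟩
            · intro hgg
              apply h2
              have : (pre d)⁻¹ * post j = 1 := by
                calc (pre d)⁻¹ * post j = ((pre d)⁻¹ * post d) * ((pre j)⁻¹ * post j) := by
                      rw [← h1.symm]; group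
                  _ = 1 := by rw [hg2, hg2', ← hg'', ← map_mul, hgg, map_one]
              exact inv_mul_eq_one.mp this
            · rw [map_mul, hg'', ← hg2, ← hg2', ← h1.symm]; group
          · rw [Function.update_of_ne hdi]
            exact hv d (by simp only [List.mem_append, List.mem_cons] at hd ⊢; tauto))
      exact ⟨_, noncrossing_merge hs hij h1.symm hR⟩

/-! ### Cancellation in infinite words -/

namespace Word

variable {G : ℕ → Type u} [∀ n, Group (G n)]

/-- The lower set `S` stands for the letters already read, which makes the statement inductive in
the list; between successive letters of `l` nothing visible at stage `N` occurs. The case of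
interest is `S = ∅`. -/
theorem isPath_proj (N : ℕ) (C : Word G) (l : List C.dom) (hs : l.Pairwise (· < ·))
    (S : Set C.dom) (hS : IsLowerSet S)
    (hl : ∀ i, i ∈ l ↔ i ∉ S ∧ ∃ n ≤ N, (C.letter i).InGroup n) :
    IsPath (fun d => TopProd.proj N (C.seg (Set.Iio d)))
      (fun d => TopProd.proj N (C.seg (Set.Iic d))) (TopProd.proj N (C.seg S)) l
      (TopProd.proj N (C.seg Set.univ)) := by
  induction l generalizing S with
  | nil =>
    change _ = _
    rw [← Set.union_compl_self S, seg_union, map_mul, proj_seg_of_forall_not N C Sᶜ, mul_one]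
    · intro i hi n hn hin
      exact List.not_mem_nil ((hl i).mpr ⟨hi, n, hn, hin⟩)
    · intro a ha b hb
      by_contra h
      exact hb (hS (not_lt.mp h) ha)
  | cons d l ih =>
    have hd := (hl d).mp (by simp)
    have hs' := List.pairwise_cons.mp hs
    constructor
    · have hsub : Set.Iio d = S ∪ (Set.Iio d \ S) := by
        rw [Set.union_sdiff_self, eq_comm, Set.union_eq_right]
        intro s hsS
        by_contra h
        exact hd.1 (hS (not_lt.mp h) hsS)
      dsimp only
      rw [hsub, seg_union, map_mul, proj_seg_of_forall_not N C (Set.Iio d \ S), mul_one]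
      · intro i hi n hn hin
        have := (hl i).mpr ⟨hi.2, n, hn, hin⟩
        rcases List.mem_cons.mp this with rfl | h
        · exact lt_irrefl _ hi.1
        · exact (hs'.1 i h).asymm hi.1
      · intro a ha b hb
        by_contra h
        exact hb.2 (hS (not_lt.mp h) ha)
    · refine ih hs'.2 (Set.Iic d) (isLowerSet_Iic d) (fun i => ?_)
      constructor
      · intro hi
        exact ⟨not_le.mpr (hs'.1 i hi), ((hl i).mp (by simp [hi])).2⟩
      · rintro ⟨hi, hn⟩
        have hiS : i ∉ S := fun h => hd.1 (hS (not_le.mp hi).le h)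
        rcases List.mem_cons.mp ((hl i).mpr ⟨hiS, hn⟩) with rfl | h
        · exact absurd le_rfl hi
        · exact h

theorem seg_mul_seg_Ioo (C : Word G) {a b : C.dom} (h : a < b) :
    C.seg (Set.Iic a) * C.seg (Set.Ioo a b) = C.seg (Set.Iio b) := by
  rw [← seg_union C (S := Set.Iic a) (T := Set.Ioo a b) (fun x hx y hy => lt_of_le_of_lt hx hy.1)]
  congr 1
  ext x
  simp only [Set.mem_union, Set.mem_Iic, Set.mem_Ioo, Set.mem_Iio]
  constructor
  · rintro (h1 | h1)
    · exact h1.trans_lt h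
    · exact h1.2
  · intro h1
    rcases le_or_gt x a with h2 | h2
    · exact Or.inl h2
    · exact Or.inr ⟨h2, h1⟩

theorem seg_mul_seg_Icc (C : Word G) {a b : C.dom} (h : a ≤ b) :
    C.seg (Set.Iio a) * C.seg (Set.Icc a b) = C.seg (Set.Iic b) := by
  rw [← seg_union C (S := Set.Iio a) (T := Set.Icc a b)
    (fun x hx y hy => lt_of_lt_of_le hx hy.1), Set.Iio_union_Icc_eq_Iic h]

/-- A noncrossing equivalence relation on the letters of `C` whose successive members cancel what
lies between them, and whose classes cancel altogether. -/
structure Cancellation (C : Word G) (R : C.dom → C.dom → Prop) : Prop where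
  equiv : Equivalence R
  inGroup : ∀ a b n, R a b → (C.letter a).InGroup n → (C.letter b).InGroup n
  cross : ∀ a b c d, a < b → b < c → c < d → R a c → R b d → R a b
  next : ∀ a b, a < b → R a b → (∀ c, a < c → c < b → ¬ R a c) → C.seg (Set.Ioo a b) = 1
  close : ∀ a b, R a b → (∀ c, R a c → a ≤ c ∧ c ≤ b) → C.seg (Set.Icc a b) = 1

/-- Each `p_N(C)` has a noncrossing cancellation, and these relations are pooled along a
nonprincipal ultrafilter. A class stays inside one group, thus inside a finite set of letters, so
the whole class of a given letter is constant for almost all `N`. The conditions `next` and `close`,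
which speak about whole classes, therefore pass to the limit. -/
theorem exists_cancellation (C : Word G) (hC : TopProd.mk C = 1)
    (hn : ∀ i, C.letter i ≠ none) : ∃ R, Cancellation C R := by
  choose grp hgrp using fun i => (C.letter i).exists_inGroup
  have hgrp' : ∀ i n, (C.letter i).InGroup n → n = grp i := fun i n h =>
    Letter.InGroup.unique (hn i) h (hgrp i)
  -- The minimum merely makes the index lie in `Fin (N + 1)`; on the letters of `p_N(C)` it is the
  -- index of the group.
  let idx : ∀ N, C.dom → Fin (N + 1) := fun N d => ⟨min (grp d) N, by omega⟩
  have key : ∀ N, ∃ R, Noncrossing (idx N) (fun d => TopProd.proj N (C.seg (Set.Iio d)))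
      (fun d => TopProd.proj N (C.seg (Set.Iic d))) ((C.support N).sort (· ≤ ·)) R := by
    intro N
    refine exists_noncrossing (idx N) _ 1 _ _ _ le_rfl (Finset.sortedLT_sort _).pairwise ?_ ?_
    · have := isPath_proj N C ((C.support N).sort (· ≤ ·)) (Finset.sortedLT_sort _).pairwise ∅
        isLowerSet_empty (fun i => by rw [mem_support]; simp)
      rwa [seg_univ, hC, seg_empty, map_one] at this
    · intro d hd
      obtain ⟨n, hnN, hdn⟩ := (mem_support N C d).mp hd
      -- The first conclusion is dropped, so the target group and the homomorphisms are arbitrary.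
      obtain ⟨g, -, hg, hg1⟩ 
        := TopProd.factorHom_toFree (H := Multiplicative ℤ) N (fun _ => 1)
        (C.letter d) n hnN hdn
      have hid : idx N d = ⟨n, by omega⟩ := by
        simp only [idx, Fin.mk.injEq]
        rw [← hgrp' d n hdn, min_eq_left hnN]
      rw [hid]
      refine ⟨g, hg1 (hn d), ?_⟩
      rw [← hg, ← proj_seg_singleton N C d ⟨n, hnN, hdn⟩, ← map_inv, ← map_mul]
      congr 1
      rw [inv_mul_eq_iff_eq_mul, ← Set.Icc_self, seg_mul_seg_Icc _ le_rfl]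
  choose R hR using key
  let f : Filter ℕ := (Filter.hyperfilter ℕ : Ultrafilter ℕ)
  have hf : ∀ n, ∀ᶠ N in f, n ≤ N := fun n =>
    Nat.hyperfilter_le_atTop (Filter.eventually_ge_atTop n)
  have hmem : ∀ N a, grp a ≤ N → a ∈ (C.support N).sort (· ≤ ·) := fun N a h =>
    (mem_support N C a).mpr ⟨_, h, hgrp a⟩
  have hgrpN : ∀ N a b, grp a ≤ N → R N a b → grp b = grp a := by
    intro N a b ha h
    by_cases hab : b = a
    · rw [hab]
    have hb := (hR N).mem b a ((hR N).equiv.symm h) hab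
    obtain ⟨n, hnN, hbn⟩ := (mem_support N C b).mp hb
    have hb' : grp b ≤ N := (hgrp' b n hbn) ▸ hnN
    have h1 := congrArg Fin.val ((hR N).idx_eq a b h)
    simp only [idx] at h1
    omega
  let Q : C.dom → C.dom → Prop := fun a b => ∀ᶠ N in f, R N a b
  have hQgrp : ∀ a b, Q a b → grp b = grp a := by
    intro a b h
    obtain ⟨N, h1, h2⟩ := (h.and (hf (grp a))).exists
    exact hgrpN N a b h2 h1
  -- Only the finitely many letters in the group of `a` can be related to `a`, so finitely many
  -- ultrafilter decisions fix its entire class.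
  have hlim : ∀ a, ∀ᶠ N in f, ∀ c, R N a c ↔ Q a c := by
    intro a
    have hfin : {c | (C.letter c).InGroup (grp a)}.Finite := C.finite_letters _
    have h1 : ∀ᶠ N in f, ∀ c ∈ {c | (C.letter c).InGroup (grp a)}, (R N a c ↔ Q a c) := by
      rw [Filter.eventually_all_finite hfin]
      intro c _
      by_cases hc : Q a c
      · filter_upwards [hc] with N hN using iff_of_true hN hc
      · have : ∀ᶠ N in f, ¬ R N a c := Ultrafilter.eventually_not.mpr hc
        filter_upwards [this] with N hN using iff_of_false hN hc
    filter_upwards [h1, hf (grp a)] with N hN hN'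
    intro c
    by_cases hc : (C.letter c).InGroup (grp a)
    · exact hN c hc
    · refine iff_of_false (fun h => hc ?_) (fun h => hc ?_)
      · rw [← hgrpN N a c hN' h]; exact hgrp c
      · rw [← hQgrp a c h]; exact hgrp c
  -- Ultrafilter-many stages include arbitrarily late ones, and those decide the earlier ones.
  have hone : ∀ x y : TopProd G, (∀ᶠ N in f, TopProd.proj N x = TopProd.proj N y) → x = y := by
    intro x y h
    refine TopProd.ext (fun M => ?_)
    obtain ⟨N, h1, h2⟩ := (h.and (hf M)).exists
    exact TopProd.proj_eq_of_le h2 h1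
  refine ⟨Q, ⟨⟨fun a => Filter.Eventually.of_forall (fun N => (hR N).equiv.refl a), ?_, ?_⟩,
    ?_, ?_, ?_, ?_⟩⟩
  · intro a b h
    exact h.mono (fun N hN => (hR N).equiv.symm hN)
  · intro a b c h h'
    exact (h.and h').mono (fun N hN => (hR N).equiv.trans hN.1 hN.2)
  · intro a b n h hna
    rw [hgrp' a n hna, ← hQgrp a b h]; exact hgrp b
  · intro a b c d h1 h2 h3 h h'
    exact (h.and h').mono (fun N hN => (hR N).cross a b c d h1 h2 h3 hN.1 hN.2)
  · intro a b hab h hno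
    have : C.seg (Set.Iic a) = C.seg (Set.Iio b) := by
      refine hone _ _ ?_
      filter_upwards [hlim a] with N hN
      exact (hR N).next a b hab ((hN b).mpr h) (fun c hc hc' h' => hno c hc hc' ((hN c).mp h'))
    rwa [← seg_mul_seg_Ioo _ hab, left_eq_mul] at this
  · intro a b h hc
    have hab : a ≤ b := (hc b h).1
    have : C.seg (Set.Iio a) = C.seg (Set.Iic b) := by
      refine hone _ _ ?_
      filter_upwards [hlim a, hf (grp a), hf (grp b)] with N hN ha hb
      exact (hR N).close a b (hmem N a ha) (hmem N b hb) ((hN b).mpr h)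
        (fun c h' => hc c ((hN c).mp h'))
    rwa [← seg_mul_seg_Icc _ hab, left_eq_mul] at this

/-- The letters of `W` in the set `D` form a reduced word. -/
def ReducedOn (W : Word G) (D : Set W.dom) : Prop :=
  (∀ I ⊆ D, I.OrdConnected → W.seg I = 1 → I = ∅) ∧
  ∀ i ∈ D, ∀ j ∈ D, i ⋖ j → ¬ ∃ n, (W.letter i).InGroup n ∧ (W.letter j).InGroup n

theorem ReducedOn.letter_ne_none {W : Word G} {D : Set W.dom} (h : W.ReducedOn D) {i : W.dom}
    (hi : i ∈ D) : W.letter i ≠ none := by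
  intro hnone
  have : ({i} : Set W.dom) = ∅ := by
    refine h.1 {i} (by simpa using hi) Set.ordConnected_singleton (TopProd.ext fun N => ?_)
    rw [proj_seg_singleton, hnone, map_one]
    · rfl
    · exact ⟨0, Nat.zero_le _, by rw [hnone]; trivial⟩
  exact Set.singleton_ne_empty i this

theorem ReducedOn.mono {W : Word G} {D D' : Set W.dom} (h : W.ReducedOn D) (hD : D' ⊆ D) :
    W.ReducedOn D' :=
  ⟨fun I hI => h.1 I (hI.trans hD), fun i hi j hj => h.2 i (hD hi) j (hD hj)⟩

theorem IsMatch.reducedOn {V W : Word G} {δ : ℤˣ} {f : V.dom → W.dom} {A : Set V.dom}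
    (h : IsMatch V W δ f A) (hfA : (f '' A).OrdConnected)
    (hW : W.ReducedOn (f '' A)) : V.ReducedOn A := by
  constructor
  · intro I hI hIc hI1
    have h1 := (h.mono hI).seg_eq
    rw [hI1] at h1
    have h2 : W.seg (f '' I) = 1 := by
      rcases Int.units_eq_one_or δ with rfl | rfl <;> simpa using h1.symm
    have := hW.1 (f '' I) (Set.image_mono hI) (h.ordConnected_image hfA hI hIc) h2
    exact Set.image_eq_empty.mp this
  · rintro i hi j hj hij ⟨n, hn1, hn2⟩
    have hnone : ¬ ∃ b, f i < b ∧ b < f j ∨ f j < b ∧ b < f i := by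
      rintro ⟨b, hb⟩
      have hb' : b ∈ f '' A := by
        rcases hb with hb | hb
        · exact hfA.out ⟨i, hi, rfl⟩ ⟨j, hj, rfl⟩ ⟨hb.1.le, hb.2.le⟩
        · exact hfA.out ⟨j, hj, rfl⟩ ⟨i, hi, rfl⟩ ⟨hb.1.le, hb.2.le⟩
      obtain ⟨c, hc, rfl⟩ := hb'
      rcases hb with hb | hb
      · rcases h.lt_or_lt hi hc hj hb.1 hb.2 with h1 | h1
        · exact hij.2 h1.1 h1.2
        · exact (h1.1.trans h1.2).asymm hij.1
      · rcases h.lt_or_lt hj hc hi hb.1 hb.2 with h1 | h1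
        · exact (h1.1.trans h1.2).asymm hij.1
        · exact hij.2 h1.1 h1.2
    have hl := h.lt hi hj hij.1
    have e1 : (W.letter (f i)).InGroup n := by rw [h.letter hi]; simpa using hn1
    have e2 : (W.letter (f j)).InGroup n := by rw [h.letter hj]; simpa using hn2
    rcases Int.units_eq_one_or δ with rfl | rfl
    · exact hW.2 _ ⟨i, hi, rfl⟩ _ ⟨j, hj, rfl⟩ ⟨by simpa using hl,
        fun c h1 h2 => hnone ⟨c, Or.inl ⟨h1, h2⟩⟩⟩ ⟨n, e1, e2⟩
    · exact hW.2 _ ⟨j, hj, rfl⟩ _ ⟨i, hi, rfl⟩ ⟨by simpa using hl,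
        fun c h1 h2 => hnone ⟨c, Or.inr ⟨h1, h2⟩⟩⟩ ⟨n, e2, e1⟩

/-- A letter outside an interval lies below all of it or above all of it. The third part is given by
the negated condition so that the splitting is also right for `I = ∅`, when all letters go to the
first part. -/
theorem same_concat_of_ordConnected (W : Word G) (I : Set W.dom) (hI : I.OrdConnected) :
    W.Same (concat (W.restrict {i | i ∉ I ∧ ∀ j ∈ I, i < j}) (concat (W.restrict I)
      (W.restrict {i | i ∉ I ∧ ¬ ∀ j ∈ I, i < j}))) := by
  have h1 : ∀ i, i ∉ I ∧ (¬ ∀ j ∈ I, i < j) → ∀ j ∈ I, j < i := by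
    rintro i ⟨hi, h⟩ j hj
    push Not at h
    obtain ⟨k, hk, hki⟩ := h
    by_contra hji
    exact hi (hI.out hk hj ⟨hki, not_lt.mp hji⟩)
  apply Same.symm
  refine same_of_strictMono (V := concat (W.restrict {i | i ∉ I ∧ ∀ j ∈ I, i < j})
      (concat (W.restrict I) (W.restrict {i | i ∉ I ∧ ¬ ∀ j ∈ I, i < j})))
    (fun x => Sum.elim (fun a : {i | i ∉ I ∧ ∀ j ∈ I, i < j} => a.1)
      (fun y => Sum.elim (fun a : I => a.1)
        (fun a : {i | i ∉ I ∧ ¬ ∀ j ∈ I, i < j} => a.1) (ofLex y)) (ofLex x)) ?_ ?_ ?_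
  · intro x y hxy
    obtain ⟨x, rfl⟩ := toLex.surjective x
    obtain ⟨y, rfl⟩ := toLex.surjective y
    rcases x with x | x <;> rcases y with y | y
    · exact (Sum.Lex.inl_lt_inl_iff (α := {i | i ∉ I ∧ ∀ j ∈ I, i < j})).mp hxy
    · obtain ⟨y, rfl⟩ := toLex.surjective y
      rcases y with y | y
      · exact x.2.2 y.1 y.2
      · obtain ⟨k, hk, hky⟩ : ∃ k ∈ I, k ≤ y.1 := by have := y.2.2; push Not at this; exact this
        exact (x.2.2 k hk).trans_le hky
    · exact absurd hxy Sum.Lex.not_inr_lt_inl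
    · have hxy' := (Sum.Lex.inr_lt_inr_iff (β := (concat (W.restrict I)
        (W.restrict {i | i ∉ I ∧ ¬ ∀ j ∈ I, i < j})).dom)).mp hxy
      obtain ⟨x, rfl⟩ := toLex.surjective x
      obtain ⟨y, rfl⟩ := toLex.surjective y
      rcases x with x | x <;> rcases y with y | y
      · exact (Sum.Lex.inl_lt_inl_iff (α := I)).mp hxy'
      · exact h1 y.1 y.2 x.1 x.2
      · exact absurd hxy' Sum.Lex.not_inr_lt_inl
      · exact (Sum.Lex.inr_lt_inr_iff (β := {i | i ∉ I ∧ ¬ ∀ j ∈ I, i < j})).mp hxy'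
  · intro i
    by_cases hi : i ∈ I
    · exact ⟨toLex (Sum.inr (toLex (Sum.inl ⟨i, hi⟩))), rfl⟩
    · by_cases h : ∀ j ∈ I, i < j
      · exact ⟨toLex (Sum.inl ⟨i, hi, h⟩), rfl⟩
      · exact ⟨toLex (Sum.inr (toLex (Sum.inr ⟨i, hi, h⟩))), rfl⟩
  · intro x
    obtain ⟨x, rfl⟩ := toLex.surjective x
    rcases x with x | x
    · rfl
    · obtain ⟨x, rfl⟩ := toLex.surjective x
      rcases x with x | x <;> rfl

theorem isSubword_restrict (W : Word G) {I : Set W.dom} (hI : I.OrdConnected) :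
    (W.restrict I).IsSubword W :=
  ⟨_, _, W.same_concat_of_ordConnected I hI⟩

theorem IsSubword.exists_isMatch {V W : Word G} (h : V.IsSubword W) :
    ∃ f : V.dom → W.dom, IsMatch V W 1 f Set.univ ∧ (f '' Set.univ).OrdConnected := by
  obtain ⟨W₀, W₂, e, he⟩ := h
  obtain ⟨c, hcm, hcl, hc⟩ : ∃ c : V.dom → (concat W₀ (concat V W₂)).dom, StrictMono c ∧
      (∀ a, (concat W₀ (concat V W₂)).letter (c a) = V.letter a) ∧
      ∀ a b x, c a ≤ x → x ≤ c b → ∃ y, c y = x := by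
    refine ⟨fun a => toLex (Sum.inr (toLex (Sum.inl a))), ?_, fun _ => rfl, ?_⟩
    · intro a b hab
      exact (Sum.Lex.inr_lt_inr_iff (β := (concat V W₂).dom)).mpr
        ((Sum.Lex.inl_lt_inl_iff (α := V.dom)).mpr hab)
    · intro a b x h1 h2
      obtain ⟨y, rfl⟩ := toLex.surjective x
      rcases y with y | y
      · exact absurd h1 Sum.Lex.not_inr_le_inl
      · obtain ⟨z, rfl⟩ := toLex.surjective y
        rcases z with z | z
        · exact ⟨z, rfl⟩
        · have := (Sum.Lex.inr_le_inr_iff (β := (concat V W₂).dom)).mp h2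
          exact absurd this Sum.Lex.not_inr_le_inl
  refine ⟨fun i => e.symm (c i), ⟨?_, ?_⟩, ?_⟩
  · intro a _ b _ hab
    exact (signedLT_one _ _).mpr (e.symm.strictMono (hcm hab))
  · intro a _
    rw [he, e.apply_symm_apply, Letter.signed_one, hcl]
  · rw [Set.ordConnected_iff]
    rintro _ ⟨a, -, rfl⟩ _ ⟨b, -, rfl⟩ - x ⟨h1, h2⟩
    obtain ⟨y, hy⟩ := hc a b (e x) (e.symm_apply_le.mp h1) (e.le_symm_apply.mp h2)
    exact ⟨y, trivial, by dsimp only; rw [hy, e.symm_apply_apply]⟩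

/-- Subwords are, up to `≡`, restrictions to order-convex sets, so reducedness can be tested inside
`W` and localised to subsets of its domain. -/
theorem isReduced_iff (W : Word G) : W.IsReduced ↔ W.ReducedOn Set.univ := by
  constructor
  · rintro ⟨h1, h2⟩
    refine ⟨fun I _ hI hI1 => ?_, fun i _ j _ => h2 i j⟩
    obtain ⟨e, -⟩ := h1 _ (W.isSubword_restrict hI) ((mk_eq_one_iff _).mp hI1)
    rw [Set.eq_empty_iff_forall_notMem]
    exact fun i hi => (e ⟨i, hi⟩).elim
  · rintro ⟨h1, h2⟩
    refine ⟨fun V hV hV1 => ?_, fun i j => h2 i trivial j trivial⟩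
    obtain ⟨f, hf, hc⟩ := hV.exists_isMatch
    have h3 := hf.seg_eq
    rw [seg_univ, (mk_eq_one_iff V).mpr hV1] at h3
    have h4 := h1 _ (Set.subset_univ _) hc (by simpa using h3.symm)
    have h5 : ∀ i : V.dom, False := fun i => by
      have : f i ∈ f '' Set.univ := ⟨i, trivial, rfl⟩
      rw [h4] at this; exact this
    exact same_of_strictMono (fun i => (h5 i).elim) (fun i => (h5 i).elim) (fun i => i.elim)
      (fun i => (h5 i).elim)

end Word

theorem Letter.toFree_injective {G : ℕ → Type u} [∀ n, Group (G n)] {N n : ℕ} (hn : n ≤ N)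
    {a b : Letter G} (ha : a.InGroup n) (hb : b.InGroup n) (h : a.toFree N = b.toFree N) :
    a = b := by
  have hn' : n < N + 1 := by omega
  rcases a with _ | ⟨k, g, hg⟩ <;> rcases b with _ | ⟨l, g', hg'⟩
  · rfl
  · obtain rfl : l = n := hb
    simp only [toFree, hn', dite_true] at h
    rw [eq_comm, ← map_one (Monoid.CoprodI.of (M := fun n : Fin (N + 1) => G n) (i := ⟨l, hn'⟩))]
      at h
    exact absurd (Monoid.CoprodI.of_injective _ h) hg'
  · obtain rfl : k = n := ha
    simp only [toFree, hn', dite_true] at h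
    rw [← map_one (Monoid.CoprodI.of (M := fun n : Fin (N + 1) => G n) (i := ⟨k, hn'⟩))] at h
    exact absurd (Monoid.CoprodI.of_injective _ h) hg
  · obtain rfl : k = n := ha
    obtain rfl : l = k := hb
    simp only [toFree, hn', dite_true] at h
    obtain rfl : g = g' :=
      Monoid.CoprodI.of_injective (M := fun n : Fin (N + 1) => G n) ⟨l, hn'⟩ h
    rfl

/-! ### Words composed of pieces of a family -/

namespace Word

variable {G : ℕ → Type u} [∀ n, Group (G n)]

theorem isMatch_inl (V W : Word G) :
    IsMatch V (concat V W) 1 (fun i => toLex (Sum.inl i)) Set.univ :=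
  ⟨fun _ _ _ _ h => (signedLT_one _ _).mpr ((Sum.Lex.inl_lt_inl_iff (β := W.dom)).mpr h),
    fun _ _ => (Letter.signed_one _).symm⟩

theorem isMatch_inr (V W : Word G) :
    IsMatch W (concat V W) 1 (fun i => toLex (Sum.inr i)) Set.univ :=
  ⟨fun _ _ _ _ h => (signedLT_one _ _).mpr ((Sum.Lex.inr_lt_inr_iff (α := V.dom)).mpr h),
    fun _ _ => (Letter.signed_one _).symm⟩

theorem isMatch_toDual (W : Word G) :
    IsMatch W W.inv (-1) (fun i => OrderDual.toDual i) Set.univ :=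
  ⟨fun _ _ _ _ h => (signedLT_neg_one _ _).mpr (OrderDual.toDual_lt_toDual (α := W.dom).mpr h),
    fun _ _ => (Letter.signed_neg_one _).symm⟩

theorem isMatch_val (W : Word G) (S : Set W.dom) :
    IsMatch (W.restrict S) W 1 Subtype.val Set.univ :=
  ⟨fun _ _ _ _ h => (signedLT_one _ _).mpr h, fun _ _ => (Letter.signed_one _).symm⟩

theorem IsMatch.exists_transfer {V W Z : Word G} {ε δ : ℤˣ} {c : V.dom → W.dom}
    {f : V.dom → Z.dom} {A : Set V.dom} (hA : A.Nonempty) (hc : IsMatch V W ε c A)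
    (hf : IsMatch V Z δ f A) :
    ∃ f' : W.dom → Z.dom, IsMatch W Z (ε * δ) f' (c '' A) ∧ ∀ a ∈ A, f' (c a) = f a := by
  have : Nonempty V.dom := ⟨hA.some⟩
  obtain ⟨g, hg⟩ := hc.exists_leftInv
  have h1 := hc.symm hg
  refine ⟨f ∘ g, h1.comp (by rwa [IsMatch.image_image hg]), fun a ha => ?_⟩
  rw [Function.comp_apply, hg a ha]

/-- `A` is matched with an interval of one of the words `Wf x`. -/
def IsPiece {X : Type w} (Wf : X → Red G) (W : Word G) (A : Set W.dom) : Prop :=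
  ∃ x δ, ∃ f : W.dom → (Wf x).1.dom, IsMatch W (Wf x).1 δ f A ∧ (f '' A).OrdConnected

theorem IsPiece.transfer {X : Type w} {Wf : X → Red G} {V W : Word G} {ε : ℤˣ}
    {c : V.dom → W.dom} {A : Set V.dom} (hA : A.Nonempty) (hc : IsMatch V W ε c A)
    (h : IsPiece Wf V A) : IsPiece Wf W (c '' A) := by
  obtain ⟨x, δ, f, hf, hf'⟩ := h
  obtain ⟨f', h1, h2⟩ := hc.exists_transfer hA hf
  refine ⟨x, _, f', h1, ?_⟩
  rwa [Set.image_image, Set.image_congr h2]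

/-- The subgroup of the topologist's product generated by the subwords of the `Wf x`. -/
def subwordGroup {X : Type w} (Wf : X → Red G) : Subgroup (TopProd G) :=
  Subgroup.closure {a | ∃ (x : X) (S : Word G), S.IsSubword (Wf x).1 ∧ TopProd.mk S = a}

theorem IsPiece.seg_mem {X : Type w} {Wf : X → Red G} {W : Word G} {A : Set W.dom}
    (h : IsPiece Wf W A) : W.seg A ∈ subwordGroup Wf := by
  obtain ⟨x, δ, f, hf, hc⟩ := h
  rw [hf.seg_eq]
  have h1 : (Wf x).1.seg (f '' A) ∈ subwordGroup Wf :=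
    Subgroup.subset_closure ⟨x, _, isSubword_restrict _ hc, rfl⟩
  exact Subgroup.zpow_mem _ h1 _

/-- Closure induction: a product juxtaposes the labelled pieces, and an inverse reverses both the
order and the labels. The word `C` need not be reduced; only its pieces are. -/
theorem exists_pieces_of_mem {X : Type w} (Wf : X → Red G) {a : TopProd G}
    (ha : a ∈ subwordGroup Wf) : ∃ (C : Word G) (r : ℕ) (q : C.dom → ℕ), TopProd.mk C = a ∧
      Monotone q ∧ (∀ i, q i < r) ∧ ∀ k, (q ⁻¹' {k}).Nonempty → IsPiece Wf C (q ⁻¹' {k}) := by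
  induction ha using Subgroup.closure_induction with
  | mem a h =>
    obtain ⟨x, S, hS, rfl⟩ := h
    obtain ⟨f, hf, hc⟩ := hS.exists_isMatch
    refine ⟨S, 1, fun _ => 0, rfl, monotone_const, by simp, fun k hk => ?_⟩
    obtain ⟨i, rfl⟩ := hk
    exact ⟨x, 1, f, by simpa using hf, by simpa using hc⟩
  | one =>
    refine ⟨empty, 0, fun _ => 0, rfl, monotone_const, fun i => i.elim, fun k hk => ?_⟩
    exact hk.some.elim
  | mul a b _ _ iha ihb =>
    obtain ⟨C, r, q, rfl, hq, hr, hp⟩ := iha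
    obtain ⟨C', r', q', rfl, hq', hr', hp'⟩ := ihb
    refine ⟨concat C C', r + r', fun i => Sum.elim q (fun j => r + q' j) (ofLex i), rfl,
      ?_, ?_, ?_⟩
    · intro i j hij
      obtain ⟨i, rfl⟩ := toLex.surjective i
      obtain ⟨j, rfl⟩ := toLex.surjective j
      rcases i with i | i <;> rcases j with j | j
      · exact hq ((Sum.Lex.inl_le_inl_iff (β := C'.dom)).mp hij)
      · exact (hr i).le.trans (Nat.le_add_right _ _)
      · exact absurd hij Sum.Lex.not_inr_le_inl
      · exact Nat.add_le_add_left (hq' ((Sum.Lex.inr_le_inr_iff (α := C.dom)).mp hij)) _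
    · intro i
      obtain ⟨i, rfl⟩ := toLex.surjective i
      rcases i with i | i
      · exact (hr i).trans_le (Nat.le_add_right _ _)
      · exact Nat.add_lt_add_left (hr' i) _
    · intro k hk
      rcases lt_or_ge k r with hkr | hkr
      · have he : (fun i : (concat C C').dom => Sum.elim q (fun j => r + q' j) (ofLex i)) ⁻¹' {k} =
            (fun i => toLex (Sum.inl i)) '' (q ⁻¹' {k}) := by
          ext i
          obtain ⟨i, rfl⟩ := toLex.surjective i
          rcases i with i | i
          · constructor
            · intro h; exact ⟨i, h, rfl⟩
            · rintro ⟨j, hj, hji⟩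
              obtain rfl : j = i := Sum.inl_injective (toLex.injective hji)
              exact hj
          · constructor
            · intro (h : r + q' i = k); omega
            · rintro ⟨j, hj, hji⟩
              exact absurd (toLex.injective hji) (by simp)
        rw [he] at hk ⊢
        exact (hp k (Set.image_nonempty.mp hk)).transfer (Set.image_nonempty.mp hk)
          ((isMatch_inl C C').mono (Set.subset_univ _))
      · have he : (fun i : (concat C C').dom => Sum.elim q (fun j => r + q' j) (ofLex i)) ⁻¹' {k} =
            (fun i => toLex (Sum.inr i)) '' (q' ⁻¹' {k - r}) := by
          ext i
          obtain ⟨i, rfl⟩ := toLex.surjective i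
          rcases i with i | i
          · constructor
            · intro (h : q i = k); have := hr i; omega
            · rintro ⟨j, hj, hji⟩
              exact absurd (toLex.injective hji) (by simp)
          · constructor
            · intro (h : r + q' i = k)
              exact ⟨i, show q' i = k - r by omega, rfl⟩
            · rintro ⟨j, hj, hji⟩
              obtain rfl : j = i := Sum.inr_injective (toLex.injective hji)
              have hj' : q' j = k - r := hj
              show r + q' j = k
              omega
        rw [he] at hk ⊢
        exact (hp' _ (Set.image_nonempty.mp hk)).transfer (Set.image_nonempty.mp hk)
          ((isMatch_inr C C').mono (Set.subset_univ _))
  | inv a _ iha =>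
    obtain ⟨C, r, q, rfl, hq, hr, hp⟩ := iha
    refine ⟨C.inv, r, fun i => r - 1 - q (OrderDual.ofDual i), rfl, ?_, ?_, ?_⟩
    · intro i j hij
      have := hq (OrderDual.ofDual_le_ofDual.mpr hij)
      dsimp only
      omega
    · intro i
      have := hr (OrderDual.ofDual i)
      dsimp only
      omega
    · intro k hk
      obtain ⟨i, hi⟩ := hk
      have hi' : r - 1 - q (OrderDual.ofDual i) = k := hi
      have he : (fun i : C.inv.dom => r - 1 - q (OrderDual.ofDual i)) ⁻¹' {k} =
          (fun i => OrderDual.toDual i) '' (q ⁻¹' {r - 1 - k}) := by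
        ext j
        constructor
        · intro (h : r - 1 - q (OrderDual.ofDual j) = k)
          have := hr (OrderDual.ofDual j)
          refine ⟨OrderDual.ofDual j, ?_, rfl⟩
          show q (OrderDual.ofDual j) = r - 1 - k
          omega
        · rintro ⟨l, hl, rfl⟩
          have hl' : q l = r - 1 - k := hl
          have := hr (OrderDual.ofDual i)
          have := hr l
          show r - 1 - q l = k
          omega
      rw [he]
      have := hr (OrderDual.ofDual i)
      have hne : (q ⁻¹' {r - 1 - k}).Nonempty :=
        ⟨OrderDual.ofDual i, show q (OrderDual.ofDual i) = r - 1 - k by omega⟩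
      exact (hp _ hne).transfer hne ((isMatch_toDual C).mono (Set.subset_univ _))

/-! ### Cancelling a reduced word against reduced pieces -/

/-- Suppose `a < b`, and let `c` be the next member of the class after `a`. What lies between `a`
and `c` cancels, hence is empty by reducedness; then `a` and `c` are neighbours in a common group,
which reducedness forbids. -/
theorem Cancellation.eq_of_reducedOn {C : Word G} {R : C.dom → C.dom → Prop}
    (hR : Cancellation C R) {D : Set C.dom} (hD : D.OrdConnected) (hred : C.ReducedOn D)
    {a b : C.dom} (ha : a ∈ D) (hb : b ∈ D) (h : R a b) : a = b := by
  have key : ∀ a b, a ∈ D → b ∈ D → R a b → ¬ a < b := by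
    intro a b ha hb h hab
    obtain ⟨n, hn⟩ := (C.letter a).exists_inGroup
    -- The class lies in one group, so it is finite and a next member exists.
    have hfin : {c | R a c ∧ a < c}.Finite :=
      (C.finite_letters n).subset (fun c hc => hR.inGroup a c n hc.1 hn)
    obtain ⟨c, hc, hmin⟩ := Set.exists_min_image _ id hfin ⟨b, h, hab⟩
    have hcD : c ∈ D := hD.out ha hb ⟨hc.2.le, hmin b ⟨h, hab⟩⟩
    have h1 := hR.next a c hc.2 hc.1
      (fun d h1 h2 h3 => absurd (hmin d ⟨h3, h1⟩) (not_le.mpr h2))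
    have h2 := hred.1 (Set.Ioo a c) (fun d hd => hD.out ha hcD ⟨hd.1.le, hd.2.le⟩)
      Set.ordConnected_Ioo h1
    refine hred.2 a ha c hcD ⟨hc.2, fun d h3 h4 => ?_⟩ ⟨n, hn, hR.inGroup a c n hc.1 hn⟩
    have : d ∈ Set.Ioo a c := ⟨h3, h4⟩
    rw [h2] at this
    exact this
  rcases lt_trichotomy a b with hlt | heq | hlt
  · exact absurd hlt (key a b ha hb h)
  · exact heq
  · exact absurd hlt (key b a hb ha (hR.equiv.symm h))

/-- By `close`, a letter forming a class alone would be a trivial subword. -/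
theorem Cancellation.exists_ne {C : Word G} {R : C.dom → C.dom → Prop}
    (hR : Cancellation C R) {D : Set C.dom} (hred : C.ReducedOn D)
    {a : C.dom} (ha : a ∈ D) : ∃ b, b ≠ a ∧ R a b := by
  by_contra hcon
  push Not at hcon
  have h1 := hR.close a a (hR.equiv.refl a) (fun c hc => by
    by_cases h : c = a
    · rw [h]; exact ⟨le_rfl, le_rfl⟩
    · exact absurd hc (hcon c h))
  have h2 := hred.1 (Set.Icc a a) (by simpa using ha) Set.ordConnected_Icc h1
  simp at h2

/-- For the class `{s, v}`, both the closed interval and its interior are trivial; dividing out the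
interior leaves the product of the two letters. -/
theorem Cancellation.letter_eq_inv {C : Word G} {R : C.dom → C.dom → Prop}
    (hR : Cancellation C R) {s v : C.dom} (hsv : s < v) (h : R s v)
    (hc : ∀ u, R u v → u = s ∨ u = v) : C.letter s = (C.letter v).inv := by
  have hc' : ∀ u, R s u → u = s ∨ u = v := fun u hu =>
    hc u (hR.equiv.trans (hR.equiv.symm hu) h)
  have h1 := hR.next s v hsv h (fun c h1 h2 h3 => by
    rcases hc' c h3 with rfl | rfl
    · exact h1.false
    · exact h2.false)
  have h2 := hR.close s v h (fun c h3 => by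
    rcases hc' c h3 with rfl | rfl
    · exact ⟨le_rfl, hsv.le⟩
    · exact ⟨hsv.le, le_rfl⟩)
  have h3 : C.seg {s} * C.seg {v} = 1 := by
    rw [← h2, ← Set.Icc_union_Ioc_eq_Icc le_rfl hsv.le,
      seg_union C (S := Set.Icc s s) (T := Set.Ioc s v) (fun a ha b hb => ha.2.trans_lt hb.1),
      ← Set.Ioo_union_Icc_eq_Ioc hsv le_rfl,
      seg_union C (S := Set.Ioo s v) (T := Set.Icc v v) (fun a ha b hb => ha.2.trans_le hb.1),
      h1, one_mul, Set.Icc_self, Set.Icc_self]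
  obtain ⟨n, hn⟩ := (C.letter v).exists_inGroup
  have hn' := hR.inGroup v s n (hR.equiv.symm h) hn
  have h4 := congrArg (TopProd.proj n) h3
  rw [map_mul, proj_seg_singleton n C s ⟨n, le_rfl, hn'⟩,
    proj_seg_singleton n C v ⟨n, le_rfl, hn⟩, map_one] at h4
  refine Letter.toFree_injective le_rfl hn' ((Letter.inGroup_inv n _).mpr hn) ?_
  rw [Letter.toFree_inv]
  exact eq_inv_of_mul_eq_one_left h4

theorem ordConnected_fiber {D : Type*} [LinearOrder D] {q : D → ℕ} (hq : Monotone q) (k : ℕ) :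
    (q ⁻¹' {k}).OrdConnected :=
  Set.OrdConnected.preimage_mono Set.ordConnected_singleton hq

theorem IsPiece.reducedOn {X : Type w} {Wf : X → Red G} {W : Word G} {A : Set W.dom}
    (h : IsPiece Wf W A) : W.ReducedOn A := by
  obtain ⟨x, δ, f, hf, hc⟩ := h
  exact hf.reducedOn hc (((isReduced_iff _).mp (Wf x).2).mono (Set.subset_univ _))

theorem reducedOn_empty (W : Word G) : W.ReducedOn ∅ :=
  ⟨fun _ hI _ _ => Set.subset_empty_iff.mp hI, fun _ hi => hi.elim⟩

/-- A class meets each fibre of `p` at most once and is never a singleton. So a letter `v` of the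
last fibre either has exactly one partner, which lies in an earlier fibre `j` and carries the
inverse letter (then `v ∈ A j`), or has partners in two different earlier fibres (then `v ∈ E`). Two
letters of `E` with the same pair of fibres would give crossing classes, so `E` is finite.
Noncrossing also makes each `A j` and the set of its partners convex. -/
theorem Cancellation.exists_cover {C : Word G} {R : C.dom → C.dom → Prop}
    (hR : Cancellation C R) {p : C.dom → ℕ} (hp : Monotone p) {r : ℕ} (hr : ∀ i, p i ≤ r)
    (hred : ∀ k, C.ReducedOn (p ⁻¹' {k})) :
    ∃ (A : ℕ → Set C.dom) (E : Set C.dom), E.Finite ∧ p ⁻¹' {r} = E ∪ ⋃ j ∈ Set.Iio r, A j ∧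
      ∀ j < r, (A j).OrdConnected ∧ ∃ σ : C.dom → C.dom, IsMatch C C (-1) σ (A j) ∧
        (σ '' A j).OrdConnected ∧ σ '' A j ⊆ p ⁻¹' {j} := by
  have inj : ∀ a b, R a b → p a = p b → a = b := fun a b h h' =>
    hR.eq_of_reducedOn (ordConnected_fiber hp (p b)) (hred _) h' rfl h
  have hlt : ∀ a b, p a < p b → a < b := fun a b h => hp.reflect_lt h
  have symm : ∀ {a b}, R a b → R b a := hR.equiv.symm
  have trans : ∀ {a b c}, R a b → R b c → R a c := hR.equiv.trans
  let E : Set C.dom := {v | p v = r ∧ ∃ s s', R s v ∧ R s' v ∧ p s < p s' ∧ p s' < r}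
  let A : ℕ → Set C.dom := fun j =>
    {v | p v = r ∧ ∃ s, p s = j ∧ R s v ∧ ∀ u, R u v → u = s ∨ u = v}
  refine ⟨A, E, ?_, ?_, ?_⟩
  · have hsub : E ⊆ ⋃ jk ∈ (Set.Iio r ×ˢ Set.Iio r : Set (ℕ × ℕ)),
        {v | p v = r ∧ ∃ s s', R s v ∧ R s' v ∧ p s < p s' ∧ p s' < r ∧ (p s, p s') = jk} := by
      rintro v ⟨hv, s, s', h1, h2, h3, h4⟩
      exact Set.mem_biUnion (x := (p s, p s')) ⟨h3.trans h4, h4⟩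
        ⟨hv, s, s', h1, h2, h3, h4, rfl⟩
    refine (Set.Finite.biUnion ((Set.finite_Iio r).prod (Set.finite_Iio r))
      (fun jk _ => Set.Subsingleton.finite ?_)).subset hsub
    -- In `s < t' < v < v'`, noncrossing puts all four letters into one class, but `v` and `v'`
    -- share a fibre.
    have key : ∀ v v' s s' t t', p v = r → p v' = r → R s v → R s' v → R t v' → R t' v' →
        p s < p s' → p s' < r → p t = p s → p t' = p s' → ¬ v < v' := by
      intro v v' s s' t t' hv hv' h1 h2 h3 h4 h5 h6 h7 h8 hvv
      have := hR.cross s t' v v' (hlt _ _ (by omega)) (hlt _ _ (by omega)) hvv h1 h4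
      exact hvv.ne (inj v v' (trans (symm h1) (trans this h4)) (by omega))
    rintro v ⟨hv, s, s', h1, h2, h3, h4, h5⟩ v' ⟨hv', t, t', k1, k2, k3, k4, k5⟩
    rw [← k5, Prod.mk.injEq] at h5
    rcases lt_trichotomy v v' with h | h | h
    · exact absurd h (key v v' s s' t t' hv hv' h1 h2 k1 k2 h3 h4 h5.1.symm h5.2.symm)
    · exact h
    · exact absurd h (key v' v t t' s s' hv' hv k1 k2 h1 h2 k3 k4 h5.1 h5.2)
  · ext v
    constructor
    · intro (hv : p v = r)
      obtain ⟨b, hbv, hb⟩ := hR.exists_ne (hred (p v)) rfl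
      have hpart : ∀ u, u ≠ v → R u v → p u < r := by
        intro u hu huv
        refine lt_of_le_of_ne (hr u) (fun h => hu (inj u v huv (h.trans hv.symm)))
      by_cases hall : ∀ u, R u v → u = b ∨ u = v
      · right
        exact Set.mem_biUnion (x := p b) (hpart b hbv (symm hb)) ⟨hv, b, rfl, symm hb, hall⟩
      · push Not at hall
        obtain ⟨u, hu, hub, huv⟩ := hall
        left
        have hne : p u ≠ p b := fun h => hub (inj u b (trans hu hb) h)
        rcases lt_or_gt_of_ne hne with h | h
        · exact ⟨hv, u, b, hu, symm hb, h, hpart b hbv (symm hb)⟩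
        · exact ⟨hv, b, u, symm hb, hu, h, hpart u huv hu⟩
    · rintro (h | h)
      · exact h.1
      · obtain ⟨j, _, hj⟩ := Set.mem_iUnion₂.mp h
        exact hj.1
  · intro j hj
    have anti : ∀ v v' s s', p v = r → p v' = r → p s = j → p s' = j → R s v → R s' v' →
        v < v' → s' < s := by
      intro v v' s s' hv hv' hs hs' h h' hvv
      rcases lt_trichotomy s s' with hss | hss | hss
      · have := hR.cross s s' v v' hss (hlt _ _ (by omega)) hvv h h'
        exact absurd (inj s s' this (by omega)) hss.ne
      · exact absurd (inj v v' (trans (symm h) (hss ▸ h')) (by omega)) hvv.ne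
      · exact hss
    have hne : ∀ v v' w, p v = r → p v' = r → v ≠ v' → R w v → ¬ R w v' := by
      intro v v' w hv hv' hvv h h'
      exact hvv (inj v v' (trans (symm h) h') (by omega))
    constructor
    · rw [Set.ordConnected_iff]
      rintro v ⟨hv, s, hs, hsv, hsc⟩ v'' ⟨hv'', s'', hs'', hsv'', hsc''⟩ - v' ⟨h1, h2⟩
      rcases eq_or_lt_of_le h1 with rfl | h1
      · exact ⟨hv, s, hs, hsv, hsc⟩
      rcases eq_or_lt_of_le h2 with rfl | h2
      · exact ⟨hv'', s'', hs'', hsv'', hsc''⟩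
      have hv' : p v' = r := le_antisymm (hr _) (hv ▸ hp h1.le)
      have hss := anti v v'' s s'' hv hv'' hs hs'' hsv hsv'' (h1.trans h2)
      -- Noncrossing confines the partners of `v'` to the stretch between `s''` and `s`, whose ends
      -- both lie in fibre `j`.
      have claim : ∀ u, u ≠ v' → R u v' → p u = j := by
        intro u hu huv
        have hpu : p u < r := lt_of_le_of_ne (hr u) (fun h => hu (inj u v' huv (by omega)))
        have c1 : s'' < u := by
          rcases lt_trichotomy u s'' with h | h | h
          · have := hR.cross u s'' v' v'' h (hlt _ _ (by omega)) h2 huv hsv''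
            exact absurd (trans this hsv'') (hne v' v'' u hv' hv'' h2.ne huv)
          · exact absurd (h ▸ hsv'') (hne v' v'' u hv' hv'' h2.ne huv)
          · exact h
        have c2 : u < s := by
          rcases lt_trichotomy u s with h | h | h
          · exact h
          · exact absurd (h ▸ huv) (hne v v' s hv hv' h1.ne hsv)
          · have := hR.cross s u v v' h (hlt _ _ (by omega)) h1 hsv huv
            exact absurd (trans this huv) (hne v v' s hv hv' h1.ne hsv)
        have e1 := hp c1.le
        have e2 := hp c2.le
        omega
      obtain ⟨b, hbv, hb⟩ := hR.exists_ne (hred (p v')) rfl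
      refine ⟨hv', b, claim b hbv (symm hb), symm hb, fun u hu => ?_⟩
      by_cases huv : u = v'
      · exact Or.inr huv
      · exact Or.inl (inj u b (trans hu hb)
          ((claim u huv hu).trans (claim b hbv (symm hb)).symm))
    · have hex : ∀ v, ∃ s, v ∈ A j → p s = j ∧ R s v ∧ ∀ u, R u v → u = s ∨ u = v := by
        intro v
        by_cases hv : v ∈ A j
        · obtain ⟨s, hs⟩ := hv.2
          exact ⟨s, fun _ => hs⟩
        · exact ⟨v, fun h => absurd h hv⟩
      choose σ hσ using hex
      refine ⟨σ, ⟨?_, ?_⟩, ?_, ?_⟩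
      · intro v hv v' hv' hvv
        rw [signedLT_neg_one]
        exact anti v v' _ _ hv.1 hv'.1 (hσ v hv).1 (hσ v' hv').1 (hσ v hv).2.1 (hσ v' hv').2.1 hvv
      · intro v hv
        obtain ⟨h1, h2, h3⟩ := hσ v hv
        rw [Letter.signed_neg_one]
        exact hR.letter_eq_inv (hlt _ _ (by rw [h1, hv.1]; exact hj)) h2 h3
      · rw [Set.ordConnected_iff]
        rintro _ ⟨v'', hv'', rfl⟩ _ ⟨v, hv, rfl⟩ hle u ⟨h1, h2⟩
        obtain ⟨hs, hsv, hsc⟩ := hσ v hv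
        obtain ⟨hs'', hsv'', hsc''⟩ := hσ v'' hv''
        rcases eq_or_lt_of_le h1 with rfl | h1
        · exact ⟨v'', hv'', rfl⟩
        rcases eq_or_lt_of_le h2 with rfl | h2
        · exact ⟨v, hv, rfl⟩
        have hvv : v < v'' := by
          rcases lt_trichotomy v v'' with h | h | h
          · exact h
          · rw [h] at h2; exact absurd (h1.trans h2) (lt_irrefl _)
          · exact absurd (anti v'' v _ _ hv''.1 hv.1 hs'' hs hsv'' hsv h) (h1.trans h2).asymm
        have hpu : p u = j := by
          have e1 := hp h1.le
          have e2 := hp h2.le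
          omega
        have hnu : ∀ t, p t = j → t ≠ u → ¬ R u t := fun t ht htu h =>
          htu (inj t u (symm h) (by omega))
        -- Noncrossing with the pairs `(σ v'', v'')` and `(σ v, v)`, and the fact that `u` has no
        -- other partner in fibre `j`, leave only the last fibre.
        have claim : ∀ w, w ≠ u → R u w → p w = r := by
          intro w hwu huw
          have hpw : p w ≠ j := fun h => hnu w h hwu huw
          rcases lt_trichotomy w (σ v'') with h | h | h
          · have := hR.cross w (σ v'') u v'' h h1 (hlt _ _ (by rw [hv''.1]; omega))
              (symm huw) hsv''
            exact absurd (trans huw this) (hnu _ hs'' h1.ne)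
          · exact absurd (h ▸ hs'') hpw
          · rcases le_or_gt w (σ v) with h' | h'
            · have e1 := hp h.le
              have e2 := hp h'
              omega
            · rcases lt_trichotomy w v with k | k | k
              · have := hR.cross u (σ v) w v h2 h' k huw hsv
                exact absurd this (hnu _ hs h2.ne')
              · exact absurd (trans huw (by rw [k]; exact symm hsv)) (hnu _ hs h2.ne')
              · exact le_antisymm (hr _) (hv.1 ▸ hp k.le)
        obtain ⟨w, hwu, hw⟩ := hR.exists_ne (hred (p u)) rfl
        have hwr := claim w hwu hw
        have hwA : w ∈ A j := by
          refine ⟨hwr, u, hpu, hw, fun t ht => ?_⟩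
          by_cases htu : t = u
          · exact Or.inl htu
          · exact Or.inr (inj t w ht ((claim t htu (trans hw (symm ht))).trans hwr.symm))
        refine ⟨w, hwA, ?_⟩
        obtain ⟨k1, k2, k3⟩ := hσ w hwA
        exact inj _ _ (trans k2 (symm hw)) (k1.trans hpu.symm)
      · rintro _ ⟨v, hv, rfl⟩
        exact (hσ v hv).1

end Word
namespace Word

variable {G : ℕ → Type u} [∀ n, Group (G n)]

/-- `C` consists of pieces with product `W.seg D`, followed by the inverse of `W ↾ D` as the part
labelled `r`. The map `π` sends a letter to its inverted copy, whence the sign `-1`. -/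
theorem exists_cancelling_word {X : Type w} (Wf : X → Red G) (W : Word G) {D : Set W.dom}
    (hne : D.Nonempty) (hmem : W.seg D ∈ subwordGroup Wf) :
    ∃ (C : Word G) (r : ℕ) (p : C.dom → ℕ) (π : W.dom → C.dom), TopProd.mk C = 1 ∧ Monotone p ∧
      (∀ i, p i ≤ r) ∧ (∀ k < r, (p ⁻¹' {k}).Nonempty → IsPiece Wf C (p ⁻¹' {k})) ∧
      IsMatch W C (-1) π D ∧ π '' D = p ⁻¹' {r} := by
  obtain ⟨C₀, r, q, hC, hq, hr, hpc⟩ := exists_pieces_of_mem Wf hmem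
  have hm : IsMatch (W.restrict D) (concat C₀ (W.restrict D).inv) (-1)
      (fun i => toLex (Sum.inr (OrderDual.toDual i))) Set.univ := by
    have := (isMatch_toDual (W.restrict D)).comp
      ((isMatch_inr C₀ (W.restrict D).inv).mono (Set.subset_univ _))
    rwa [mul_one] at this
  have hne' : (Set.univ : Set (W.restrict D).dom).Nonempty := ⟨⟨hne.some, hne.some_mem⟩, trivial⟩
  obtain ⟨π, hπ, hπ'⟩ := (isMatch_val W D).exists_transfer hne' hm
  have hπD : IsMatch W (concat C₀ (W.restrict D).inv) (-1) π D := by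
    rw [one_mul] at hπ
    exact hπ.mono (fun d hd => ⟨(⟨d, hd⟩ : D), trivial, rfl⟩)
  refine ⟨concat C₀ (W.restrict D).inv, r, fun i => Sum.elim q (fun _ => r) (ofLex i), π,
    ?_, ?_, ?_, ?_, ?_, ?_⟩
  · rw [mk_concat, hC, mk_inv]
    exact mul_inv_cancel _
  · intro i j hij
    obtain ⟨i, rfl⟩ := toLex.surjective i
    obtain ⟨j, rfl⟩ := toLex.surjective j
    rcases i with i | i <;> rcases j with j | j
    · exact hq ((Sum.Lex.inl_le_inl_iff (β := (W.restrict D).inv.dom)).mp hij)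
    · exact (hr i).le
    · exact absurd hij Sum.Lex.not_inr_le_inl
    · exact le_rfl
  · intro i
    obtain ⟨i, rfl⟩ := toLex.surjective i
    rcases i with i | i
    · exact (hr i).le
    · exact le_rfl
  · intro k hk hkn
    have he : (fun i : (concat C₀ (W.restrict D).inv).dom => Sum.elim q (fun _ => r) (ofLex i)) ⁻¹'
        {k} = (fun i => toLex (Sum.inl i)) '' (q ⁻¹' {k}) := by
      ext i
      obtain ⟨i, rfl⟩ := toLex.surjective i
      rcases i with i | i
      · constructor
        · intro h; exact ⟨i, h, rfl⟩
        · rintro ⟨j, hj, hji⟩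
          obtain rfl : j = i := Sum.inl_injective (toLex.injective hji)
          exact hj
      · constructor
        · intro (h : r = k); omega
        · rintro ⟨j, hj, hji⟩
          exact absurd (toLex.injective hji) (by simp)
    rw [he] at hkn ⊢
    exact (hpc k (Set.image_nonempty.mp hkn)).transfer (Set.image_nonempty.mp hkn)
      ((isMatch_inl _ _).mono (Set.subset_univ _))
  · exact hπD
  · ext i
    constructor
    · rintro ⟨d, hd, rfl⟩
      have := hπ' (⟨d, hd⟩ : D) trivial
      change π d = _ at this
      rw [this]
      rfl
    · obtain ⟨i, rfl⟩ := toLex.surjective i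
      rcases i with i | i
      · intro (h : q i = r)
        exact absurd h (hr i).ne
      · intro _
        exact ⟨(OrderDual.ofDual i : D).1, (OrderDual.ofDual i : D).2,
          hπ' (OrderDual.ofDual i) trivial⟩

/-- Going from `D` to its inverted copy by `π`, and from there to partners in piece `j` by `σ`,
reverses the order twice; this matches an interval of `D` with an interval of piece `j`, hence of a
word of the family. The finitely many exceptional letters become singletons. -/
theorem exists_piece_cover {X : Type w} (Wf : X → Red G) (W : Word G) {D : Set W.dom}
    (hD : D.OrdConnected) (hred : W.ReducedOn D) (hmem : W.seg D ∈ subwordGroup Wf) :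
    ∃ 𝒜 : Set (Set W.dom), 𝒜.Finite ∧ D ⊆ ⋃₀ 𝒜 ∧
      ∀ A ∈ 𝒜, A ⊆ D ∧ A.OrdConnected ∧ (A.Finite ∨ IsPiece Wf W A) := by
  rcases D.eq_empty_or_nonempty with rfl | hne
  · exact ⟨∅, Set.finite_empty, Set.empty_subset _, fun A hA => hA.elim⟩
  obtain ⟨C, r, p, π, hC, hp, hr, hpc, hπ, hπD⟩ := exists_cancelling_word Wf W hne hmem
  have : Nonempty W.dom := ⟨hne.some⟩
  obtain ⟨g, hg⟩ := hπ.exists_leftInv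
  have hredr : C.ReducedOn (p ⁻¹' {r}) := by
    rw [← hπD]
    refine (hπ.symm hg).reducedOn ?_ ?_ <;> rw [IsMatch.image_image hg]
    · exact hD
    · exact hred
  have hredk : ∀ k, C.ReducedOn (p ⁻¹' {k}) := by
    intro k
    rcases (p ⁻¹' {k}).eq_empty_or_nonempty with h | h
    · rw [h]; exact reducedOn_empty C
    · obtain ⟨i, rfl⟩ := h
      rcases (hr i).lt_or_eq with h1 | h1
      · exact (hpc _ h1 ⟨i, rfl⟩).reducedOn
      · rw [h1]; exact hredr
  obtain ⟨R, hR⟩ := exists_cancellation C hC (fun i => (hredk (p i)).letter_ne_none rfl)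
  obtain ⟨A, E, hE, hAE, hA⟩ := hR.exists_cover hp hr hredk
  refine ⟨(fun v => {g v}) '' E ∪ (fun j => D ∩ π ⁻¹' (A j)) '' Set.Iio r,
    (hE.image _).union ((Set.finite_Iio r).image _), ?_, ?_⟩
  · intro d hd
    have h1 : π d ∈ p ⁻¹' {r} := by rw [← hπD]; exact ⟨d, hd, rfl⟩
    rw [hAE] at h1
    rcases h1 with h1 | h1
    · exact ⟨{g (π d)}, Or.inl ⟨_, h1, rfl⟩, by rw [hg d hd]; rfl⟩
    · obtain ⟨j, hj, hdj⟩ := Set.mem_iUnion₂.mp h1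
      exact ⟨_, Or.inr ⟨j, hj, rfl⟩, hd, hdj⟩
  · rintro _ (⟨v, hv, rfl⟩ | ⟨j, hj, rfl⟩)
    · have h1 : v ∈ π '' D := by rw [hπD, hAE]; exact Or.inl hv
      obtain ⟨d, hd, rfl⟩ := h1
      dsimp only
      rw [hg d hd]
      exact ⟨by simpa using hd, Set.ordConnected_singleton, Or.inl (Set.finite_singleton d)⟩
    · obtain ⟨hAj, σ, hσ, hσc, hσj⟩ := hA j hj
      dsimp only
      have hsub : D ∩ π ⁻¹' A j ⊆ D := Set.inter_subset_left
      refine ⟨hsub, hπ.ordConnected_preimage hD hAj, ?_⟩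
      rcases (D ∩ π ⁻¹' A j).eq_empty_or_nonempty with h | h
      · left; rw [h]; exact Set.finite_empty
      · right
        have hAjP : A j ⊆ π '' D := by
          rw [hπD, hAE]
          exact fun v hv => Or.inr (Set.mem_biUnion hj hv)
        have him : π '' (D ∩ π ⁻¹' A j) = A j := by
          rw [Set.image_inter_preimage, Set.inter_eq_right]; exact hAjP
        have hfib : (p ⁻¹' {j}).Nonempty := by
          obtain ⟨d, hd⟩ := h
          exact ⟨σ (π d), hσj ⟨π d, hd.2, rfl⟩⟩
        obtain ⟨x, δ, f, hf, hfc⟩ := hpc j hj hfib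
        have h1 : IsMatch W C (-1 * -1) (σ ∘ π) (D ∩ π ⁻¹' A j) :=
          (hπ.mono hsub).comp (by rwa [him])
        have h2 : (σ ∘ π) '' (D ∩ π ⁻¹' A j) = σ '' A j := by rw [Set.image_comp, him]
        refine ⟨x, _, f ∘ (σ ∘ π), h1.comp (hf.mono (by rwa [h2])), ?_⟩
        rw [Set.image_comp, h2]
        exact hf.ordConnected_image hfc hσj hσc

end Word

/-! ### Close order isomorphisms as relations -/

/-- Induction on the number of points of `S` in `A`: with none, closeness applies; otherwise
removing one splits `A` into two intervals containing fewer. -/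
theorem IsClose.finite_of_finite_inter {Λ : Type*} [LinearOrder Λ] {S : Set Λ} (hS : IsClose S)
    {A : Set Λ} (hA : A.OrdConnected) (h : (A ∩ S).Finite) : A.Finite := by
  obtain ⟨n, hn⟩ : ∃ n, (A ∩ S).ncard ≤ n := ⟨_, le_rfl⟩
  induction n generalizing A with
  | zero =>
    by_contra hinf
    have := hS A hA hinf
    rw [Nat.le_zero, Set.ncard_eq_zero h] at hn
    rw [hn] at this
    exact Set.not_nonempty_empty this
  | succ n ih =>
    by_contra hinf
    obtain ⟨a, haA, haS⟩ := hS A hA hinf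
    have key : ∀ B : Set Λ, B.OrdConnected → a ∉ B → (A ∩ B).Finite := by
      intro B hB haB
      have hsub : A ∩ B ∩ S ⊆ (A ∩ S) \ {a} := by
        rintro x ⟨⟨h1, h2⟩, h3⟩
        exact ⟨⟨h1, h3⟩, fun h => haB (h ▸ h2)⟩
      refine ih (hA.inter hB) (h.subset (hsub.trans Set.sdiff_subset)) ?_
      have h1 := Set.ncard_le_ncard hsub (h.subset Set.sdiff_subset)
      have h2 := Set.ncard_sdiff_singleton_lt_of_mem (s := A ∩ S) (a := a) ⟨haA, haS⟩ h
      omega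
    apply hinf
    refine (((key (Set.Iio a) Set.ordConnected_Iio (lt_irrefl a)).union
      (key (Set.Ioi a) Set.ordConnected_Ioi (lt_irrefl a))).union (Set.finite_singleton a)).subset ?_
    intro x hx
    rcases lt_trichotomy x a with h | h | h
    · exact Or.inl (Or.inl ⟨hx, h⟩)
    · exact Or.inr h
    · exact Or.inl (Or.inr ⟨hx, h⟩)

namespace Coi

variable {Λ Θ : Type*} [LinearOrder Λ] [LinearOrder Θ]

/-- The graph of a coi. -/
def Rel (ι : Coi Λ Θ) (a : Λ) (u : Θ) : Prop := ∃ h : a ∈ ι.source, (ι.iso ⟨a, h⟩ : Θ) = u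

theorem rel_symm (ι : Coi Λ Θ) (a : Λ) (u : Θ) : ι.symm.Rel u a ↔ ι.Rel a u := by
  constructor
  · rintro ⟨h, rfl⟩
    exact ⟨(ι.iso.symm ⟨u, h⟩).2, congrArg Subtype.val (ι.iso.apply_symm_apply ⟨u, h⟩)⟩
  · rintro ⟨h, rfl⟩
    exact ⟨(ι.iso ⟨a, h⟩).2, congrArg Subtype.val (ι.iso.symm_apply_apply ⟨a, h⟩)⟩

theorem Rel.lt_iff {ι : Coi Λ Θ} {a b : Λ} {u v : Θ} (h : ι.Rel a u) (h' : ι.Rel b v) :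
    a < b ↔ u < v := by
  obtain ⟨h, rfl⟩ := h
  obtain ⟨h', rfl⟩ := h'
  rw [Subtype.coe_lt_coe, ι.iso.lt_iff_lt]
  exact Iff.rfl

theorem Rel.le_iff {ι : Coi Λ Θ} {a b : Λ} {u v : Θ} (h : ι.Rel a u) (h' : ι.Rel b v) :
    a ≤ b ↔ u ≤ v := by
  rw [← not_lt, ← not_lt, h'.lt_iff h]

theorem Rel.left_unique {ι : Coi Λ Θ} {a b : Λ} {u : Θ} (h : ι.Rel a u) (h' : ι.Rel b u) :
    a = b := le_antisymm ((h.le_iff h').mpr le_rfl) ((h'.le_iff h).mpr le_rfl)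

theorem exists_rel_of_mem_source {ι : Coi Λ Θ} {a : Λ} (h : a ∈ ι.source) : ∃ u, ι.Rel a u :=
  ⟨_, h, rfl⟩

theorem exists_rel_of_mem_target {ι : Coi Λ Θ} {u : Θ} (h : u ∈ ι.target) : ∃ a, ι.Rel a u :=
  ⟨_, (ι.iso.symm ⟨u, h⟩).2, congrArg Subtype.val (ι.iso.apply_symm_apply ⟨u, h⟩)⟩

theorem mem_hull {ι : Coi Λ Θ} {I : Set Λ} {θ : Θ} :
    θ ∈ ι.hull I ↔ ∃ a ∈ I, ∃ b ∈ I, ∃ u v, ι.Rel a u ∧ ι.Rel b v ∧ u ≤ θ ∧ θ ≤ v := by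
  constructor
  · rintro ⟨a, b, ha, hb, h1, h2⟩
    exact ⟨a, ha, b, hb, _, _, ⟨a.2, rfl⟩, ⟨b.2, rfl⟩, h1, h2⟩
  · rintro ⟨a, ha, b, hb, u, v, ⟨ha', rfl⟩, ⟨hb', rfl⟩, h1, h2⟩
    exact ⟨⟨a, ha'⟩, ⟨b, hb'⟩, ha, hb, h1, h2⟩

theorem hull_mono (ι : Coi Λ Θ) {I J : Set Λ} (h : I ⊆ J) : ι.hull I ⊆ ι.hull J := by
  rintro θ ⟨a, b, ha, hb, h1, h2⟩
  exact ⟨a, b, h ha, h hb, h1, h2⟩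

theorem ordConnected_hull (ι : Coi Λ Θ) (I : Set Λ) : (ι.hull I).OrdConnected := by
  rw [Set.ordConnected_iff]
  rintro x ⟨a, b, ha, hb, h1, h2⟩ y ⟨c, d, hc, hd, h3, h4⟩ - z ⟨h5, h6⟩
  exact ⟨a, d, ha, hd, h1.trans h5, h6.trans h4⟩

theorem Rel.mem_hull {ι : Coi Λ Θ} {a : Λ} {u : Θ} (h : ι.Rel a u) {I : Set Λ} (ha : a ∈ I) :
    u ∈ ι.hull I :=
  Coi.mem_hull.mpr ⟨a, ha, a, ha, u, u, h, h, le_rfl, le_rfl⟩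

theorem Rel.mem_of_mem_hull {ι : Coi Λ Θ} {a : Λ} {u : Θ} (h : ι.Rel a u) {I : Set Λ}
    (hI : I.OrdConnected) (hu : u ∈ ι.hull I) : a ∈ I := by
  obtain ⟨b, hb, c, hc, v, w, h1, h2, h3, h4⟩ := Coi.mem_hull.mp hu
  exact hI.out hb hc ⟨(h1.le_iff h).mpr h3, (h.le_iff h2).mpr h4⟩

theorem finite_hull (ι : Coi Λ Θ) {I : Set Λ} (hI : I.OrdConnected)
    (h : (I ∩ ι.source).Finite) : (ι.hull I).Finite := by
  refine ι.close_target.finite_of_finite_inter (ι.ordConnected_hull I) ?_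
  have hsub : ι.hull I ∩ ι.target ⊆
      (fun a : ι.source => (ι.iso a : Θ)) '' ((fun a : ι.source => (a : Λ)) ⁻¹' (I ∩ ι.source)) := by
    rintro u ⟨hu, hut⟩
    obtain ⟨a, ha⟩ := exists_rel_of_mem_target hut
    exact ⟨⟨a, ha.1⟩, ⟨ha.mem_of_mem_hull hI hu, ha.1⟩, ha.2⟩
  exact ((h.preimage Subtype.val_injective.injOn).image _).subset hsub

/-- A coi from a strictly monotone relation with close domain and range. -/
theorem exists_of_rel (P : Λ → Θ → Prop)
    (hP : ∀ a u b v, P a u → P b v → (a < b ↔ u < v))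
    (hs : IsClose {a | ∃ u, P a u}) (ht : IsClose {u | ∃ a, P a u}) :
    ∃ ι : Coi Λ Θ, ∀ a u, ι.Rel a u ↔ P a u := by
  have huniq : ∀ a u v, P a u → P a v → u = v := fun a u v h h' =>
    le_antisymm (not_lt.mp fun h1 => lt_irrefl a ((hP a v a u h' h).mpr h1))
      (not_lt.mp fun h1 => lt_irrefl a ((hP a u a v h h').mpr h1))
  choose f hf using fun a : {a | ∃ u, P a u} => a.2
  let φ : {a | ∃ u, P a u} → {u | ∃ a, P a u} := fun a => ⟨f a, a.1, hf a⟩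
  have hmono : StrictMono φ := fun a b hab => (hP _ _ _ _ (hf a) (hf b)).mp hab
  have hsurj : Function.Surjective φ := by
    rintro ⟨u, a, hau⟩
    exact ⟨⟨a, u, hau⟩, Subtype.ext (huniq a _ _ (hf ⟨a, u, hau⟩) hau)⟩
  refine ⟨⟨_, _, hs, ht, hmono.orderIsoOfSurjective φ hsurj⟩, fun a u => ⟨?_, ?_⟩⟩
  · rintro ⟨h, rfl⟩
    exact hf ⟨a, h⟩
  · intro h
    exact ⟨⟨u, h⟩, huniq a _ _ (hf ⟨a, u, h⟩) h⟩

end Coi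

/-! ### Monotone labellings with small fibres -/

/-- The label of a point counts the members of `𝒰` containing it. For upper sets these subfamilies
grow with the point, so equal counts mean equal subfamilies. -/
theorem exists_monotone_label {D : Type*} [LinearOrder D] {𝒰 : Set (Set D)} (hfin : 𝒰.Finite)
    (hup : ∀ U ∈ 𝒰, IsUpperSet U) : ∃ (q : D → ℕ) (r : ℕ), Monotone q ∧ (∀ d, q d < r) ∧
      ∀ d d', q d = q d' → ∀ U ∈ 𝒰, d ∈ U → d' ∈ U := by
  classical
  have hm : ∀ d d' : D, d ≤ d' → (hfin.toFinset.filter (d ∈ ·)) ⊆ (hfin.toFinset.filter (d' ∈ ·)) := by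
    intro d d' h U hU
    rw [Finset.mem_filter, Set.Finite.mem_toFinset] at hU ⊢
    exact ⟨hU.1, hup U hU.1 h hU.2⟩
  refine ⟨fun d => (hfin.toFinset.filter (d ∈ ·)).card, hfin.toFinset.card + 1,
    fun d d' h => Finset.card_le_card (hm d d' h),
    fun d => Nat.lt_succ_of_le (Finset.card_filter_le _ _), ?_⟩
  intro d d' h U hU hdU
  have heq : hfin.toFinset.filter (d ∈ ·) = hfin.toFinset.filter (d' ∈ ·) := by
    rcases le_total d d' with h1 | h1
    · exact Finset.eq_of_subset_of_card_le (hm d d' h1) h.ge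
    · exact (Finset.eq_of_subset_of_card_le (hm d' d h1) h.le).symm
  have h2 : U ∈ hfin.toFinset.filter (d' ∈ ·) := by
    rw [← heq, Finset.mem_filter, Set.Finite.mem_toFinset]
    exact ⟨hU, hdU⟩
  exact (Finset.mem_filter.mp h2).2

/-- Membership in an interval is determined by two upper sets: the points above some element of it
and the points strictly above all of it. -/
theorem exists_monotone_label_of_cover {D : Type*} [LinearOrder D] {𝒜 : Set (Set D)}
    (hfin : 𝒜.Finite) (hc : ∀ A ∈ 𝒜, A.OrdConnected) :
    ∃ (q : D → ℕ) (r : ℕ), Monotone q ∧ (∀ d, q d < r) ∧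
      ∀ d d', q d = q d' → ∀ A ∈ 𝒜, d ∈ A → d' ∈ A := by
  obtain ⟨q, r, h1, h2, h3⟩ := exists_monotone_label
    (𝒰 := (fun A => {v | ∃ a ∈ A, a ≤ v}) '' 𝒜 ∪ (fun A => {v | ∀ a ∈ A, a < v}) '' 𝒜)
    ((hfin.image _).union (hfin.image _)) (by
      rintro _ (⟨A, _, rfl⟩ | ⟨A, _, rfl⟩)
      · rintro a b hab ⟨c, hc, hca⟩
        exact ⟨c, hc, hca.trans hab⟩
      · intro a b hab h c hc
        exact (h c hc).trans_le hab)
  refine ⟨q, r, h1, h2, fun d d' h A hA hdA => ?_⟩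
  obtain ⟨a, ha, had⟩ := h3 d d' h _ (Or.inl ⟨A, hA, rfl⟩) ⟨d, hdA, le_rfl⟩
  have h4 : ¬ ∀ a ∈ A, a < d' := fun hall =>
    lt_irrefl d (h3 d' d h.symm _ (Or.inr ⟨A, hA, rfl⟩) hall d hdA)
  push Not at h4
  obtain ⟨b, hb, hdb⟩ := h4
  exact (hc A hA).out ha hb ⟨had, hdb⟩

/-- `Λ` is cut where the coi reaches each `θ ∈ F` and where it passes it. If the hull of a fibre
still contains `θ`, every source point of the fibre is sent to `θ` itself; so there is at most one
such point, and closeness makes the fibre finite. -/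
theorem Coi.exists_label_avoiding {Λ Θ : Type*} [LinearOrder Λ] [LinearOrder Θ] (ι : Coi Λ Θ)
    {F : Set Θ} (hF : F.Finite) : ∃ (q : Λ → ℕ) (r : ℕ), Monotone q ∧ (∀ d, q d < r) ∧
      ∀ k, (q ⁻¹' {k}).Finite ∨ ∀ θ ∈ ι.hull (q ⁻¹' {k}), θ ∉ F := by
  obtain ⟨q, r, h1, h2, h3⟩ := exists_monotone_label
    (𝒰 := (fun θ => {c | ∃ a u, a ≤ c ∧ ι.Rel a u ∧ θ ≤ u}) '' F ∪
      (fun θ => {c | ∃ a u, a ≤ c ∧ ι.Rel a u ∧ θ < u}) '' F)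
    ((hF.image _).union (hF.image _)) (by
      rintro _ (⟨θ, _, rfl⟩ | ⟨θ, _, rfl⟩)
      · rintro c d hcd ⟨a, u, h1, h2⟩
        exact ⟨a, u, h1.trans hcd, h2⟩
      · rintro c d hcd ⟨a, u, h1, h2⟩
        exact ⟨a, u, h1.trans hcd, h2⟩)
  refine ⟨q, r, h1, h2, fun k => ?_⟩
  by_contra hcon
  push Not at hcon
  obtain ⟨hinf, θ, hθ, hθF⟩ := hcon
  obtain ⟨a, ha, b, hb, u, v, hau, hbv, huθ, hθv⟩ := Coi.mem_hull.mp hθ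
  have hge : ∀ c ∈ q ⁻¹' {k}, ∀ w, ι.Rel c w → θ ≤ w := by
    intro c hc w hcw
    obtain ⟨d, z, hd, hdz, hz⟩ := h3 b c (hb.trans hc.symm) _ (Or.inl ⟨θ, hθF, rfl⟩)
      ⟨b, v, le_rfl, hbv, hθv⟩
    exact hz.trans ((hdz.le_iff hcw).mp hd)
  have hle : ∀ c ∈ q ⁻¹' {k}, ∀ w, ι.Rel c w → w ≤ θ := by
    intro c hc w hcw
    by_contra hlt
    obtain ⟨d, z, hd, hdz, hz⟩ := h3 c a (hc.trans ha.symm) _ (Or.inr ⟨θ, hθF, rfl⟩)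
      ⟨c, w, le_rfl, hcw, not_le.mp hlt⟩
    exact absurd ((hdz.le_iff hau).mp hd) (not_le.mpr (huθ.trans_lt hz))
  apply hinf
  refine ι.close_source.finite_of_finite_inter (Word.ordConnected_fiber h1 k) ?_
  refine Set.Subsingleton.finite ?_
  rintro c ⟨hc, hcs⟩ d ⟨hd, hds⟩
  obtain ⟨w, hw⟩ := Coi.exists_rel_of_mem_source hcs
  obtain ⟨z, hz⟩ := Coi.exists_rel_of_mem_source hds
  have e1 := le_antisymm (hle c hc w hw) (hge c hc w hw)
  have e2 := le_antisymm (hle d hd z hz) (hge d hd z hz)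
  rw [e1] at hw
  rw [e2] at hz
  exact hw.left_unique hz

/-! ### Decomposition into pieces -/

section Decomposition

variable {G : ℕ → Type u} {K : ℕ → Type v} [∀ n, Group (G n)] [∀ n, Group (K n)]

/-- `A` is matched with an interval of a left word of the family whose hull in the corresponding
right word has no letters in the groups below `n`. -/
def IsPieceAbove {X : Type w} (T : X → CoiTriple G K) (n : ℕ) (W : Word G) (A : Set W.dom) :
    Prop :=
  ∃ x δ, ∃ f : W.dom → (T x).left.1.dom, Word.IsMatch W (T x).left.1 δ f A ∧
    (f '' A).OrdConnected ∧
    ∀ θ ∈ (T x).coi.hull (f '' A), ∀ i < n, ¬ ((T x).right.1.letter θ).InGroup i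

theorem IsPieceAbove.mono {X : Type w} {T : X → CoiTriple G K} {n : ℕ} {W : Word G}
    {A B : Set W.dom} (h : IsPieceAbove T n W A) (hBA : B ⊆ A) (hB : B.OrdConnected) :
    IsPieceAbove T n W B := by
  obtain ⟨x, δ, f, hf, hc, hn⟩ := h
  exact ⟨x, δ, f, hf.mono hBA, hf.ordConnected_image hc hBA hB,
    fun θ hθ => hn θ (Coi.hull_mono _ (Set.image_mono hBA) hθ)⟩

/-- A right word has only finitely many letters in the groups below `n`, so each piece can be cut by
a labelling that avoids them. -/
theorem exists_pieceAbove_cover {X : Type w} (T : X → CoiTriple G K) (n : ℕ) (W : Word G)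
    {D : Set W.dom} (hD : D.OrdConnected) (hred : W.ReducedOn D)
    (hmem : W.seg D ∈ Word.subwordGroup (fun x => (T x).left)) :
    ∃ 𝒜 : Set (Set W.dom), 𝒜.Finite ∧ D ⊆ ⋃₀ 𝒜 ∧
      ∀ A ∈ 𝒜, A.OrdConnected ∧ (A.Finite ∨ IsPieceAbove T n W A) := by
  obtain ⟨𝒜, hfin, hcov, hA⟩ := Word.exists_piece_cover _ W hD hred hmem
  have key : ∀ A, ∃ ℬ : Set (Set W.dom), A ∈ 𝒜 → ℬ.Finite ∧ A ⊆ ⋃₀ ℬ ∧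
      ∀ B ∈ ℬ, B.OrdConnected ∧ (B.Finite ∨ IsPieceAbove T n W B) := by
    intro A
    by_cases hA' : A ∈ 𝒜
    swap
    · exact ⟨∅, fun h => absurd h hA'⟩
    obtain ⟨-, hAc, hfinite | ⟨x, δ, f, hf, hfc⟩⟩ := hA A hA'
    · exact ⟨{A}, fun _ => ⟨Set.finite_singleton A, by simp, by
        rintro _ rfl; exact ⟨hAc, Or.inl hfinite⟩⟩⟩
    have hF : {θ | ∃ i < n, ((T x).right.1.letter θ).InGroup i}.Finite := by
      refine ((Set.finite_Iio n).biUnion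
        (fun i _ => (T x).right.1.finite_letters i)).subset ?_
      rintro θ ⟨i, hi, hθ⟩
      exact Set.mem_biUnion (x := i) hi hθ
    obtain ⟨q, r, hq, hr, hqk⟩ := (T x).coi.exists_label_avoiding hF
    refine ⟨(fun k => A ∩ f ⁻¹' (q ⁻¹' {k})) '' Set.Iio r, fun _ =>
      ⟨(Set.finite_Iio r).image _, ?_, ?_⟩⟩
    · intro a ha
      exact ⟨_, ⟨q (f a), hr _, rfl⟩, ha, rfl⟩
    · rintro _ ⟨k, -, rfl⟩
      have hBc := hf.ordConnected_preimage hAc (Word.ordConnected_fiber hq k)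
      refine ⟨hBc, ?_⟩
      rcases hqk k with h | h
      · left
        refine Set.Finite.of_finite_image (f := f) (h.subset ?_)
          (hf.injOn.mono Set.inter_subset_left)
        rintro _ ⟨a, ha, rfl⟩
        exact ha.2
      · right
        refine ⟨x, δ, f, hf.mono Set.inter_subset_left,
          hf.ordConnected_image hfc Set.inter_subset_left hBc, fun θ hθ i hi hin => ?_⟩
        refine h θ (Coi.hull_mono _ ?_ hθ) ⟨i, hi, hin⟩
        rintro _ ⟨a, ha, rfl⟩
        exact ha.2
  choose ℬ hℬ using key
  refine ⟨⋃ A ∈ 𝒜, ℬ A, hfin.biUnion (fun A h => (hℬ A h).1), ?_, ?_⟩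
  · intro d hd
    obtain ⟨A, hA', hdA⟩ := hcov hd
    obtain ⟨B, hB, hdB⟩ := (hℬ A hA').2.1 hdA
    exact ⟨B, Set.mem_biUnion hA' hB, hdB⟩
  · intro B hB
    obtain ⟨A, hA', hB'⟩ := Set.mem_iUnion₂.mp hB
    exact (hℬ A hA').2.2 B hB'

/-- Here `b k` is the block to which the `k`-th label belongs. Every block receives at least one
label, so `b` climbs by steps of at most one. The bound `2 * b k + 4` leaves the lower groups free
for the new letters that are placed near the `k`-th piece. -/
theorem exists_piece_decomposition {X : Type w} (T : X → CoiTriple G K) (W : Red G)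
    (blk : W.1.dom → ℕ) (hblk : Monotone blk) (hsurj : Function.Surjective blk)
    (hmem : ∀ m, W.1.seg (blk ⁻¹' {m}) ∈ Word.subwordGroup (fun x => (T x).left)) :
    ∃ (q : W.1.dom → ℕ) (b : ℕ → ℕ), Monotone q ∧ (∀ n, ∃ i, n ≤ q i) ∧ Monotone b ∧
      (∀ k, b (k + 1) ≤ b k + 1) ∧ (∀ n, ∃ k, n ≤ b k) ∧
      ∀ k, (q ⁻¹' {k}).Finite ∨ IsPieceAbove T (2 * b k + 4) W.1 (q ⁻¹' {k}) := by
  have hred := (Word.isReduced_iff _).mp W.2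
  choose 𝒜 hfin hcov hA using fun m => exists_pieceAbove_cover T (2 * m + 4) W.1
    (Word.ordConnected_fiber hblk m) (hred.mono (Set.subset_univ _)) (hmem m)
  choose q r hq hr hqA using fun m => exists_monotone_label_of_cover (hfin m)
    (fun A h => (hA m A h).1)
  -- Block `m` uses the labels from `R m` up to, but not including, `R (m + 1)`.
  let R : ℕ → ℕ := fun m => ∑ l ∈ Finset.range m, r l
  have hR0 : R 0 = 0 := rfl
  have hRs : ∀ m, R (m + 1) = R m + r m := fun m => Finset.sum_range_succ _ _
  have hr1 : ∀ m, 0 < r m := fun m => by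
    obtain ⟨i, rfl⟩ := hsurj m
    exact (Nat.zero_le _).trans_lt (hr _ i)
  have hRm : StrictMono R := strictMono_nat_of_lt_succ (fun m => by rw [hRs]; have := hr1 m; omega)
  have hb : ∀ k, ∃ m, R m ≤ k ∧ k < R (m + 1) := by
    intro k
    induction k with
    | zero => exact ⟨0, le_rfl, by rw [hRs]; have := hr1 0; omega⟩
    | succ k ih =>
      obtain ⟨m, h1, h2⟩ := ih
      rcases lt_or_ge (k + 1) (R (m + 1)) with h | h
      · exact ⟨m, by omega, h⟩
      · exact ⟨m + 1, h, by rw [hRs (m + 1)]; have := hr1 (m + 1); omega⟩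
  choose b hb1 hb2 using hb
  have hbeq : ∀ k m, R m ≤ k → k < R (m + 1) → b k = m := by
    intro k m h1 h2
    have h3 := hRm.lt_iff_lt.mp ((hb1 k).trans_lt h2)
    have h4 := hRm.lt_iff_lt.mp (h1.trans_lt (hb2 k))
    omega
  have hQ : ∀ i, R (blk i) ≤ R (blk i) + q (blk i) i ∧ R (blk i) + q (blk i) i < R (blk i + 1) :=
    fun i => ⟨Nat.le_add_right _ _, by rw [hRs]; have := hr (blk i) i; omega⟩
  have hQm : Monotone (fun i => R (blk i) + q (blk i) i) := by
    intro i j hij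
    rcases (hblk hij).lt_or_eq with h | h
    · exact (hQ i).2.le.trans ((hRm.monotone h).trans (hQ j).1)
    · dsimp only
      rw [h]
      exact Nat.add_le_add_left (hq _ hij) _
  have hbm : Monotone b := by
    refine monotone_nat_of_le_succ (fun k => ?_)
    have := hRm.lt_iff_lt.mp (((hb1 k).trans (Nat.le_succ k)).trans_lt (hb2 (k + 1)))
    omega
  refine ⟨fun i => R (blk i) + q (blk i) i, b, hQm, ?_, hbm, ?_, ?_, ?_⟩
  · intro n
    obtain ⟨i, hi⟩ := hsurj n
    refine ⟨i, ?_⟩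
    have := hRm.le_apply (x := n)
    dsimp only
    rw [hi]
    omega
  · intro k
    have h1 := hb2 k
    have h2 : R (b (k + 1)) < R (b k + 2) := by
      have h3 := hRm (show b k + 1 < b k + 2 by omega)
      exact (hb1 (k + 1)).trans_lt (by omega)
    have := hRm.lt_iff_lt.mp h2
    omega
  · intro n
    exact ⟨R n, (hbeq (R n) n le_rfl (hRm (Nat.lt_succ_self n))).ge⟩
  · intro k
    rcases ((fun i => R (blk i) + q (blk i) i) ⁻¹' {k}).eq_empty_or_nonempty with h | ⟨i, hi⟩
    · left; rw [h]; exact Set.finite_empty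
    have hblki : ∀ j, R (blk j) + q (blk j) j = k → blk j = b k := fun j hj =>
      (hbeq k (blk j) (hj ▸ (hQ j).1) (hj ▸ (hQ j).2)).symm
    have hbi := hblki i hi
    obtain ⟨A, hA', hiA⟩ := hcov (b k) hbi
    have hsub : (fun i => R (blk i) + q (blk i) i) ⁻¹' {k} ⊆ A := by
      intro j hj
      have hbj := hblki j hj
      refine hqA (b k) i j ?_ A hA' hiA
      have h1 : R (blk i) + q (blk i) i = k := hi
      have h2 : R (blk j) + q (blk j) j = k := hj
      rw [hbi] at h1
      rw [hbj] at h2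
      omega
    rcases (hA (b k) A hA').2 with h | h
    · exact Or.inl (h.subset hsub)
    · exact Or.inr (h.mono hsub (Word.ordConnected_fiber hQm k))

end Decomposition

/-! ### Interleaving words with new letters -/

namespace Letter

variable {G : ℕ → Type u} [∀ n, Group (G n)]

open Classical in
/-- An element of `G n` as a letter. -/
noncomputable def ofElem (n : ℕ) (g : G n) : Letter G := if h : g = 1 then none else some ⟨n, g, h⟩

theorem ofElem_of_ne {n : ℕ} {g : G n} (h : g ≠ 1) : ofElem n g = some ⟨n, g, h⟩ := dif_neg h

theorem inGroup_ofElem (n : ℕ) (g : G n) : (ofElem n g).InGroup n := by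
  unfold ofElem
  split_ifs
  · trivial
  · rfl

theorem ofElem_ne_none {n : ℕ} {g : G n} (h : g ≠ 1) : ofElem n g ≠ none := by
  simp [ofElem_of_ne h]

theorem ofElem_injective (n : ℕ) : Function.Injective (ofElem (G := G) n) := by
  intro g h hgh
  by_cases hg : g = 1 <;> by_cases hh : h = 1
  · rw [hg, hh]
  · simp [ofElem, hg, hh] at hgh
  · simp [ofElem, hg, hh] at hgh
  · simpa [ofElem, hg, hh] using hgh

theorem toFree_ofElem {N n : ℕ} (hn : n ≤ N) (g : G n) : (ofElem n g).toFree N =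
    Monoid.CoprodI.of (M := fun n : Fin (N + 1) => G n) (i := ⟨n, by omega⟩) g := by
  by_cases h : g = 1
  · simp [ofElem, h, toFree]
  · have : n < N + 1 := by omega
    simp only [ofElem_of_ne h, toFree, this, dite_true]

end Letter

namespace Word

variable {K : ℕ → Type v} [∀ n, Group (K n)]

theorem countable_dom (W : Word K) : Countable W.dom := by
  rw [← Set.countable_univ_iff]
  have : (Set.univ : Set W.dom) ⊆ ⋃ n, {i | (W.letter i).InGroup n} := fun i _ =>
    Set.mem_iUnion.mpr (W.letter i).exists_inGroup
  exact (Set.countable_iUnion (fun n => (W.finite_letters n).countable)).mono this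

/-- `U` is obtained by putting the new letter `z k` in front of the word `Q k`, for each `k`, and
concatenating. -/
structure Interleaved (Q : ℕ → Word K) (t : ℕ → Letter K) (U : Word K) (q : U.dom → ℕ)
    (z : ℕ → U.dom) (e : ∀ k, (Q k).dom → U.dom) : Prop where
  mono : Monotone q
  q_z : ∀ k, q (z k) = k
  z_le : ∀ i, z (q i) ≤ i
  letter_z : ∀ k, U.letter (z k) = t k
  isMatch : ∀ k, IsMatch (Q k) U 1 (e k) Set.univ
  q_e : ∀ k d, q (e k d) = k
  e_ne : ∀ k d, e k d ≠ z k
  cases : ∀ i, i = z (q i) ∨ ∃ d, i = e (q i) d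

/-- A bottom element adjoined to the domain of `Q k` is the place of the new letter. The two
finiteness hypotheses ensure that the infinite concatenation is a word. -/
theorem exists_interleave (Q : ℕ → Word K) (t : ℕ → Letter K)
    (h1 : ∀ n, {k | (t k).InGroup n}.Finite)
    (h2 : ∀ n, {k | ∃ d, ((Q k).letter d).InGroup n}.Finite) :
    ∃ (U : Word K) (q : U.dom → ℕ) (z : ℕ → U.dom) (e : ∀ k, (Q k).dom → U.dom),
      Interleaved Q t U q z e := by
  let D : Type := Σₗ k, WithBot (Q k).dom
  let letter : D → Letter K := fun i => WithBot.recBotCoe (C := fun _ => Letter K) (t (ofLex i).1)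
    (fun d => (Q (ofLex i).1).letter d) (ofLex i).2
  let z : ℕ → D := fun k => toLex ⟨k, ⊥⟩
  let e : ∀ k, (Q k).dom → D := fun k d => toLex ⟨k, (d : WithBot (Q k).dom)⟩
  have hcase : ∀ i : D, i = z (ofLex i).1 ∨ ∃ d, i = e (ofLex i).1 d := by
    intro i
    obtain ⟨⟨k, x⟩, rfl⟩ := toLex.surjective i
    induction x using WithBot.recBotCoe with
    | bot => exact Or.inl rfl
    | coe d => exact Or.inr ⟨d, rfl⟩
  have hlz : ∀ k, letter (z k) = t k := fun k => rfl
  have hle : ∀ k d, letter (e k d) = (Q k).letter d := fun k d => rfl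
  have hfin : ∀ n, {i | (letter i).InGroup n}.Finite := by
    intro n
    refine (((h1 n).image z).union ((h2 n).biUnion
      (fun k _ => ((Q k).finite_letters n).image (e k)))).subset ?_
    intro i hi
    rcases hcase i with h | ⟨d, h⟩
    · left
      rw [Set.mem_ofPred_eq, h, hlz] at hi
      exact ⟨_, hi, h.symm⟩
    · right
      rw [Set.mem_ofPred_eq, h, hle] at hi
      exact Set.mem_biUnion (x := (ofLex i).1) ⟨d, hi⟩ ⟨d, hi, h.symm⟩
  have hmono : Monotone (fun i : D => (ofLex i).1) := by
    intro i j hij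
    rcases Sigma.Lex.le_def.mp hij with h | ⟨h, -⟩
    · exact h.le
    · exact h.le
  refine ⟨⟨D, letter, hfin⟩, fun i : D => (ofLex i).1, z, e, hmono, fun _ => rfl, ?_, hlz, ?_,
    fun _ _ => rfl, ?_, hcase⟩
  · intro i
    exact Sigma.Lex.le_def.mpr (Or.inr ⟨rfl, bot_le⟩)
  · intro k
    refine ⟨fun a _ b _ hab => (signedLT_one _ _).mpr ?_, fun d _ => ?_⟩
    · exact Sigma.Lex.lt_def.mpr (Or.inr ⟨rfl, WithBot.coe_lt_coe.mpr hab⟩)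
    · rw [Letter.signed_one]
      exact hle k d
  · intro k d h
    have h1 := eq_of_heq (Sigma.mk.inj (toLex.injective h)).2
    exact WithBot.coe_ne_bot h1

namespace Interleaved

variable {Q : ℕ → Word K} {t : ℕ → Letter K} {U : Word K} {q : U.dom → ℕ}
    {z : ℕ → U.dom} {e : ∀ k, (Q k).dom → U.dom}

theorem lt_of_lt (h : Interleaved Q t U q z e) {i j : U.dom} (hij : q i < q j) : i < j :=
  h.mono.reflect_lt hij

theorem z_lt_z (h : Interleaved Q t U q z e) {k l : ℕ} (hkl : k < l) : z k < z l :=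
  h.lt_of_lt (by rwa [h.q_z, h.q_z])

theorem z_lt_e (h : Interleaved Q t U q z e) (k : ℕ) (d : (Q k).dom) : z k < e k d := by
  refine lt_of_le_of_ne ?_ (h.e_ne k d).symm
  have := h.z_le (e k d)
  rwa [h.q_e] at this

theorem letter_e (h : Interleaved Q t U q z e) (k : ℕ) (d : (Q k).dom) :
    U.letter (e k d) = (Q k).letter d := by
  rw [(h.isMatch k).letter trivial, Letter.signed_one]

theorem range_e (h : Interleaved Q t U q z e) (k : ℕ) :
    Set.range (e k) = {i | q i = k ∧ i ≠ z k} := by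
  ext i
  constructor
  · rintro ⟨d, rfl⟩
    exact ⟨h.q_e k d, h.e_ne k d⟩
  · rintro ⟨rfl, hi⟩
    rcases h.cases i with h' | ⟨d, hd⟩
    · exact absurd h' hi
    · exact ⟨d, hd.symm⟩

theorem reducedOn_range (h : Interleaved Q t U q z e) {k : ℕ}
    (hQ : (Q k).ReducedOn Set.univ) : U.ReducedOn (Set.range (e k)) := by
  rcases isEmpty_or_nonempty (Q k).dom with hE | hE
  · rw [Set.range_eq_empty]; exact reducedOn_empty U
  obtain ⟨g, hg⟩ := (h.isMatch k).exists_leftInv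
  rw [← Set.image_univ]
  refine ((h.isMatch k).symm hg).reducedOn ?_ ?_ <;> rw [IsMatch.image_image hg]
  · exact Set.ordConnected_univ
  · exact hQ

/-- Let `I` be a trivial interval. If it contains new letters and `z k` is the first of them, then
all letters of `I` in the group `c k` are new and are positive powers of the same element of
infinite order, so retracting to that factor gives a nontrivial value. If it contains none, it lies
inside the copy of a single `Q k`. Neighbours are separated by `hc`, by `hQc` and by the reducedness
of the `Q k`. -/
theorem isReduced (h : Interleaved Q t U q z e) (hQ : ∀ k, (Q k).ReducedOn Set.univ)
    {g : ∀ n, K n} (hg : ∀ n, ¬ IsOfFinOrder (g n)) {c : ℕ → ℕ} {E : ℕ → ℕ} (hE : ∀ k, E k ≠ 0)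
    (ht : ∀ k, t k = Letter.ofElem (c k) (g (c k) ^ E k)) (hc : ∀ k, c k ≠ c (k + 1))
    (hQc : ∀ k j, k ≤ j + 1 → ∀ d, ¬ ((Q j).letter d).InGroup (c k)) : U.IsReduced := by
  rw [isReduced_iff]
  have hinj : ∀ n, Function.Injective (fun m : ℕ => g n ^ m) := fun n =>
    injective_pow_iff_not_isOfFinOrder.mpr (hg n)
  have hpow : ∀ n m, m ≠ 0 → g n ^ m ≠ 1 := fun n m hm h1 =>
    hm (hinj n (h1.trans (pow_zero _).symm))
  have htn : ∀ k, t k ≠ none := fun k => by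
    rw [ht]; exact Letter.ofElem_ne_none (hpow _ _ (hE k))
  have htc : ∀ k, (t k).InGroup (c k) := fun k => by rw [ht]; exact Letter.inGroup_ofElem _ _
  constructor
  · intro I _ hI hI1
    by_contra hne
    rw [← ne_eq, ← Set.nonempty_iff_ne_empty] at hne
    by_cases hz : ∃ k, z k ∈ I
    · classical
      obtain ⟨k, hk, hmin⟩ : ∃ k, z k ∈ I ∧ ∀ j, z j ∈ I → k ≤ j :=
        ⟨Nat.find hz, Nat.find_spec hz, fun j hj => Nat.find_min' hz hj⟩
      have hfin : {i | i ∈ I ∧ ∃ n ≤ c k, (U.letter i).InGroup n}.Finite :=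
        (U.finite_le (c k)).subset (fun i hi => hi.2)
      have hl : ∀ i, i ∈ hfin.toFinset.sort (· ≤ ·) ↔
          i ∈ I ∧ ∃ n ≤ c k, (U.letter i).InGroup n := by
        intro i; rw [Finset.mem_sort, Set.Finite.mem_toFinset]; rfl
      -- The retraction of the free product onto the factor `K (c k)`.
      let ψ : Monoid.CoprodI (fun n : Fin (c k + 1) => K n) →* K (c k) :=
        Monoid.CoprodI.lift (Pi.mulSingle (M := fun n : Fin (c k + 1) => K n →* K (c k))
          ⟨c k, by omega⟩ (MonoidHom.id _))
      have hψ : ∀ x : K (c k), ψ ((Letter.ofElem (c k) x).toFree (c k)) = x := by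
        intro x
        rw [Letter.toFree_ofElem le_rfl]
        simp [ψ]
      have hψ' : ∀ a : Letter K, ∀ n, n < c k → a.InGroup n → ψ (a.toFree (c k)) = 1 := by
        intro a n hn ha
        rcases a with _ | ⟨m, x, hx⟩
        · simp [Letter.toFree]
        · obtain rfl : m = n := ha
          have h1 : m < c k + 1 := by omega
          have h2 : (⟨m, h1⟩ : Fin (c k + 1)) ≠ ⟨c k, by omega⟩ := by
            rw [ne_eq, Fin.mk.injEq]; omega
          simp only [Letter.toFree, h1, dite_true, ψ, Monoid.CoprodI.lift_of]
          rw [Pi.mulSingle_eq_of_ne h2]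
          rfl
      -- The exponents are natural numbers, so the nonzero exponent of `z k` cannot be cancelled by
      -- the others.
      have hs : ∀ i, ∃ s : ℕ, (i ∈ hfin.toFinset.sort (· ≤ ·) →
          ψ ((U.letter i).toFree (c k)) = g (c k) ^ s) ∧ (i = z k → s = E k) := by
        intro i
        by_cases hik : i = z k
        · refine ⟨E k, fun _ => ?_, fun _ => rfl⟩
          rw [hik, h.letter_z, ht, hψ]
        · by_cases hi : i ∈ hfin.toFinset.sort (· ≤ ·)
          swap
          · exact ⟨0, fun h => absurd h hi, fun h => absurd h hik⟩
          obtain ⟨hiI, n, hn, hin⟩ := (hl i).mp hi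
          rcases hn.lt_or_eq with hn | rfl
          · refine ⟨0, fun _ => ?_, fun h => absurd h hik⟩
            rw [hψ' _ n hn hin, pow_zero]
          · rcases h.cases i with hi' | ⟨d, hd⟩
            · rw [hi', h.letter_z] at hin
              have hcc : c k = c (q i) := Letter.InGroup.unique (htn _) hin (htc _)
              refine ⟨E (q i), fun _ => ?_, fun h => absurd h hik⟩
              rw [hi', h.letter_z, h.q_z, ht, ← hcc, hψ]
            -- By `hQc`, a letter of `Q (q i)` in the group `c k` would require `q i + 1 < k`; then
            -- `z (q i + 1)` would be an earlier new letter in `I`.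
            · exfalso
              rw [hd, h.letter_e] at hin
              refine hQc k (q i) ?_ d hin
              by_contra hlt
              have h3 : z (q i + 1) ∈ I := by
                refine hI.out hiI hk ⟨(h.lt_of_lt ?_).le, (h.z_lt_z (by omega)).le⟩
                rw [h.q_z]; omega
              have := hmin _ h3
              omega
      choose s hs1 hs2 using hs
      have h3 := proj_seg_eq_prod (c k) U I _ (Finset.sortedLT_sort hfin.toFinset).pairwise hl
      rw [hI1, map_one] at h3
      have h4 := congrArg ψ h3
      rw [map_one, map_list_prod, List.map_map] at h4
      have h5 : ∀ l : List U.dom, (∀ i ∈ l, i ∈ hfin.toFinset.sort (· ≤ ·)) →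
          (l.map (ψ ∘ fun i => (U.letter i).toFree (c k))).prod = g (c k) ^ (l.map s).sum := by
        intro l
        induction l with
        | nil => intro _; simp
        | cons i l ih =>
          intro hl
          rw [List.map_cons, List.prod_cons, ih (fun j hj => hl j (by simp [hj])),
            Function.comp_apply, hs1 i (hl i (by simp)), List.map_cons, List.sum_cons, pow_add]
      rw [h5 _ (fun _ hi => hi)] at h4
      refine hpow _ _ ?_ h4.symm
      have hzk : z k ∈ hfin.toFinset.sort (· ≤ ·) := (hl _).mpr
        ⟨hk, c k, le_rfl, by rw [h.letter_z]; exact htc k⟩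
      have h6 := List.le_sum_of_mem (List.mem_map_of_mem (f := s) hzk)
      rw [hs2 _ rfl] at h6
      have := hE k
      omega
    · push Not at hz
      obtain ⟨i, hi⟩ := hne
      have hsub : I ⊆ Set.range (e (q i)) := by
        have key : ∀ x ∈ I, ∀ y ∈ I, ¬ q x < q y := fun x hx y hy hxy =>
          hz (q y) (hI.out hx hy ⟨(h.lt_of_lt (by rwa [h.q_z])).le, h.z_le y⟩)
        intro j hj
        rw [h.range_e]
        refine ⟨?_, fun h' => hz _ (h' ▸ hj)⟩
        have h1 := key i hi j hj
        have h2 := key j hj i hi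
        omega
      have := (h.reducedOn_range (hQ (q i))).1 I hsub hI hI1
      rw [this] at hi
      exact hi
  · rintro i - j - hij ⟨n, hin, hjn⟩
    have hle : q i ≤ q j := h.mono hij.1.le
    have hnz : ∀ k, q i < k → z k < j → False := fun k h1 h2 =>
      hij.2 (h.lt_of_lt (by rwa [h.q_z])) h2
    rcases h.cases j with hj | ⟨d, hd⟩
    · have hlt : q i < q j := by
        refine lt_of_le_of_ne hle (fun heq => ?_)
        have h1 := h.z_le i
        rw [heq, ← hj] at h1
        exact absurd hij.1 (not_lt.mpr h1)
      have hqj : q j = q i + 1 := by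
        by_contra hne
        refine hnz (q i + 1) (by omega) ?_
        rw [hj]; exact h.z_lt_z (by omega)
      rw [hj, h.letter_z] at hjn
      have hnc : n = c (q j) := Letter.InGroup.unique (htn _) hjn (htc _)
      rcases h.cases i with hi | ⟨d, hd⟩
      · rw [hi, h.letter_z] at hin
        have hnc' : n = c (q i) := Letter.InGroup.unique (htn _) hin (htc _)
        rw [hqj] at hnc
        exact hc (q i) (hnc'.symm.trans hnc)
      · rw [hd, h.letter_e, hnc] at hin
        exact hQc (q j) (q i) (by omega) d hin
    · have heq : q i = q j := by
        by_contra hne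
        refine hnz (q j) (by omega) ?_
        rw [hd, h.q_e]; exact h.z_lt_e _ d
      rcases h.cases i with hi | ⟨d', hd'⟩
      · rw [hi, h.letter_z] at hin
        have hnc : n = c (q i) := Letter.InGroup.unique (htn _) hin (htc _)
        rw [hd, h.letter_e, hnc] at hjn
        exact hQc (q i) (q j) (by omega) d hjn
      · refine (h.reducedOn_range (hQ (q j))).2 i ?_ j ⟨d, hd.symm⟩ hij ⟨n, hin, hjn⟩
        rw [← heq]
        exact ⟨d', hd'.symm⟩

end Interleaved
end Word

/-! ### Choosing the exponents of the new letters -/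

namespace Word

variable {K : ℕ → Type v} [∀ n, Group (K n)]

/-- The finitely many words `Q j` with `j < k` have finitely many letters in the group `c k`, and
these exhaust only boundedly many powers. Summing the bounds makes `M` strictly increasing. -/
theorem exists_exponents (Q : ℕ → Word K) {g : ∀ n, K n} (hg : ∀ n, ¬ IsOfFinOrder (g n))
    (c : ℕ → ℕ) : ∃ M : ℕ → ℕ, StrictMono M ∧ (∀ k, M k ≠ 0) ∧
      ∀ k, ∀ j < k, ∀ d, ∀ m ≥ M k, (Q j).letter d ≠ Letter.ofElem (c k) (g (c k) ^ m) := by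
  have hB : ∀ k, ∃ B : ℕ, ∀ j < k, ∀ d, ∀ m ≥ B,
      (Q j).letter d ≠ Letter.ofElem (c k) (g (c k) ^ m) := by
    intro k
    have hinj : Function.Injective (fun m : ℕ => Letter.ofElem (G := K) (c k) (g (c k) ^ m)) :=
      (Letter.ofElem_injective _).comp (injective_pow_iff_not_isOfFinOrder.mpr (hg (c k)))
    have hfin : (⋃ j ∈ Set.Iio k, (fun m : ℕ => Letter.ofElem (G := K) (c k) (g (c k) ^ m)) ⁻¹'
        ((Q j).letter '' {d | ((Q j).letter d).InGroup (c k)})).Finite :=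
      (Set.finite_Iio k).biUnion (fun j _ =>
        (((Q j).finite_letters (c k)).image _).preimage hinj.injOn)
    obtain ⟨B, hB⟩ := hfin.bddAbove
    refine ⟨B + 1, fun j hj d m hm heq => ?_⟩
    have : m ≤ B := hB (Set.mem_biUnion (x := j) hj
      ⟨d, by rw [Set.mem_ofPred_eq, heq]; exact Letter.inGroup_ofElem _ _, heq⟩)
    omega
  choose B hB using hB
  have hs : ∀ k, ∑ j ∈ Finset.range (k + 1 + 1), (B j + 1) =
      ∑ j ∈ Finset.range (k + 1), (B j + 1) + (B (k + 1) + 1) := fun k =>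
    Finset.sum_range_succ _ _
  have hle : ∀ k, B k + 1 ≤ ∑ j ∈ Finset.range (k + 1), (B j + 1) := fun k => by
    rw [Finset.sum_range_succ]; omega
  refine ⟨fun k => ∑ j ∈ Finset.range (k + 1), (B j + 1), strictMono_nat_of_lt_succ ?_, ?_, ?_⟩
  · intro k
    rw [hs]; omega
  · intro k
    have := hle k
    dsimp only
    omega
  · intro k j hj d m hm
    have := hle k
    exact hB k j hj d m (by dsimp only at hm; omega)

/-- No final segment of `U` is matched with an interval of one of the words `V y`. -/
def AvoidsTails {X : Type w} (V : X → Word K) (U : Word K) : Prop :=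
  ∀ x δ, ∀ f : U.dom → (V x).dom, ∀ I : Set U.dom, I.OrdConnected → (∀ a, ∃ i ∈ I, a < i) →
    (f '' I).OrdConnected → ¬ IsMatch U (V x) δ f I

/-- Every binary sequence `τ` yields a reduced word `U τ`. If each had a final segment matched with
an interval of some `V x`, then `τ` could be recovered from `x`, the sign, the index of one new
letter, the place of its image and a finite part of `τ`. That would inject the continuum many
sequences into the product of `X` with a countable set. -/
theorem exists_reduced_interleaved {X : Type w} (hX : Cardinal.mk X < Cardinal.continuum)
    (V : X → Word K) (hK : ∀ n, ∃ k : K n, ¬ IsOfFinOrder k) (Q : ℕ → Word K)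
    (hQ : ∀ k, (Q k).ReducedOn Set.univ) (b : ℕ → ℕ) (hb : Monotone b)
    (hb1 : ∀ k, b (k + 1) ≤ b k + 1) (hbt : ∀ n, ∃ k, n ≤ b k)
    (hQb : ∀ k d, ∀ i < 2 * b k + 4, ¬ ((Q k).letter d).InGroup i) :
    ∃ (t : ℕ → Letter K) (U : Word K) (q : U.dom → ℕ) (z : ℕ → U.dom)
      (e : ∀ k, (Q k).dom → U.dom), Interleaved Q t U q z e ∧ U.IsReduced ∧ AvoidsTails V U := by
  choose g hg using hK
  -- The parity term separates `c k` from `c (k + 1)`. For `k ≤ j + 1` one has `c k ≤ 2 * b j + 3`,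
  -- which is below all groups occurring in `Q j`.
  let c : ℕ → ℕ := fun k => 2 * b k + k % 2
  obtain ⟨M, hM, hM0, hMQ⟩ := exists_exponents Q hg c
  -- The last binary digit stores `τ k`, and the rest of the exponent determines `k`.
  let E : (ℕ → Bool) → ℕ → ℕ := fun τ k => 2 * M k + (τ k).toNat
  have hE : ∀ τ k, E τ k ≠ 0 := fun τ k => by have := hM0 k; simp only [E]; omega
  have hE' : ∀ τ τ' k l, E τ k = E τ' l → k = l ∧ τ k = τ' l := by
    intro τ τ' k l h
    simp only [E] at h
    have h1 := Bool.toNat_le (τ k)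
    have h2 := Bool.toNat_le (τ' l)
    obtain rfl : k = l := hM.injective (by omega)
    refine ⟨rfl, ?_⟩
    have : (τ k).toNat = (τ' k).toNat := by omega
    cases hh : τ k <;> cases hh' : τ' k <;> simp_all
  let t : (ℕ → Bool) → ℕ → Letter K := fun τ k => Letter.ofElem (c k) (g (c k) ^ E τ k)
  have hpow : ∀ n m, m ≠ 0 → g n ^ m ≠ 1 := fun n m hm h1 =>
    hm (injective_pow_iff_not_isOfFinOrder.mpr (hg n) (h1.trans (pow_zero _).symm))
  have htn : ∀ τ k, t τ k ≠ none := fun τ k => Letter.ofElem_ne_none (hpow _ _ (hE τ k))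
  have htc : ∀ τ k, (t τ k).InGroup (c k) := fun τ k => Letter.inGroup_ofElem _ _
  have hbfin : ∀ n, {k | b k ≤ n}.Finite := by
    intro n
    obtain ⟨k, hk⟩ := hbt (n + 1)
    refine (Set.finite_Iio k).subset (fun j (hj : b j ≤ n) => ?_)
    by_contra hkj
    have := hb (not_lt.mp hkj)
    omega
  have hQc : ∀ k j, k ≤ j + 1 → ∀ d, ¬ ((Q j).letter d).InGroup (c k) := by
    intro k j hkj d
    refine hQb j d (c k) ?_
    have h1 := (hb hkj).trans (hb1 j)
    simp only [c]
    omega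
  have hex : ∀ τ, ∃ (U : Word K) (q : U.dom → ℕ) (z : ℕ → U.dom) (e : ∀ k, (Q k).dom → U.dom),
      Interleaved Q (t τ) U q z e := by
    intro τ
    refine exists_interleave Q (t τ) (fun n => ?_) (fun n => ?_)
    · refine (hbfin n).subset (fun k (hk : (t τ k).InGroup n) => ?_)
      have : n = c k := Letter.InGroup.unique (htn τ k) hk (htc τ k)
      simp only [c] at this
      show b k ≤ n
      omega
    · refine (hbfin n).subset (fun k hk => ?_)
      obtain ⟨d, hd⟩ := hk
      by_contra hlt
      have hlt : n < b k := not_le.mp hlt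
      exact hQb k d n (by omega) hd
  choose U q z e hU using hex
  have hred : ∀ τ, (U τ).IsReduced := fun τ =>
    (hU τ).isReduced hQ hg (hE τ) (fun _ => rfl) (fun k => by
      simp only [c]
      omega) hQc
  -- A new letter shows its index and its bit. It cannot be a letter of `Q j`: the exponent is too
  -- large if `j < k`, and the group is too low if `k ≤ j`.
  have hletter : ∀ τ τ' k i, (U τ').letter i = t τ k → τ k = τ' k := by
    intro τ τ' k i hi
    rcases (hU τ').cases i with h | ⟨d, h⟩
    · rw [h, (hU τ').letter_z] at hi
      have h1 : c (q τ' i) = c k := Letter.InGroup.unique (htn τ' _) (htc τ' _)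
        (hi ▸ htc τ k)
      have h2 : t τ' (q τ' i) = Letter.ofElem (c k) (g (c k) ^ E τ' (q τ' i)) := by
          change Letter.ofElem (c (q τ' i)) (g (c (q τ' i)) ^ E τ' (q τ' i)) = _
          rw [h1]
      rw [h2] at hi
      have h3 := injective_pow_iff_not_isOfFinOrder.mpr (hg (c k))
        (Letter.ofElem_injective _ hi)
      obtain ⟨h4, h5⟩ := hE' τ' τ _ _ h3
      rw [← h5, h4]
    · rw [h, (hU τ').letter_e] at hi
      exfalso
      rcases lt_or_ge (q τ' i) k with hlt | hge
      · refine hMQ k _ hlt d (E τ k) ?_ hi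
        simp only [E]
        omega
      · refine hQc k _ (by omega) d ?_
        rw [hi]
        exact htc τ k
  suffices ∃ τ, AvoidsTails V (U τ) by
    obtain ⟨τ, hτ⟩ := this
    exact ⟨t τ, U τ, q τ, z τ, e τ, hU τ, hred τ, hτ⟩
  by_contra hbad
  push Not at hbad
  have hcapt : ∀ τ, ∃ (x : X) (δ : ℤˣ) (f : (U τ).dom → (V x).dom) (I : Set (U τ).dom) (m : ℕ),
      (f '' I).OrdConnected ∧ IsMatch (U τ) (V x) δ f I ∧ ∀ k ≥ m, z τ k ∈ I := by
    intro τ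
    have := hbad τ
    simp only [AvoidsTails, not_forall, not_not] at this
    obtain ⟨x, δ, f, I, hI, hIu, hf, hm⟩ := this
    obtain ⟨i, hi, -⟩ := hIu (z τ 0)
    refine ⟨x, δ, f, I, q τ i + 1, hf, hm, fun k hk => ?_⟩
    obtain ⟨j, hj, hkj⟩ := hIu (z τ k)
    refine hI.out hi hj ⟨((hU τ).lt_of_lt ?_).le, hkj.le⟩
    rw [(hU τ).q_z]
    omega
  choose x δ f I m hf hmatch hzI using hcapt
  choose enc henc using fun y => (countable_dom (V y)).exists_injective_nat
  let key : (ℕ → Bool) → X × (ℕ × ℤˣ × ℕ × List Bool) := fun τ =>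
    (x τ, enc _ (f τ (z τ (m τ))), δ τ, m τ, (List.range (m τ + 1)).map τ)
  have hinj : Function.Injective key := by
    -- The image of `z τ k` lies in the convex image of `J'`, so it is also the image of a letter of
    -- `U τ'`, and `hletter` applies.
    have main : ∀ (y : X) (ε : ℤˣ) (n : ℕ) (τ τ' : ℕ → Bool) (φ : (U τ).dom → (V y).dom)
        (φ' : (U τ').dom → (V y).dom) (J : Set (U τ).dom) (J' : Set (U τ').dom),
        (φ' '' J').OrdConnected → IsMatch (U τ) (V y) ε φ J → IsMatch (U τ') (V y) ε φ' J' →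
        (∀ k ≥ n, z τ k ∈ J) → (∀ k ≥ n, z τ' k ∈ J') → φ (z τ n) = φ' (z τ' n) →
        ∀ k > n, (φ (z τ k) ∈ Set.uIcc (φ' (z τ' n)) (φ' (z τ' k))) → τ k = τ' k := by
      intro y ε n τ τ' φ φ' J J' hc h h' hz hz' hn k hk hmem
      obtain ⟨i, hi, hik⟩ := hc.uIcc_subset ⟨_, hz' n le_rfl, rfl⟩ ⟨_, hz' k hk.le, rfl⟩ hmem
      refine hletter τ τ' k i ?_
      have h1 := h'.letter hi
      rw [hik, h.letter (hz k hk.le), (hU τ).letter_z] at h1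
      have h2 := congrArg (Letter.signed ε) h1
      rw [Letter.signed_signed_self, Letter.signed_signed_self] at h2
      exact h2.symm
    -- Both matches start from the same place and run in the same direction, so one of the two
    -- `k`-th images lies between the start and the other one; `main` applies after exchanging `τ`
    -- and `τ'` if necessary.
    have main2 : ∀ (y : X) (ε : ℤˣ) (n : ℕ) (τ τ' : ℕ → Bool) (φ : (U τ).dom → (V y).dom)
        (φ' : (U τ').dom → (V y).dom) (J : Set (U τ).dom) (J' : Set (U τ').dom),
        (φ '' J).OrdConnected → (φ' '' J').OrdConnected →
        IsMatch (U τ) (V y) ε φ J → IsMatch (U τ') (V y) ε φ' J' →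
        (∀ k ≥ n, z τ k ∈ J) → (∀ k ≥ n, z τ' k ∈ J') → φ (z τ n) = φ' (z τ' n) →
        ∀ k > n, τ k = τ' k := by
      intro y ε n τ τ' φ φ' J J' hc hc' h h' hz hz' hn k hk
      have h1 := h.lt (hz n le_rfl) (hz k hk.le) ((hU τ).z_lt_z hk)
      have h2 := h'.lt (hz' n le_rfl) (hz' k hk.le) ((hU τ').z_lt_z hk)
      by_cases hmem : φ (z τ k) ∈ Set.uIcc (φ' (z τ' n)) (φ' (z τ' k))
      · exact main y ε n τ τ' φ φ' J J' hc' h h' hz hz' hn k hk hmem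
      · refine (main y ε n τ' τ φ' φ J' J hc h' h hz' hz hn.symm k hk ?_).symm
        rw [hn] at h1 ⊢
        rw [Set.mem_uIcc] at hmem ⊢
        rcases Int.units_eq_one_or ε with rfl | rfl
        · rw [signedLT_one] at h1 h2
          refine Or.inl ⟨h2.le, ?_⟩
          by_contra hlt
          exact hmem (Or.inl ⟨h1.le, (not_le.mp hlt).le⟩)
        · rw [signedLT_neg_one] at h1 h2
          refine Or.inr ⟨?_, h2.le⟩
          by_contra hlt
          exact hmem (Or.inr ⟨(not_le.mp hlt).le, h1.le⟩)
    intro τ τ' h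
    have hx : x τ = x τ' := congrArg Prod.fst h
    have hδ : δ τ = δ τ' := congrArg (fun p => p.2.2.1) h
    have hm : m τ = m τ' := congrArg (fun p => p.2.2.2.1) h
    have hl : (List.range (m τ + 1)).map τ = (List.range (m τ' + 1)).map τ' :=
      congrArg (fun p => p.2.2.2.2) h
    have hp : enc _ (f τ (z τ (m τ))) = enc _ (f τ' (z τ' (m τ'))) :=
      congrArg (fun p => p.2.1) h
    obtain ⟨φ', hφ'1, hφ'2, hφ'3⟩ : ∃ φ' : (U τ').dom → (V (x τ)).dom,
        (φ' '' I τ').OrdConnected ∧ IsMatch (U τ') (V (x τ)) (δ τ) φ' (I τ') ∧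
        f τ (z τ (m τ)) = φ' (z τ' (m τ)) := by
      have h1 := hf τ'
      have h2 := hmatch τ'
      rw [← hδ] at h2
      rw [← hm] at hp
      revert h1 h2 hp
      generalize f τ' = φ
      revert φ
      rw [← hx]
      intro φ hp h1 h2
      exact ⟨φ, h1, h2, henc _ hp⟩
    have hgt := main2 (x τ) (δ τ) (m τ) τ τ' (f τ) φ' (I τ) (I τ') (hf τ) hφ'1 (hmatch τ) hφ'2
      (hzI τ) (by rw [hm]; exact hzI τ') hφ'3
    funext k
    rcases lt_or_ge (m τ) k with hk | hk
    · exact hgt k hk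
    · rw [← hm] at hl
      exact List.map_inj_left.mp hl k (List.mem_range.mpr (Nat.lt_succ_of_le hk))
  have hcard := Cardinal.mk_le_of_injective (α := ULift.{w} (ℕ → Bool))
    (f := fun τ => key τ.down) (fun a b h => ULift.down_injective (hinj h))
  have h1 : Cardinal.mk (ULift.{w} (ℕ → Bool)) = Cardinal.continuum := by
    simp
  rw [h1, Cardinal.mk_prod] at hcard
  have h2 : Cardinal.mk (ℕ × ℤˣ × ℕ × List Bool) ≤ Cardinal.aleph0 := Cardinal.mk_le_aleph0
  refine absurd hcard (not_le.mpr ?_)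
  refine Cardinal.mul_lt_of_lt Cardinal.aleph0_le_continuum (by simpa using hX) ?_
  rw [Cardinal.lift_lt_continuum]
  exact h2.trans_lt Cardinal.aleph0_lt_continuum

end Word

/-! ### Values of intervals in the quotient by finite words -/

section

variable {G : ℕ → Type u} {K : ℕ → Type v} [∀ n, Group (G n)] [∀ n, Group (K n)]

/-- The quotient map by the normal closure of the finite words. -/
def toArch (K : ℕ → Type v) [∀ n, Group (K n)] : TopProd K →* ArchQuot K := QuotientGroup.mk' _

theorem toArch_seg_of_finite (W : Word K) {S : Set W.dom} (hS : S.Finite) :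
    toArch K (W.seg S) = 1 :=
  (QuotientGroup.eq_one_iff _).mpr (Subgroup.subset_normalClosure ⟨W.restrict S, hS, rfl⟩)

namespace CoiTriple

/-- The class, modulo finite words, of the part of the right word that corresponds to a part of
the left word. -/
def val (t : CoiTriple G K) (I : Set t.left.1.dom) : ArchQuot K :=
  toArch K (t.right.1.seg (t.coi.hull I))

theorem val_of_finite (t : CoiTriple G K) {I : Set t.left.1.dom} (hI : I.OrdConnected)
    (h : I.Finite) : t.val I = 1 :=
  toArch_seg_of_finite _ (t.coi.finite_hull hI (h.subset Set.inter_subset_left))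

/-- The hull of `I ∪ J` exceeds the two hulls by a gap without points of the target of the coi.
Closeness makes this gap finite, hence invisible in the quotient. -/
theorem val_union (t : CoiTriple G K) {I J : Set t.left.1.dom} (hlt : ∀ a ∈ I, ∀ b ∈ J, a < b)
    (hIJ : (I ∪ J).OrdConnected) : t.val (I ∪ J) = t.val I * t.val J := by
  let gap : Set t.right.1.dom := {θ | θ ∈ t.coi.hull (I ∪ J) ∧ (∀ w ∈ t.coi.hull I, w < θ) ∧
    ∀ w ∈ t.coi.hull J, θ < w}
  have hlt' : ∀ u ∈ t.coi.hull I, ∀ v ∈ t.coi.hull J, u < v := by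
    intro u hu v hv
    obtain ⟨-, -, b, hb, -, u', -, hbu, -, h1⟩ := Coi.mem_hull.mp hu
    obtain ⟨a, ha, -, -, v', -, hav, -, h2, -⟩ := Coi.mem_hull.mp hv
    exact h1.trans_lt (((hbu.lt_iff hav).mp (hlt b hb a ha)).trans_le h2)
  have hgap : gap.Finite := by
    refine t.coi.close_target.finite_of_finite_inter ?_ ?_
    · refine Set.ordConnected_iff.mpr ?_
      rintro x ⟨h1, h2, h3⟩ y ⟨h4, h5, h6⟩ - z ⟨h7, h8⟩
      exact ⟨(t.coi.ordConnected_hull _).out h1 h4 ⟨h7, h8⟩,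
        fun w hw => (h2 w hw).trans_le h7, fun w hw => h8.trans_lt (h6 w hw)⟩
    · refine Set.finite_empty.subset ?_
      rintro u ⟨⟨h1, h2, h3⟩, hu⟩
      obtain ⟨a, ha⟩ := Coi.exists_rel_of_mem_target hu
      rcases ha.mem_of_mem_hull hIJ h1 with h | h
      · exact absurd (h2 u (ha.mem_hull h)) (lt_irrefl u)
      · exact absurd (h3 u (ha.mem_hull h)) (lt_irrefl u)
  have hunion : t.coi.hull (I ∪ J) = t.coi.hull I ∪ (gap ∪ t.coi.hull J) := by
    refine Set.Subset.antisymm ?_ ?_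
    · intro θ hθ
      by_contra hcon
      simp only [Set.mem_union, not_or] at hcon
      obtain ⟨h1, h2, h3⟩ := hcon
      obtain ⟨a, ha, b, hb, u, v, hau, hbv, huθ, hθv⟩ := Coi.mem_hull.mp hθ
      have haI : a ∈ I := by
        refine ha.resolve_right fun haJ => ?_
        rcases hb with hb | hb
        · exact absurd (huθ.trans hθv) (not_le.mpr ((hbv.lt_iff hau).mp (hlt b hb a haJ)))
        · exact h3 (Coi.mem_hull.mpr ⟨a, haJ, b, hb, u, v, hau, hbv, huθ, hθv⟩)
      have hbJ : b ∈ J := hb.resolve_left fun hbI =>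
        h1 (Coi.mem_hull.mpr ⟨a, haI, b, hbI, u, v, hau, hbv, huθ, hθv⟩)
      refine h2 ⟨hθ, fun w hw => ?_, fun w hw => ?_⟩
      · by_contra hw'
        exact h1 ((t.coi.ordConnected_hull _).out (hau.mem_hull haI) hw ⟨huθ, not_lt.mp hw'⟩)
      · by_contra hw'
        exact h3 ((t.coi.ordConnected_hull _).out hw (hbv.mem_hull hbJ) ⟨not_lt.mp hw', hθv⟩)
    · rintro θ (h | h | h)
      · exact t.coi.hull_mono Set.subset_union_left h
      · exact h.1
      · exact t.coi.hull_mono Set.subset_union_right h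
  rw [val, hunion, Word.seg_union, Word.seg_union, map_mul, map_mul,
    toArch_seg_of_finite _ hgap, one_mul]
  · rfl
  · exact fun a ha b hb => ha.2.2 b hb
  · rintro a ha b (hb | hb)
    · exact hb.2.1 a ha
    · exact hlt' a ha b hb

/-- Coherence of two triples for one pair of matched intervals. -/
def AgreesAt (t₀ t₁ : CoiTriple G K) (δ : ℤˣ) (I₀ : Set t₀.left.1.dom)
    (I₁ : Set t₁.left.1.dom) : Prop := t₀.val I₀ = t₁.val I₁ ^ (δ : ℤ)

theorem AgreesAt.symm {t₀ t₁ : CoiTriple G K} {δ : ℤˣ} {I₀ : Set t₀.left.1.dom}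
    {I₁ : Set t₁.left.1.dom} (h : t₀.AgreesAt t₁ δ I₀ I₁) : t₁.AgreesAt t₀ δ I₁ I₀ := by
  rw [AgreesAt] at h ⊢
  rw [h, ← zpow_mul]
  rcases Int.units_eq_one_or δ with rfl | rfl <;> simp

/-- This trades isomorphisms of restrictions for maps between whole domains. For the empty interval,
where no such map need exist, both values are trivial. -/
theorem agree_iff (t₀ t₁ : CoiTriple G K) : t₀.Agree t₁ ↔
    ∀ (δ : ℤˣ) (f : t₀.left.1.dom → t₁.left.1.dom) (I : Set t₀.left.1.dom), I.OrdConnected →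
      (f '' I).OrdConnected → Word.IsMatch t₀.left.1 t₁.left.1 δ f I →
      t₀.AgreesAt t₁ δ I (f '' I) := by
  have key : ∀ (δ : ℤˣ) I₀ I₁, t₀.AgreesAt t₁ δ I₀ I₁ ↔
      (t₀.right.1.restrict (t₀.coi.hull I₀)).cls =
        ((t₁.right.1.restrict (t₁.coi.hull I₁)).signed δ).cls := by
    intro δ I₀ I₁
    rw [AgreesAt, val, val, ← map_zpow, Word.cls, Word.cls, Word.mk_signed]
    rfl
  constructor
  · intro h δ f I hI hfI hf
    rw [key]
    exact h I _ hI hfI δ hf.same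
  · intro h I₀ I₁ hI₀ hI₁ δ hs
    rw [← key]
    rcases I₀.eq_empty_or_nonempty with rfl | hne
    · have hI₁e : I₁ = ∅ := by
        obtain ⟨e, -⟩ := hs
        rcases Int.units_eq_one_or δ with rfl | rfl
        · rw [Word.signed_one] at e
          exact Set.eq_empty_of_forall_notMem fun i hi => (e.symm ⟨i, hi⟩).2
        · rw [Word.signed_neg_one] at e
          exact Set.eq_empty_of_forall_notMem fun i hi =>
            (e.symm (OrderDual.toDual (⟨i, hi⟩ : I₁))).2
      subst hI₁e
      rw [AgreesAt, val_of_finite _ hI₀ Set.finite_empty, val_of_finite _ hI₁ Set.finite_empty,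
        one_zpow]
    · obtain ⟨f, hf, rfl⟩ := Word.exists_isMatch_of_same hne hs
      exact h δ f I₀ hI₀ hI₁ hf

/-- For `δ = -1` the images appear in the opposite order, as do the factors in the inverse of a
product. -/
theorem AgreesAt.union {t₀ t₁ : CoiTriple G K} {δ : ℤˣ} {f : t₀.left.1.dom → t₁.left.1.dom}
    {I J : Set t₀.left.1.dom} (hlt : ∀ a ∈ I, ∀ b ∈ J, a < b) (hIJ : (I ∪ J).OrdConnected)
    (hf : Word.IsMatch t₀.left.1 t₁.left.1 δ f (I ∪ J)) (hfIJ : (f '' (I ∪ J)).OrdConnected)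
    (hI : t₀.AgreesAt t₁ δ I (f '' I)) (hJ : t₀.AgreesAt t₁ δ J (f '' J)) :
    t₀.AgreesAt t₁ δ (I ∪ J) (f '' (I ∪ J)) := by
  rw [AgreesAt] at hI hJ ⊢
  rw [val_union t₀ hlt hIJ, hI, hJ]
  rw [Set.image_union] at hfIJ ⊢
  rcases Int.units_eq_one_or δ with rfl | rfl
  · rw [val_union t₁ _ hfIJ]
    · simp
    · rintro _ ⟨a, ha, rfl⟩ _ ⟨b, hb, rfl⟩
      exact (signedLT_one _ _).mp (hf.lt (Or.inl ha) (Or.inr hb) (hlt a ha b hb))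
  · rw [Set.union_comm] at hfIJ ⊢
    rw [val_union t₁ _ hfIJ]
    · simp
    · rintro _ ⟨b, hb, rfl⟩ _ ⟨a, ha, rfl⟩
      exact (signedLT_neg_one _ _).mp (hf.lt (Or.inl ha) (Or.inr hb) (hlt a ha b hb))

/-- The triples `t` and `s` correspond to each other on the sets `A`, `B` by means of `f`, `g`. -/
structure Corresponds (t s : CoiTriple G K) (δ : ℤˣ) (f : t.left.1.dom → s.left.1.dom)
    (g : t.right.1.dom → s.right.1.dom) (A : Set t.left.1.dom) (B : Set t.right.1.dom) :
    Prop where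
  left : Word.IsMatch t.left.1 s.left.1 δ f A
  left_image : (f '' A).OrdConnected
  right : Word.IsMatch t.right.1 s.right.1 δ g B
  right_image : (g '' B).OrdConnected
  rel_iff : ∀ a ∈ A, ∀ u ∈ B, t.coi.Rel a u ↔ s.coi.Rel (f a) (g u)
  mem_right : ∀ a ∈ A, ∀ v, s.coi.Rel (f a) v → v ∈ g '' B
  mem_left : ∀ u ∈ B, ∀ a, s.coi.Rel a (g u) → a ∈ f '' A

theorem Corresponds.symm {t s : CoiTriple G K} {δ : ℤˣ} {f : t.left.1.dom → s.left.1.dom}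
    {g : t.right.1.dom → s.right.1.dom} {A : Set t.left.1.dom} {B : Set t.right.1.dom}
    (h : t.Corresponds s δ f g A B) : t.symm.Corresponds s.symm δ g f B A :=
  ⟨h.right, h.right_image, h.left, h.left_image,
    fun u hu a ha => (Coi.rel_symm _ _ _).trans
      ((h.rel_iff a ha u hu).trans (Coi.rel_symm _ _ _).symm),
    fun u hu a ha => h.mem_left u hu a ((Coi.rel_symm _ _ _).mp ha),
    fun a ha u hu => h.mem_right a ha u ((Coi.rel_symm _ _ _).mp hu)⟩

theorem Corresponds.image_hull {t s : CoiTriple G K} {δ : ℤˣ} {f : t.left.1.dom → s.left.1.dom}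
    {g : t.right.1.dom → s.right.1.dom} {A : Set t.left.1.dom} {B : Set t.right.1.dom}
    (h : t.Corresponds s δ f g A B) (hB : B.OrdConnected)
    (hAB : ∀ a u, t.coi.Rel a u → a ∈ A → u ∈ B) {I : Set t.left.1.dom} (hI : I ⊆ A) :
    g '' (t.coi.hull I) = s.coi.hull (f '' I) := by
  refine Set.Subset.antisymm ?_ ?_
  · rintro _ ⟨θ, hθ, rfl⟩
    obtain ⟨a, ha, b, hb, u, v, hau, hbv, huθ, hθv⟩ := Coi.mem_hull.mp hθ
    have hu := hAB a u hau (hI ha)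
    have hv := hAB b v hbv (hI hb)
    have hθB := hB.out hu hv ⟨huθ, hθv⟩
    have h1 := ((h.rel_iff a (hI ha) u hu).mp hau).mem_hull (Set.mem_image_of_mem f ha)
    have h2 := ((h.rel_iff b (hI hb) v hv).mp hbv).mem_hull (Set.mem_image_of_mem f hb)
    rcases huθ.eq_or_lt with rfl | h3
    · exact h1
    rcases hθv.eq_or_lt with rfl | h4
    · exact h2
    rcases h.right.between hu hθB hv h3 h4 with h5 | h5
    · exact (s.coi.ordConnected_hull _).out h1 h2 ⟨h5.1.le, h5.2.le⟩
    · exact (s.coi.ordConnected_hull _).out h2 h1 ⟨h5.1.le, h5.2.le⟩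
  · intro η hη
    obtain ⟨_, ⟨a, ha, rfl⟩, _, ⟨b, hb, rfl⟩, u, v, hau, hbv, huη, hηv⟩ := Coi.mem_hull.mp hη
    obtain ⟨u, hu, rfl⟩ := h.mem_right a (hI ha) u hau
    obtain ⟨v, hv, rfl⟩ := h.mem_right b (hI hb) v hbv
    obtain ⟨θ, hθ, rfl⟩ := h.right_image.out ⟨u, hu, rfl⟩ ⟨v, hv, rfl⟩ ⟨huη, hηv⟩
    have h1 := ((h.rel_iff a (hI ha) u hu).mpr hau).mem_hull ha
    have h2 := ((h.rel_iff b (hI hb) v hv).mpr hbv).mem_hull hb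
    refine ⟨θ, ?_, rfl⟩
    rcases huη.eq_or_lt with h3 | h3
    · rw [← h.right.injOn hu hθ h3]; exact h1
    rcases hηv.eq_or_lt with h4 | h4
    · rw [h.right.injOn hθ hv h4]; exact h2
    rcases h.right.lt_or_lt hu hθ hv h3 h4 with h5 | h5
    · exact (t.coi.ordConnected_hull _).out h1 h2 ⟨h5.1.le, h5.2.le⟩
    · exact (t.coi.ordConnected_hull _).out h2 h1 ⟨h5.1.le, h5.2.le⟩

theorem Corresponds.val_eq {t s : CoiTriple G K} {δ : ℤˣ} {f : t.left.1.dom → s.left.1.dom}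
    {g : t.right.1.dom → s.right.1.dom} {A : Set t.left.1.dom} {B : Set t.right.1.dom}
    (h : t.Corresponds s δ f g A B) (hB : B.OrdConnected)
    (hAB : ∀ a u, t.coi.Rel a u → a ∈ A → u ∈ B) {I : Set t.left.1.dom} (hI : I ⊆ A) :
    t.val I = s.val (f '' I) ^ (δ : ℤ) := by
  have hsub : t.coi.hull I ⊆ B := by
    intro θ hθ
    obtain ⟨a, ha, b, hb, u, v, hau, hbv, huθ, hθv⟩ := Coi.mem_hull.mp hθ
    exact hB.out (hAB a u hau (hI ha)) (hAB b v hbv (hI hb)) ⟨huθ, hθv⟩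
  rw [val, val, ← map_zpow, (h.right.mono hsub).seg_eq, h.image_hull hB hAB hI]

end CoiTriple

/-! ### Coherence of triples assembled from a family -/

/-- The triple `t` is put together from finite parts and parts of the triples `T x`, labelled by
natural numbers. -/
structure Assembled {X : Type w} (T : X → CoiTriple G K) (t : CoiTriple G K)
    (q : t.left.1.dom → ℕ) (q' : t.right.1.dom → ℕ) : Prop where
  mono_left : Monotone q
  mono_right : Monotone q'
  rel : ∀ a u, t.coi.Rel a u → q a = q' u
  fiber : ∀ k, ((q ⁻¹' {k}).Finite ∧ (q' ⁻¹' {k}).Finite) ∨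
    ∃ x δ f g, t.Corresponds (T x) δ f g (q ⁻¹' {k}) (q' ⁻¹' {k})

namespace Assembled

variable {X : Type w} {T : X → CoiTriple G K} {t : CoiTriple G K}
    {q : t.left.1.dom → ℕ} {q' : t.right.1.dom → ℕ}

theorem symm (h : Assembled T t q q') : Assembled (fun x => (T x).symm) t.symm q' q :=
  ⟨h.mono_right, h.mono_left, fun u a hua => (h.rel a u ((Coi.rel_symm _ _ _).mp hua)).symm,
    fun k => (h.fiber k).imp (fun h => h.symm) (fun ⟨x, δ, f, g, h⟩ => ⟨x, δ, g, f, h.symm⟩)⟩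

/-- Induction on the label bound, splitting off the last fibre. There the value is trivial if the
fibre is finite; otherwise the fibre is a copy of a part of some `T x`, and the match with `s` is
pulled back to `T x`. -/
theorem agreesAt_of_bounded (h : Assembled T t q q') {s : CoiTriple G K}
    (hs : ∀ x, (T x).Agree s) (δ : ℤˣ) (φ : t.left.1.dom → s.left.1.dom) (n : ℕ) :
    ∀ I : Set t.left.1.dom, I.OrdConnected → (φ '' I).OrdConnected →
      Word.IsMatch t.left.1 s.left.1 δ φ I → (∀ i ∈ I, q i < n) → t.AgreesAt s δ I (φ '' I) := by
  induction n with
  | zero =>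
    intro I hI hφI hφ hn
    obtain rfl : I = ∅ := Set.eq_empty_of_forall_notMem fun i hi => absurd (hn i hi) (by omega)
    rw [CoiTriple.AgreesAt, CoiTriple.val_of_finite _ hI Set.finite_empty,
      CoiTriple.val_of_finite _ hφI (Set.finite_empty.image _), one_zpow]
  | succ n ih =>
    intro I hI hφI hφ hn
    have hsplit : I = I ∩ q ⁻¹' Set.Iio n ∪ I ∩ q ⁻¹' {n} := by
      ext i
      simp only [Set.mem_union, Set.mem_inter_iff, Set.mem_preimage, Set.mem_Iio,
        Set.mem_singleton_iff, ← and_or_left]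
      exact ⟨fun hi => ⟨hi, by have := hn i hi; omega⟩, fun hi => hi.1⟩
    have hc1 : (I ∩ q ⁻¹' Set.Iio n).OrdConnected :=
      hI.inter (Set.ordConnected_Iio.preimage_mono h.mono_left)
    have hc2 : (I ∩ q ⁻¹' {n}).OrdConnected := hI.inter (Word.ordConnected_fiber h.mono_left n)
    have hi1 := hφ.ordConnected_image hφI Set.inter_subset_left hc1
    have hi2 := hφ.ordConnected_image hφI Set.inter_subset_left hc2
    have h1 := ih _ hc1 hi1 (hφ.mono Set.inter_subset_left) (fun i hi => hi.2)
    have h2 : t.AgreesAt s δ (I ∩ q ⁻¹' {n}) (φ '' (I ∩ q ⁻¹' {n})) := by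
      rcases h.fiber n with ⟨hf, -⟩ | ⟨x, ε, f, g, hc⟩
      · have hf' := hf.subset (Set.inter_subset_right (s := I))
        rw [CoiTriple.AgreesAt, CoiTriple.val_of_finite _ hc2 hf',
          CoiTriple.val_of_finite _ hi2 (hf'.image _), one_zpow]
      · rcases (I ∩ q ⁻¹' {n}).eq_empty_or_nonempty with he | ⟨a₀, -⟩
        · rw [CoiTriple.AgreesAt, CoiTriple.val_of_finite _ hc2 (he ▸ Set.finite_empty),
            CoiTriple.val_of_finite _ hi2 ((he ▸ Set.finite_empty : Set.Finite _).image _),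
            one_zpow]
        have : Nonempty t.left.1.dom := ⟨a₀⟩
        have hfm := hc.left.mono (Set.inter_subset_right (s := I))
        obtain ⟨f', hf'⟩ := hfm.exists_leftInv
        have hm := (hfm.symm hf').comp (g := φ) (by
          rw [Word.IsMatch.image_image hf']; exact hφ.mono Set.inter_subset_left)
        have himg : (φ ∘ f') '' (f '' (I ∩ q ⁻¹' {n})) = φ '' (I ∩ q ⁻¹' {n}) := by
          rw [Set.image_comp, Word.IsMatch.image_image hf']
        have h3 := (CoiTriple.agree_iff _ _).mp (hs x) _ _ _
          (hc.left.ordConnected_image hc.left_image Set.inter_subset_right hc2)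
          (by rw [himg]; exact hi2) hm
        rw [himg, CoiTriple.AgreesAt] at h3
        rw [CoiTriple.AgreesAt, hc.val_eq (Word.ordConnected_fiber h.mono_right n)
          (fun a u hau ha => (h.rel a u hau).symm.trans ha) Set.inter_subset_right, h3,
          ← zpow_mul, ← Units.val_mul]
        -- The pulled-back match has sign `ε * δ`, and the copy contributes another `ε`.
        congr 2
        rw [mul_comm, ← mul_assoc, Int.units_mul_self, one_mul]
    rw [hsplit] at hI hφI hφ ⊢
    refine CoiTriple.AgreesAt.union ?_ hI hφ hφI h1 h2
    intro a ha b hb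
    refine h.mono_left.reflect_lt ?_
    have h3 : q a < n := ha.2
    have h4 : q b = n := hb.2
    omega

/-- An interval with unbounded labels is cofinal, and `AvoidsTails` excludes any match of it. -/
theorem agree_family (h : Assembled T t q q')
    (hT : ∀ x y, (T x).Agree (T y)) (ht : Word.AvoidsTails (fun x => (T x).left.1) t.left.1)
    (y : X) : t.Agree (T y) := by
  rw [CoiTriple.agree_iff]
  intro δ f I hI hfI hf
  by_cases hb : ∃ n, ∀ i ∈ I, q i < n
  · obtain ⟨n, hn⟩ := hb
    exact h.agreesAt_of_bounded (fun x => hT x y) δ f n I hI hfI hf hn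
  · push Not at hb
    refine absurd hf (ht y δ f I hI (fun a => ?_) hfI)
    obtain ⟨i, hi, hai⟩ := hb (q a + 1)
    exact ⟨i, hi, h.mono_left.reflect_lt (by omega)⟩

end Assembled

theorem CoiTriple.Agree.symm {t s : CoiTriple G K} (h : t.Agree s) : s.Agree t := by
  rw [CoiTriple.agree_iff] at h ⊢
  intro δ f I hI hfI hf
  rcases I.eq_empty_or_nonempty with rfl | ⟨a, -⟩
  · rw [CoiTriple.AgreesAt, CoiTriple.val_of_finite _ hI Set.finite_empty,
      CoiTriple.val_of_finite _ hfI (Set.finite_empty.image _), one_zpow]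
  have : Nonempty s.left.1.dom := ⟨a⟩
  obtain ⟨g, hg⟩ := hf.exists_leftInv
  have h1 := h δ g _ hfI (by rw [Word.IsMatch.image_image hg]; exact hI) (hf.symm hg)
  rw [Word.IsMatch.image_image hg] at h1
  exact h1.symm

/-- Iterating `φ` from a point with `a < φ a` would give infinitely many occurrences of the same
letter. -/
theorem Word.IsMatch.not_lt_apply {W : Word G} {φ : W.dom → W.dom} {I : Set W.dom}
    (h : W.IsMatch W 1 φ I) (hI : ∀ a ∈ I, ∀ b, a ≤ b → b ∈ I) {a : W.dom} (ha : a ∈ I) :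
    ¬ a < φ a := by
  intro hlt
  have key : ∀ n, φ^[n] a ∈ I ∧ φ^[n] a < φ^[n + 1] a ∧ W.letter (φ^[n] a) = W.letter a := by
    intro n
    induction n with
    | zero => exact ⟨ha, hlt, rfl⟩
    | succ n ih =>
      have h1 : φ^[n + 1] a ∈ I := hI _ ih.1 _ ih.2.1.le
      refine ⟨h1, ?_, ?_⟩
      · have := h.lt ih.1 h1 ih.2.1
        rw [signedLT_one] at this
        rwa [← Function.iterate_succ_apply' φ n, ← Function.iterate_succ_apply' φ (n + 1)] at this
      · rw [Function.iterate_succ_apply', h.letter ih.1, Letter.signed_one]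
        exact ih.2.2
  obtain ⟨m, hm⟩ := (W.letter a).exists_inGroup
  refine Set.infinite_of_injective_forall_mem
    (strictMono_nat_of_lt_succ fun n => (key n).2.1).injective (fun n => ?_)
    (W.finite_letters m)
  change (W.letter _).InGroup m
  rw [(key n).2.2]
  exact hm

/-- If `I` or its image is bounded in labels, the bounded case applies to `f` or to its inverse.
Otherwise both are final segments. For sign `1`, neither `f` nor its inverse moves a point upwards,
so `f` is the identity. For sign `-1`, `I` is cut at a point: the lower part is bounded, and the
upper part has a bounded image. -/
theorem Assembled.agree_self {X : Type w} {T : X → CoiTriple G K} {t : CoiTriple G K}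
    {q : t.left.1.dom → ℕ} {q' : t.right.1.dom → ℕ} (h : Assembled T t q q')
    (hT : ∀ x, (T x).Agree t) : t.Agree t := by
  rw [CoiTriple.agree_iff]
  intro δ f I hI hfI hf
  rcases I.eq_empty_or_nonempty with rfl | ⟨a₀, ha₀⟩
  · rw [CoiTriple.AgreesAt, CoiTriple.val_of_finite _ hI Set.finite_empty,
      CoiTriple.val_of_finite _ hfI (Set.finite_empty.image _), one_zpow]
  have : Nonempty t.left.1.dom := ⟨a₀⟩
  have hbd : ∀ J ⊆ I, J.OrdConnected → (∃ n, ∀ i ∈ J, q i < n) →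
      t.AgreesAt t δ J (f '' J) := fun J hJI hJ ⟨n, hn⟩ =>
    h.agreesAt_of_bounded hT δ f n J hJ (hf.ordConnected_image hfI hJI hJ) (hf.mono hJI) hn
  have hbd' : ∀ J ⊆ I, J.OrdConnected → (∃ n, ∀ i ∈ f '' J, q i < n) →
      t.AgreesAt t δ J (f '' J) := by
    rintro J hJI hJ ⟨n, hn⟩
    have hfJ := hf.mono hJI
    obtain ⟨g, hg⟩ := hfJ.exists_leftInv
    have h1 := h.agreesAt_of_bounded hT δ g n (f '' J) (hf.ordConnected_image hfI hJI hJ)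
      (by rw [Word.IsMatch.image_image hg]; exact hJ) (hfJ.symm hg) hn
    rw [Word.IsMatch.image_image hg] at h1
    exact h1.symm
  by_cases hb : ∃ n, ∀ i ∈ I, q i < n
  · exact hbd I subset_rfl hI hb
  by_cases hb' : ∃ n, ∀ i ∈ f '' I, q i < n
  · exact hbd' I subset_rfl hI hb'
  push Not at hb hb'
  have hup : ∀ J : Set t.left.1.dom, J.OrdConnected → (∀ n, ∃ i ∈ J, n ≤ q i) →
      ∀ a ∈ J, ∀ b, a ≤ b → b ∈ J := by
    intro J hJ hJb a ha b hab
    obtain ⟨c, hc, hbc⟩ := hJb (q b + 1)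
    exact hJ.out ha hc ⟨hab, (h.mono_left.reflect_lt (by omega : q b < q c)).le⟩
  rcases Int.units_eq_one_or δ with rfl | rfl
  · obtain ⟨g, hg⟩ := hf.exists_leftInv
    have hid : ∀ a ∈ I, f a = a := by
      intro a ha
      rcases lt_trichotomy (f a) a with hlt | heq | hlt
      · have h1 := (hf.symm hg).not_lt_apply (hup _ hfI hb') (a := f a) ⟨a, ha, rfl⟩
        rw [hg a ha] at h1
        exact absurd hlt h1
      · exact heq
      · exact absurd hlt (hf.not_lt_apply (hup I hI hb) ha)
    have himg : f '' I = I := by rw [Set.image_congr hid, Set.image_id']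
    rw [himg, CoiTriple.AgreesAt]
    simp
  · have hsplit : I = I ∩ Set.Iio a₀ ∪ I ∩ Set.Ici a₀ := by
      rw [← Set.inter_union_distrib_left, Set.Iio_union_Ici, Set.inter_univ]
    have h1 := hbd _ Set.inter_subset_left (hI.inter (Set.ordConnected_Iio (a := a₀)))
      ⟨q a₀ + 1, fun i hi => Nat.lt_succ_of_le (h.mono_left (le_of_lt hi.2))⟩
    have h2 := hbd' _ Set.inter_subset_left (hI.inter (Set.ordConnected_Ici (a := a₀)))
      ⟨q (f a₀) + 1, by
        rintro _ ⟨i, hi, rfl⟩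
        refine Nat.lt_succ_of_le (h.mono_left ?_)
        rcases (show a₀ ≤ i from hi.2).eq_or_lt with rfl | hlt
        · exact le_rfl
        · exact ((signedLT_neg_one _ _).mp (hf.lt ha₀ hi.1 hlt)).le⟩
    rw [hsplit] at hI hfI hf ⊢
    exact CoiTriple.AgreesAt.union (fun a ha b hb => lt_of_lt_of_le ha.2 hb.2) hI hf hfI h1 h2

theorem Assembled.coherent {X : Type w} {T : X → CoiTriple G K} {t : CoiTriple G K}
    {q : t.left.1.dom → ℕ} {q' : t.right.1.dom → ℕ} (h : Assembled T t q q')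
    (hT : Coherent (Set.range T)) (hl : Word.AvoidsTails (fun x => (T x).left.1) t.left.1)
    (hr : Word.AvoidsTails (fun x => (T x).right.1) t.right.1) :
    Coherent (Set.range T ∪ {t}) := by
  have hT1 : ∀ x y, (T x).Agree (T y) := fun x y => (hT _ ⟨x, rfl⟩ _ ⟨y, rfl⟩).1
  have hT2 : ∀ x y, (T x).symm.Agree (T y).symm := fun x y => (hT _ ⟨x, rfl⟩ _ ⟨y, rfl⟩).2
  have h1 := h.agree_family hT1 hl
  have h2 := h.symm.agree_family hT2 hr
  rintro _ (⟨x, rfl⟩ | rfl) _ (⟨y, rfl⟩ | rfl)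
  · exact ⟨hT1 x y, hT2 x y⟩
  · exact ⟨(h1 x).symm, (h2 x).symm⟩
  · exact ⟨h1 y, h2 y⟩
  · exact ⟨h.agree_self fun x => (h1 x).symm, h.symm.agree_self fun x => (h2 x).symm⟩

end

/-! ### Construction of the new triple -/

section

variable {G : ℕ → Type u} {K : ℕ → Type v} [∀ n, Group (G n)] [∀ n, Group (K n)]

theorem Word.exists_isMatch_univ (W : Word K) (S : Set W.dom) (δ : ℤˣ) :
    ∃ (Q : Word K) (g : Q.dom → W.dom), IsMatch Q W δ g Set.univ ∧ g '' Set.univ = S := by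
  have h := isMatch_val W S
  rcases Int.units_eq_one_or δ with rfl | rfl
  · exact ⟨W.restrict S, _, h, Subtype.coe_image_univ S⟩
  · refine ⟨(W.restrict S).inv, fun d => (OrderDual.ofDual d : S).1, ⟨?_, ?_⟩, ?_⟩
    · intro a _ b _ hab
      exact (signedLT_neg_one _ _).mpr hab
    · intro a _
      rw [Letter.signed_neg_one]
      exact (Letter.inv_inv _).symm
    · ext i
      constructor
      · rintro ⟨d, -, rfl⟩
        exact (OrderDual.ofDual d : S).2
      · intro hi
        exact ⟨OrderDual.toDual (⟨i, hi⟩ : S), trivial, rfl⟩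

/-- `Q` is a copy of the part of the right word of the triple `t` that corresponds to the part
of the left word matched with `A`, and `R` is the copy of the graph of the coi. -/
structure IsTransported (t : CoiTriple G K) (W : Word G) (A : Set W.dom) (Q : Word K)
    (R : W.dom → Q.dom → Prop) (δ : ℤˣ) (f : W.dom → t.left.1.dom)
    (g : Q.dom → t.right.1.dom) : Prop where
  left : Word.IsMatch W t.left.1 δ f A
  left_image : (f '' A).OrdConnected
  right : Word.IsMatch Q t.right.1 δ g Set.univ
  right_image : g '' Set.univ = t.coi.hull (f '' A)
  rel_iff : ∀ a d, R a d ↔ t.coi.Rel (f a) (g d)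

namespace IsTransported

variable {t : CoiTriple G K} {W : Word G} {A : Set W.dom} {Q : Word K}
    {R : W.dom → Q.dom → Prop} {δ : ℤˣ} {f : W.dom → t.left.1.dom} {g : Q.dom → t.right.1.dom}

theorem lt_iff (h : IsTransported t W A Q R δ f g) {a b : W.dom} (ha : a ∈ A) (hb : b ∈ A)
    {d d' : Q.dom} (h1 : R a d) (h2 : R b d') : a < b ↔ d < d' := by
  rw [h.rel_iff] at h1 h2
  rw [h.left.lt_iff ha hb, h.right.lt_iff trivial trivial]
  rcases Int.units_eq_one_or δ with rfl | rfl
  · simpa using h1.lt_iff h2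
  · simpa using h2.lt_iff h1

theorem exists_of_rel_left (h : IsTransported t W A Q R δ f g) {a : W.dom} (ha : a ∈ A)
    {v : t.right.1.dom} (hv : t.coi.Rel (f a) v) : ∃ d, g d = v ∧ R a d := by
  have h1 := hv.mem_hull (Set.mem_image_of_mem f ha)
  rw [← h.right_image] at h1
  obtain ⟨d, -, rfl⟩ := h1
  exact ⟨d, rfl, (h.rel_iff a d).mpr hv⟩

theorem exists_of_rel_right (h : IsTransported t W A Q R δ f g) {d : Q.dom}
    {c : t.left.1.dom} (hc : t.coi.Rel c (g d)) : ∃ a ∈ A, f a = c ∧ R a d := by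
  have h1 : g d ∈ t.coi.hull (f '' A) := h.right_image ▸ Set.mem_image_of_mem g trivial
  obtain ⟨a, ha, rfl⟩ := hc.mem_of_mem_hull h.left_image h1
  exact ⟨a, ha, rfl, (h.rel_iff a d).mpr hc⟩

theorem exists_rel_left (h : IsTransported t W A Q R δ f g) {I : Set W.dom}
    (hI : I.OrdConnected) (hIA : I ⊆ A) (hinf : I.Infinite) : ∃ a ∈ I, ∃ d, R a d := by
  obtain ⟨_, ⟨a, ha, rfl⟩, hs⟩ := t.coi.close_source (f '' I)
    (h.left.ordConnected_image h.left_image hIA hI) (hinf.image (h.left.injOn.mono hIA))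
  obtain ⟨v, hv⟩ := Coi.exists_rel_of_mem_source hs
  obtain ⟨d, -, hd⟩ := h.exists_of_rel_left (hIA ha) hv
  exact ⟨a, ha, d, hd⟩

theorem exists_rel_right (h : IsTransported t W A Q R δ f g) {J : Set Q.dom}
    (hJ : J.OrdConnected) (hinf : J.Infinite) : ∃ d ∈ J, ∃ a ∈ A, R a d := by
  obtain ⟨_, ⟨d, hd, rfl⟩, hs⟩ := t.coi.close_target (g '' J)
    (h.right.ordConnected_image (h.right_image ▸ t.coi.ordConnected_hull _) (Set.subset_univ J) hJ)
    (hinf.image (h.right.injOn.mono (Set.subset_univ J)))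
  obtain ⟨c, hc⟩ := Coi.exists_rel_of_mem_target hs
  obtain ⟨a, ha, -, had⟩ := h.exists_of_rel_right hc
  exact ⟨d, hd, a, ha, had⟩

end IsTransported

/-- The right-hand part is copied with the sign of the left-hand match, so the copied relation
preserves order even when `δ = -1`. -/
theorem IsPieceAbove.exists_isTransported {X : Type w} {T : X → CoiTriple G K} {n : ℕ}
    {W : Word G} {A : Set W.dom} (h : IsPieceAbove T n W A) :
    ∃ (Q : Word K) (R : W.dom → Q.dom → Prop), Q.ReducedOn Set.univ ∧
      (∀ d, ∀ i < n, ¬ (Q.letter d).InGroup i) ∧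
      ∃ x δ f g, IsTransported (T x) W A Q R δ f g := by
  obtain ⟨x, δ, f, hf, hfc, hn⟩ := h
  obtain ⟨Q, g, hg, hgi⟩ := (T x).right.1.exists_isMatch_univ ((T x).coi.hull (f '' A)) δ
  refine ⟨Q, fun a d => (T x).coi.Rel (f a) (g d), ?_, ?_, x, δ, f, g, hf, hfc, hg, hgi,
    fun _ _ => Iff.rfl⟩
  · refine hg.reducedOn ?_ ?_
    · rw [hgi]
      exact Coi.ordConnected_hull _ _
    · exact ((Word.isReduced_iff _).mp (T x).right.2).mono (Set.subset_univ _)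
  · intro d i hi hd
    refine hn (g d) (hgi ▸ Set.mem_image_of_mem g trivial) i hi ?_
    rwa [hg.letter trivial, Letter.inGroup_signed]

theorem infinite_image_of_finite_fibers {D : Type*} {q : D → ℕ} {I : Set D} (hI : I.Infinite)
    (h : ∀ k, (I ∩ q ⁻¹' {k}).Finite) : (q '' I).Infinite := by
  intro hfin
  refine hI ((hfin.biUnion fun k _ => h k).subset fun i hi => ?_)
  exact Set.mem_biUnion (Set.mem_image_of_mem q hi) ⟨hi, rfl⟩

/-- For a nonempty finite fibre, one of its letters is paired with `z k`; for an infinite fibre, `z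
k` stays unpaired and `Q k` is paired through the copied coi. Labels are doubled: `2 * k` collects
the finite parts and the new letter, `2 * k + 1` the transported part. -/
theorem exists_assembled {X : Type w} (hX : Cardinal.mk X < Cardinal.continuum)
    (T : X → CoiTriple G K) (hK : ∀ n, ∃ k : K n, ¬ IsOfFinOrder k) (W : Red G)
    (q : W.1.dom → ℕ) (b : ℕ → ℕ) (hq : Monotone q) (hqt : ∀ n, ∃ i, n ≤ q i) (hb : Monotone b)
    (hb1 : ∀ k, b (k + 1) ≤ b k + 1) (hbt : ∀ n, ∃ k, n ≤ b k)
    (hfib : ∀ k, (q ⁻¹' {k}).Finite ∨ IsPieceAbove T (2 * b k + 4) W.1 (q ⁻¹' {k})) :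
    ∃ (U : Red K) (ι : Coi W.1.dom U.1.dom) (p : W.1.dom → ℕ) (p' : U.1.dom → ℕ),
      Assembled T ⟨W, U, ι⟩ p p' ∧ Word.AvoidsTails (fun x => (T x).right.1) U.1 := by
  classical
  have hdata : ∀ k, ∃ (Q : Word K) (R : W.1.dom → Q.dom → Prop), Q.ReducedOn Set.univ ∧
      (∀ d, ∀ i < 2 * b k + 4, ¬ (Q.letter d).InGroup i) ∧
      ((q ⁻¹' {k}).Finite → IsEmpty Q.dom) ∧ ((q ⁻¹' {k}).Infinite →
      ∃ x δ f g, IsTransported (T x) W.1 (q ⁻¹' {k}) Q R δ f g) := by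
    intro k
    by_cases hf : (q ⁻¹' {k}).Finite
    · refine ⟨Word.empty, fun _ _ => True, ?_, fun d => d.elim, fun _ => ?_,
        fun h => absurd hf h⟩
      · have : (Set.univ : Set (Word.empty : Word K).dom) = ∅ :=
          Set.eq_empty_of_forall_notMem fun d => d.elim
        rw [this]
        exact Word.reducedOn_empty _
      · exact inferInstanceAs (IsEmpty Empty)
    · obtain ⟨Q, R, h1, h2, h3⟩ := ((hfib k).resolve_left hf).exists_isTransported
      exact ⟨Q, R, h1, h2, fun h => absurd h hf, fun _ => h3⟩
  choose Q R hQred hQlet hQe hQt using hdata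
  obtain ⟨t, U, q', z, e, hU, hUred, hUt⟩ := Word.exists_reduced_interleaved hX
    (fun x => (T x).right.1) hK Q hQred b hb hb1 hbt hQlet
  obtain ⟨i₀, -⟩ := hqt 0
  -- For an empty fibre the default is harmless, since `P` demands `q a = k`.
  have hw : ∀ k, ∃ a : W.1.dom, ∀ c, q c = k → q a = k := by
    intro k
    by_cases h : ∃ c, q c = k
    · obtain ⟨c, hc⟩ := h
      exact ⟨c, fun _ _ => hc⟩
    · exact ⟨i₀, fun c hc => absurd ⟨c, hc⟩ h⟩
  choose a₀ ha₀ using hw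
  have hlt_e : ∀ k d d', e k d < e k d' ↔ d < d' := fun k d d' => by
    rw [(hU.isMatch k).lt_iff trivial trivial, signedLT_one]
  let P : W.1.dom → U.dom → Prop := fun a u => ∃ k, q a = k ∧
    (((q ⁻¹' {k}).Finite ∧ a = a₀ k ∧ u = z k) ∨
      ((q ⁻¹' {k}).Infinite ∧ ∃ d, u = e k d ∧ R k a d))
  have hPq : ∀ a u, P a u → q a = q' u := by
    rintro a u ⟨k, hk, ⟨-, -, rfl⟩ | ⟨-, d, rfl, -⟩⟩
    · rw [hU.q_z, hk]
    · rw [hU.q_e, hk]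
  have hPe : ∀ k, (q ⁻¹' {k}).Infinite → ∀ a, q a = k → ∀ d, P a (e k d) ↔ R k a d := by
    intro k hk a ha d
    constructor
    · rintro ⟨l, hl, ⟨hf, -, -⟩ | ⟨-, d', h1, h2⟩⟩
      · exact absurd ((ha.symm.trans hl) ▸ hf) hk
      · obtain rfl := ha.symm.trans hl
        rwa [(hU.isMatch k).injOn trivial trivial h1]
    · exact fun h => ⟨k, ha, Or.inr ⟨hk, d, rfl, h⟩⟩
  have hP : ∀ a u b v, P a u → P b v → (a < b ↔ u < v) := by
    intro a u b v h1 h2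
    have e1 := hPq a u h1
    have e2 := hPq b v h2
    rcases lt_trichotomy (q a) (q b) with h | h | h
    · exact iff_of_true (hq.reflect_lt h) (hU.lt_of_lt (by omega))
    · obtain ⟨k, hk, h1⟩ := h1
      obtain ⟨l, hl, h2⟩ := h2
      obtain rfl : k = l := by omega
      rcases h1 with ⟨h1, rfl, rfl⟩ | ⟨h1, d, rfl, h3⟩
      · rcases h2 with ⟨h2, rfl, rfl⟩ | ⟨h2, -⟩
        · simp
        · exact absurd h1 h2
      · rcases h2 with ⟨h2, -⟩ | ⟨h2, d', rfl, h4⟩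
        · exact absurd h2 h1
        · obtain ⟨x, δ, f, g, ht⟩ := hQt k h1
          rw [hlt_e]
          exact ht.lt_iff hk hl h3 h4
    · exact iff_of_false (hq.reflect_lt h).asymm (hU.lt_of_lt (by omega)).asymm
  -- In the second case of each closeness proof the interval swallows all sufficiently late fibres,
  -- and any later nonempty fibre of `q` provides a pair.
  have hlarge : ∀ (D : Type) [LinearOrder D] (p : D → ℕ) (I : Set D), Monotone p →
      I.OrdConnected → I.Infinite → (∀ k, (I ∩ p ⁻¹' {k}).Finite) →
      ∃ n, ∀ d, n < p d → d ∈ I := by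
    intro D _ p I hp hI hinf hf
    have hinf' := infinite_image_of_finite_fibers hinf hf
    obtain ⟨i, hi⟩ := hinf.nonempty
    refine ⟨p i, fun d hd => ?_⟩
    obtain ⟨_, ⟨j, hj, rfl⟩, hdj⟩ := hinf'.exists_gt (p d)
    exact hI.out hi hj ⟨(hp.reflect_lt hd).le, (hp.reflect_lt hdj).le⟩
  have hs : IsClose {a | ∃ u, P a u} := by
    intro I hI hinf
    by_cases hf : ∃ k, (I ∩ q ⁻¹' {k}).Infinite
    · obtain ⟨k, hk⟩ := hf
      have hk' := hk.mono Set.inter_subset_right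
      obtain ⟨x, δ, f, g, ht⟩ := hQt k hk'
      obtain ⟨a, ha, d, had⟩ := ht.exists_rel_left (hI.inter (Word.ordConnected_fiber hq k))
        Set.inter_subset_right hk
      exact ⟨a, ha.1, _, (hPe k hk' a ha.2 d).mpr had⟩
    · simp only [not_exists, Set.not_infinite] at hf
      obtain ⟨n, hn⟩ := hlarge _ q I hq hI hinf hf
      obtain ⟨i, hi⟩ := hqt (n + 1)
      have h1 := ha₀ (q i) i rfl
      refine ⟨a₀ (q i), hn _ (by omega), z (q i), q i, h1, Or.inl ⟨?_, rfl, rfl⟩⟩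
      refine (hf (q i)).subset fun j hj => ⟨hn j ?_, hj⟩
      have : q j = q i := hj
      omega
  have ht : IsClose {u | ∃ a, P a u} := by
    intro J hJ hinf
    by_cases hf : ∃ k, (J ∩ q' ⁻¹' {k}).Infinite
    · obtain ⟨k, hk⟩ := hf
      have hinf' : (e k ⁻¹' J).Infinite := by
        intro hfin
        refine hk (((hfin.image (e k)).union (Set.finite_singleton (z k))).subset ?_)
        rintro u ⟨huJ, rfl⟩
        rcases hU.cases u with h | ⟨d, h⟩
        · exact Or.inr h
        · exact Or.inl ⟨d, by rwa [Set.mem_preimage, ← h], h.symm⟩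
      have hk' : (q ⁻¹' {k}).Infinite := fun hfin => by
        have := hQe k hfin
        exact hinf' (Set.toFinite _)
      have hJ' : (e k ⁻¹' J).OrdConnected := by
        have := (hU.isMatch k).ordConnected_preimage Set.ordConnected_univ hJ
        rwa [Set.univ_inter] at this
      obtain ⟨x, δ, f, g, ht⟩ := hQt k hk'
      obtain ⟨d, hd, a, ha, had⟩ := ht.exists_rel_right hJ' hinf'
      exact ⟨e k d, hd, a, (hPe k hk' a ha d).mpr had⟩
    · simp only [not_exists, Set.not_infinite] at hf
      obtain ⟨n, hn⟩ := hlarge _ q' J hU.mono hJ hinf hf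
      obtain ⟨i, hi⟩ := hqt (n + 1)
      by_cases hfin : (q ⁻¹' {q i}).Finite
      · exact ⟨z (q i), hn _ (by rw [hU.q_z]; omega), a₀ (q i), q i, ha₀ (q i) i rfl,
          Or.inl ⟨hfin, rfl, rfl⟩⟩
      · obtain ⟨x, δ, f, g, ht⟩ := hQt _ hfin
        obtain ⟨a, ha, d, had⟩ := ht.exists_rel_left (Word.ordConnected_fiber hq (q i))
          subset_rfl hfin
        exact ⟨e _ d, hn _ (by rw [hU.q_e]; omega), a, (hPe _ hfin a ha d).mpr had⟩
  obtain ⟨ι, hι⟩ := Coi.exists_of_rel P hP hs ht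
  refine ⟨⟨U, hUred⟩, ι, fun a => if (q ⁻¹' {q a}).Finite then 2 * q a else 2 * q a + 1,
    fun u => if u = z (q' u) then 2 * q' u else 2 * q' u + 1, ⟨?_, ?_, ?_, ?_⟩, hUt⟩
  · intro a c hac
    rcases (hq hac).lt_or_eq with h | h
    · dsimp only
      split_ifs <;> omega
    · dsimp only
      rw [h]
  · intro u v huv
    rcases (hU.mono huv).lt_or_eq with h | h
    · dsimp only
      split_ifs <;> omega
    · dsimp only
      -- The new letter comes first among the letters with its label.
      have h3 : v = z (q' v) → u = z (q' u) := fun hv =>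
        le_antisymm (huv.trans (hv.trans (congrArg z h.symm)).le) (hU.z_le u)
      split_ifs with h1 h2 h2
      · omega
      · omega
      · exact absurd (h3 h2) h1
      · omega
  · intro a u hau
    obtain ⟨k, rfl, ⟨h1, h2, rfl⟩ | ⟨h1, d, rfl, h2⟩⟩ := (hι a u).mp hau
    · dsimp only
      rw [if_pos h1, if_pos (by rw [hU.q_z]), hU.q_z]
    · dsimp only
      rw [if_neg h1, if_neg (by rw [hU.q_e]; exact hU.e_ne _ _), hU.q_e]
  · intro m
    obtain ⟨k, rfl | rfl⟩ := Nat.even_or_odd' m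
    · left
      constructor
      · by_cases hf : (q ⁻¹' {k}).Finite
        · refine hf.subset fun a ha => ?_
          simp only [Set.mem_preimage, Set.mem_singleton_iff] at ha ⊢
          split_ifs at ha <;> omega
        · refine Set.finite_empty.subset fun a ha => hf ?_
          simp only [Set.mem_preimage, Set.mem_singleton_iff] at ha
          split_ifs at ha with h
          · rwa [show q a = k by omega] at h
          · omega
      · refine (Set.finite_singleton (z k)).subset fun u hu => ?_
        simp only [Set.mem_preimage, Set.mem_singleton_iff] at hu ⊢
        split_ifs at hu with h
        · rwa [show q' u = k by omega] at h
        · omega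
    · have hr : (fun u => if u = z (q' u) then 2 * q' u else 2 * q' u + 1) ⁻¹' {2 * k + 1} =
          e k '' Set.univ := by
        rw [Set.image_univ, hU.range_e]
        ext u
        simp only [Set.mem_preimage, Set.mem_singleton_iff, Set.mem_ofPred_eq]
        constructor
        · intro hu
          split_ifs at hu with h
          · omega
          · obtain rfl : q' u = k := by omega
            exact ⟨rfl, h⟩
        · rintro ⟨rfl, h⟩
          rw [if_neg h]
      by_cases hf : (q ⁻¹' {k}).Finite
      · left
        constructor
        · refine Set.finite_empty.subset fun a ha => ?_
          simp only [Set.mem_preimage, Set.mem_singleton_iff] at ha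
          split_ifs at ha with h
          · omega
          · exact h ((show q a = k by omega) ▸ hf)
        · have := hQe k hf
          rw [hr]
          exact (Set.toFinite _).image _
      · right
        have hl : (fun a => if (q ⁻¹' {q a}).Finite then 2 * q a else 2 * q a + 1) ⁻¹'
            {2 * k + 1} = q ⁻¹' {k} := by
          ext a
          simp only [Set.mem_preimage, Set.mem_singleton_iff]
          constructor
          · intro ha
            split_ifs at ha <;> omega
          · rintro rfl
            rw [if_neg hf]
        rw [hl, hr]
        obtain ⟨x, δ, f, g, ht⟩ := hQt k hf
        obtain ⟨-, -, d₀, -⟩ := ht.exists_rel_left (Word.ordConnected_fiber hq k) subset_rfl hf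
        have : Nonempty (Q k).dom := ⟨d₀⟩
        obtain ⟨e', he'⟩ := (hU.isMatch k).exists_leftInv
        have himg : (g ∘ e') '' (e k '' Set.univ) = g '' Set.univ := by
          rw [Set.image_comp, Word.IsMatch.image_image he']
        have hm := ((hU.isMatch k).symm he').comp (g := g) (by
          rw [Word.IsMatch.image_image he']; exact ht.right)
        rw [one_mul] at hm
        refine ⟨x, δ, f, g ∘ e', ht.left, ht.left_image, hm, ?_, ?_, ?_, ?_⟩
        · rw [himg, ht.right_image]
          exact Coi.ordConnected_hull _ _
        · rintro a ha _ ⟨d, -, rfl⟩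
          refine (hι _ _).trans ((hPe k hf a ha d).trans ?_)
          rw [Function.comp_apply, he' d trivial]
          exact ht.rel_iff a d
        · intro a ha v hv
          obtain ⟨d, rfl, -⟩ := ht.exists_of_rel_left ha hv
          rw [himg]
          exact ⟨d, trivial, rfl⟩
        · rintro _ ⟨d, -, rfl⟩ c hc
          rw [Function.comp_apply, he' d trivial] at hc
          obtain ⟨a, ha, rfl, -⟩ := ht.exists_of_rel_right hc
          exact ⟨a, ha, rfl⟩

end

/-! ### The extension theorem -/

section

variable {G : ℕ → Type u} {K : ℕ → Type v} [∀ n, Group (G n)] [∀ n, Group (K n)]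

theorem Word.IsOmegaConcat.exists_label {W : Word G} {V : ℕ → Word G} (h : W.IsOmegaConcat V)
    (hV : ∀ m, ¬ (V m).Same Word.empty) : ∃ p : W.dom → ℕ, Monotone p ∧ Function.Surjective p ∧
      ∀ m, W.seg (p ⁻¹' {m}) = TopProd.mk (V m) := by
  obtain ⟨e, he⟩ := h
  have hm : ∀ m, IsMatch (V m) W 1 (fun d => e.symm (toLex ⟨m, d⟩)) Set.univ := by
    intro m
    refine ⟨fun a _ b _ hab => (signedLT_one _ _).mpr (e.symm.lt_iff_lt.mpr
      (Sigma.Lex.lt_def.mpr (Or.inr ⟨rfl, hab⟩))), fun a _ => ?_⟩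
    rw [he, e.apply_symm_apply, Letter.signed_one]
    rfl
  have himg : ∀ m, (fun d => e.symm (toLex ⟨m, d⟩)) '' Set.univ =
      (fun i => (ofLex (e i)).1) ⁻¹' {m} := by
    intro m
    ext i
    constructor
    · rintro ⟨d, -, rfl⟩
      change (ofLex (e (e.symm (toLex ⟨m, d⟩)))).1 = m
      rw [e.apply_symm_apply]
      rfl
    · rintro rfl
      exact ⟨(ofLex (e i)).2, trivial, e.symm_apply_apply i⟩
  refine ⟨fun i => (ofLex (e i)).1, ?_, ?_, ?_⟩
  · intro i j hij
    rcases Sigma.Lex.le_def.mp (e.monotone hij) with h | ⟨h, -⟩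
    · exact h.le
    · exact h.le
  · intro m
    by_contra hm'
    have hE : IsEmpty (V m).dom := ⟨fun d => hm' ⟨e.symm (toLex ⟨m, d⟩), by
      dsimp only
      rw [e.apply_symm_apply]
      rfl⟩⟩
    exact hV m (same_of_strictMono (fun d => hE.elim d) (fun d => hE.elim d)
      (fun d => Empty.elim d) (fun d => hE.elim d))
  · intro m
    rw [← himg, ← seg_univ, (hm m).seg_eq]
    simp

/-- A matched final segment contains all blocks from some point on, and these together form a piece.
The finitely many earlier blocks lie in the subgroup as well, so `W` would belong to `Fine`. -/
theorem avoidsTails_of_notMem_fine {X : Type w} (Wf : X → Red G) (W : Red G)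
    {p : W.1.dom → ℕ} (hp : Monotone p) (hs : Function.Surjective p)
    (hmem : ∀ m, W.1.seg (p ⁻¹' {m}) ∈ Word.subwordGroup Wf) (hW : W ∉ Fine Wf) :
    Word.AvoidsTails (fun x => (Wf x).1) W.1 := by
  intro x δ f I hI hIt hfI hf
  have hinit : ∀ n, W.1.seg (p ⁻¹' Set.Iio n) ∈ Word.subwordGroup Wf := by
    intro n
    induction n with
    | zero =>
      have : p ⁻¹' Set.Iio 0 = ∅ :=
        Set.eq_empty_of_forall_notMem fun i hi => Nat.not_lt_zero _ hi
      rw [this, Word.seg_empty]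
      exact one_mem _
    | succ n ih =>
      have : p ⁻¹' Set.Iio (n + 1) = p ⁻¹' Set.Iio n ∪ p ⁻¹' {n} := by
        rw [← Set.preimage_union]
        congr 1
        ext k
        simp only [Set.mem_Iio, Set.mem_union, Set.mem_singleton_iff]
        omega
      rw [this, Word.seg_union]
      · exact mul_mem ih (hmem n)
      · intro a ha b hb
        refine hp.reflect_lt ?_
        have h1 : p a < n := ha
        have h2 : p b = n := hb
        omega
  obtain ⟨i₀, -⟩ := hs 0
  obtain ⟨i, hi, -⟩ := hIt i₀
  have hsub : p ⁻¹' Set.Ioi (p i) ⊆ I := by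
    intro j hj
    obtain ⟨k, hk, hjk⟩ := hIt j
    exact hI.out hi hk ⟨(hp.reflect_lt hj).le, hjk.le⟩
  have hc : (p ⁻¹' Set.Ioi (p i)).OrdConnected := Set.ordConnected_Ioi.preimage_mono hp
  have htail : W.1.seg (p ⁻¹' Set.Ioi (p i)) ∈ Word.subwordGroup Wf :=
    Word.IsPiece.seg_mem ⟨x, δ, f, hf.mono hsub, hf.ordConnected_image hfI hsub hc⟩
  apply hW
  change TopProd.mk W.1 ∈ Word.subwordGroup Wf
  have huniv : (Set.univ : Set W.1.dom) =
      p ⁻¹' Set.Iio (p i + 1) ∪ p ⁻¹' Set.Ioi (p i) := by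
    ext j
    simp only [Set.mem_univ, Set.mem_union, Set.mem_preimage, Set.mem_Iio, Set.mem_Ioi, true_iff]
    omega
  rw [← Word.seg_univ, huniv, Word.seg_union]
  · exact mul_mem (hinit _) htail
  · intro a ha b hb
    refine hp.reflect_lt ?_
    have h1 : p a < p i + 1 := ha
    have h2 : p i < p b := hb
    omega

theorem exists_coherent_extension (hK : ∀ n, ∃ k : K n, ¬ IsOfFinOrder k) {X : Type w}
    (hX : Cardinal.mk X < Cardinal.continuum) (T : X → CoiTriple G K)
    (hT : Coherent (Set.range T)) (W : Red G) (V : ℕ → Red G)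
    (hWV : W.1.IsOmegaConcat (fun m => (V m).1)) (hV : ∀ m, ¬ (V m).1.Same Word.empty)
    (hVF : ∀ m, V m ∈ Fine (fun x => (T x).left)) (hW : W ∉ Fine (fun x => (T x).left)) :
    ∃ (U : Red K) (ι : Coi W.1.dom U.1.dom), Coherent (Set.range T ∪ {⟨W, U, ι⟩}) := by
  obtain ⟨p, hp, hps, hpV⟩ := hWV.exists_label hV
  have hmem : ∀ m, W.1.seg (p ⁻¹' {m}) ∈ Word.subwordGroup (fun x => (T x).left) := fun m => by
    rw [hpV]
    exact hVF m
  obtain ⟨q, b, hq, hqt, hb, hb1, hbt, hfib⟩ := exists_piece_decomposition T W p hp hps hmem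
  obtain ⟨U, ι, r, r', hA, hU⟩ := exists_assembled hX T hK W q b hq hqt hb hb1 hbt hfib
  exact ⟨U, ι, hA.coherent hT (avoidsTails_of_notMem_fine _ W hp hps hmem hW) hU⟩

theorem Coherent.symm {S : Set (CoiTriple G K)} (h : Coherent S) :
    Coherent (CoiTriple.symm '' S) := by
  rintro _ ⟨s, hs, rfl⟩ _ ⟨t, ht, rfl⟩
  exact ⟨(h s hs t ht).2, (h s hs t ht).1⟩

end

end TopologistsProduct

open TopologistsProduct
theorem mainTheorem5 {G : ℕ → Type u} {K : ℕ → Type v} [∀ n, Group (G n)] [∀ n, Group (K n)]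
    (hG : ∀ n, ∃ g : G n, ¬ IsOfFinOrder g) (hK : ∀ n, ∃ k : K n, ¬ IsOfFinOrder k)
    {X : Type w} (hX : Cardinal.mk X < Cardinal.continuum)
    (T : X → CoiTriple G K) (hT : Coherent (Set.range T)) :
    (∀ (W : Red G) (V : ℕ → Red G),
      W.1.IsOmegaConcat (fun m => (V m).1) →
      (∀ m, ¬ (V m).1.Same Word.empty) →
      (∀ m, V m ∈ Fine (fun x => (T x).left)) →
      W ∉ Fine (fun x => (T x).left) →
      ∃ (U : Red K) (ι : Coi W.1.dom U.1.dom),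
        Coherent (Set.range T ∪ {⟨W, U, ι⟩})) ∧
    (∀ (U : Red K) (V : ℕ → Red K),
      U.1.IsOmegaConcat (fun m => (V m).1) →
      (∀ m, ¬ (V m).1.Same Word.empty) →
      (∀ m, V m ∈ Fine (fun x => (T x).right)) →
      U ∉ Fine (fun x => (T x).right) →
      ∃ (W : Red G) (ι : Coi W.1.dom U.1.dom),
        Coherent (Set.range T ∪ {⟨W, U, ι⟩})) := by
  -- The second half is the first one for the inverted triples, inverted back at the end.
  refine ⟨exists_coherent_extension hK hX T hT, fun U V hUV hV hVF hU => ?_⟩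
  have hT' : Coherent (Set.range fun x => (T x).symm) := by
    have := hT.symm
    rwa [← Set.range_comp] at this
  obtain ⟨W, ι, h⟩ := exists_coherent_extension hG hX (fun x => (T x).symm) hT' U V hUV hV hVF hU
  refine ⟨W, ι.symm, ?_⟩
  have h' := h.symm
  rwa [Set.image_union, ← Set.range_comp, Set.image_singleton] at h'
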